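/- Let $n\ge 1$ and let $\omega$ be a weight in the Muckenhoupt class $A_2(\mathbb{R}^n,\mathrm dx)$, i.e. $\omega:\mathbb{R}^n\to(0,\infty)$ is measurable and $\sup_Q\big(\frac1{|Q|}\int_Q\omega\,\mathrm dx\big)\big(\frac1{|Q|}\int_Q\omega^{-1}\,\mathrm dx\big)<\infty$ over all cubes $Q$ with sides parallel to the axes. Write $\mathrm d\omega=\omega(x)\,\mathrm dx$, $\mathrm d\mu=\omega(x)\,\mathrm dx\,\mathrm dt$, $L^p_\omega=L^p(\mathbb{R}^n,\mathrm d\omega)$ (complex-valued functions), $\langle f,g\rangle_{2,\omega}=\int f\overline g\,\mathrm d\omega$, and let $H^1_\omega(\mathbb{R}^n)$ be the space of $f\in L^2_\omega$ whose distributional gradient lies in $(L^2_\omega)^n$. Let $A:\mathbb{R}\times\mathbb{R}^n\to M_n(\mathbb{C})$ be measurable and let $M,\nu>0$ be such that, for all $(t,x)\in\mathbb{R}\times\mathbb{R}^n$ and $\xi,\zeta\in\mathbb{C}^n$, $$|A(t,x)\xi\cdot\zeta|\le M\omega(x)|\xi||\zeta|,\qquad \nu|\xi|^2\omega(x)\le\mathrm{Re}\,(A(t,x)\xi\cdot\overline\xi).$$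 Put $\mathcal{H}=\partial_t-\omega^{-1}\mathrm{div}_x(A(t,\cdot)\nabla_x)$ and $\mathcal{H}^\star=-\partial_s-\omega^{-1}\mathrm{div}_x(A^\star(s,\cdot)\nabla_x)$, where $A^\star$ is the hermitian adjoint of $A$. The equation $\mathcal{H}u=g$ in $\mathcal{D}'(\mathbb{R}\times\mathbb{R}^n)$ means $\iint(-u\,\partial_t\varphi+\omega^{-1}A\nabla_xu\cdot\nabla_x\varphi)\,\mathrm d\mu=\iint g\varphi\,\mathrm d\mu$ for all $\varphi\in\mathcal{D}(\mathbb{R}\times\mathbb{R}^n)$, and $\mathcal{H}^\star u=g$ means $\iint(u\,\partial_s\varphi+\omega^{-1}A^\star\nabla_xu\cdot\nabla_x\varphi)\,\mathrm d\mu=\iint g\varphi\,\mathrm d\mu$ for all such $\varphi$. Let $\Gamma=(\Gamma(t,s))_{t,s\in\mathbb{R}}$ be the fundamental solution of $\mathcal{H}$, that is, a family of bounded operators on $L^2_\omega(\mathbb{R}^n)$ with 1. $\sup_{t,s}\|\Gamma(t,s)\|<\infty$; 2. $\Gamma(t,s)=0$ if $s>t$; 3. $(t,s)\mapsto\langle\Gamma(t,s)\psi,\tilde\psi\rangle_{2,\omega}$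 is Borel measurable for all $\psi,\tilde\psi\in\mathcal{D}(\mathbb{R}^n)$; 4. for all $\phi\in\mathcal{D}(\mathbb{R})$ and $\psi\in\mathcal{D}(\mathbb{R}^n)$, every $u\in L^1_{\mathrm{loc}}(\mathbb{R};H^1_\omega(\mathbb{R}^n))$ with $\int_{\mathbb{R}}\|\nabla_xu(t)\|_{2,\omega}^2\,\mathrm dt<\infty$ and $\mathcal{H}u=\phi\otimes\psi$ in $\mathcal{D}'(\mathbb{R}\times\mathbb{R}^n)$ satisfies, for every $\tilde\psi\in\mathcal{D}(\mathbb{R}^n)$, $\langle u(t),\tilde\psi\rangle_{2,\omega}=\int_{-\infty}^t\phi(s)\langle\Gamma(t,s)\psi,\tilde\psi\rangle_{2,\omega}\,\mathrm ds$ for almost every $t\in\mathbb{R}$. Let $\tilde\Gamma=(\tilde\Gamma(s,t))_{s,t\in\mathbb{R}}$ be the fundamental solution of $\mathcal{H}^\star$, defined in the same way: it is uniformly bounded, weakly Borel measurable as in 3, $\tilde\Gamma(s,t)=0$ if $s>t$, and every $u$ in the same class with $\mathcal{H}^\star u=\phi\otimes\psi$ satisfies $\langle u(s),\tilde\psi\rangle_{2,\omega}=\int_s^{\infty}\phi(t)\langle\tilde\Gamma(s,t)\psi,\tilde\psi\rangle_{2,\omega}\,\mathrm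 dt$ for almost every $s\in\mathbb{R}$. As these properties determine the families only up to null sets of pairs $(t,s)$, the representatives are chosen, as usual, so that for all $\psi,\tilde\psi\in L^2_\omega(\mathbb{R}^n)$ the functions $\langle\Gamma(t,s)\psi,\tilde\psi\rangle_{2,\omega}$ and $\langle\tilde\Gamma(s,t)\psi,\tilde\psi\rangle_{2,\omega}$ are continuous in $t\in[s,\infty)$ for each fixed $s$, and in $s\in(-\infty,t]$ for each fixed $t$. Then for all $t\ge s$ the following hold. * $\Gamma(t,s)1=1$ in $L^2_{\omega,\mathrm{loc}}(\mathbb{R}^n)$: for every compact $K\subset\mathbb{R}^n$, $\Gamma(t,s)\mathbf 1_{B(0,R)}\to1$ in $L^2_\omega(K)$ as $R\to\infty$. In dual form: for every $\psi\in L^2_\omega(\mathbb{R}^n)$ with compact support, $\tilde\Gamma(s,t)\psi\in L^1_\omega(\mathbb{R}^n)$ and $$\int_{\mathbb{R}^n}(\tilde\Gamma(s,t)\psi)(x)\,\mathrm d\omega(x)=\int_{\mathbb{R}^n}\psi(x)\,\mathrm d\omega(x).$$ * Similarly $\tilde\Gamma(s,t)1=1$ in $L^2_{\omega,\mathrm{loc}}(\mathbb{R}^n)$: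 for every compact $K$, $\tilde\Gamma(s,t)\mathbf 1_{B(0,R)}\to1$ in $L^2_\omega(K)$ as $R\to\infty$; in dual form, for every $\psi\in L^2_\omega(\mathbb{R}^n)$ with compact support, $\Gamma(t,s)\psi\in L^1_\omega(\mathbb{R}^n)$ and $\int_{\mathbb{R}^n}\Gamma(t,s)\psi\,\mathrm d\omega=\int_{\mathbb{R}^n}\psi\,\mathrm d\omega$. -/

import Mathlib

open MeasureTheory Filter Topology Set
open scoped ENNReal NNReal

noncomputable section

namespace DegenerateParabolic

/-- The Euclidean space `ℝⁿ`. -/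
abbrev Rn (n : ℕ) : Type := EuclideanSpace ℝ (Fin n)

/-- The closed cube with sides parallel to the axes, lower corner `a` and side length `l`. -/
def cube {n : ℕ} (a : Rn n) (l : ℝ) : Set (Rn n) := {x | ∀ i, a i ≤ x i ∧ x i ≤ a i + l}

/-- The Muckenhoupt class `A₂(ℝⁿ, dx)`: (Lebesgue) measurable, positive functions with
`sup_Q (⨍_Q ω) (⨍_Q ω⁻¹) < ∞` over all cubes with sides parallel to the axes. -/
structure IsA2 {n : ℕ} (ω : Rn n → ℝ) : Prop where
  aemeasurable : AEMeasurable ω volume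
  pos : ∀ x, 0 < ω x
  bound : ∃ C : ℝ≥0, ∀ (a : Rn n) (l : ℝ), 0 < l →
    ((∫⁻ x in cube a l, ENNReal.ofReal (ω x)) / volume (cube a l)) *
      ((∫⁻ x in cube a l, ENNReal.ofReal (ω x)⁻¹) / volume (cube a l)) ≤ (C : ℝ≥0∞)

/-- The weighted measure `dω = ω(x) dx`. -/
def wMeasure {n : ℕ} (ω : Rn n → ℝ) : Measure (Rn n) :=
  volume.withDensity fun x => ENNReal.ofReal (ω x)

/-- The Hilbert space `L²_ω(ℝⁿ)` of complex-valued functions. -/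
abbrev L2w {n : ℕ} (ω : Rn n → ℝ) : Type := Lp ℂ 2 (wMeasure ω)

/-- The space `L²_ω(ℝⁿ)ⁿ` of complex vector fields. -/
abbrev L2wVec {n : ℕ} (ω : Rn n → ℝ) : Type := Lp (EuclideanSpace ℂ (Fin n)) 2 (wMeasure ω)

/-- The test functions `𝒟(V)`: complex-valued, smooth, compactly supported. -/
def IsTest {V : Type*} [NormedAddCommGroup V] [NormedSpace ℝ V] (φ : V → ℂ) : Prop :=
  ContDiff ℝ ((⊤ : ℕ∞) : WithTop ℕ∞) φ ∧ HasCompactSupport φ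

/-- An element of `L²_ω(ℝⁿ)` that is (the class of) a test function. -/
def IsTestL2 {n : ℕ} {ω : Rn n → ℝ} (ψ : L2w ω) : Prop :=
  ∃ φ : Rn n → ℂ, IsTest φ ∧ (ψ : Rn n → ℂ) =ᵐ[wMeasure ω] φ

/-- The partial derivative `∂_i φ` of a function on `ℝⁿ`. -/
def partialX {n : ℕ} (i : Fin n) (φ : Rn n → ℂ) (x : Rn n) : ℂ :=
  fderiv ℝ φ x (EuclideanSpace.single i 1)

/-- The classical gradient of a function on `ℝⁿ`. -/
def gradX {n : ℕ} (φ : Rn n → ℂ) (x : Rn n) : Fin n → ℂ := fun i => partialX i φ x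

/-- `G ∈ L²_ω(ℝⁿ)ⁿ` is the distributional gradient of `f ∈ L²_ω(ℝⁿ)` (with respect to `dx`);
thus `f ∈ H¹_ω(ℝⁿ)` with `∇f = G`. -/
def IsWeakGrad {n : ℕ} {ω : Rn n → ℝ} (f : L2w ω) (G : L2wVec ω) : Prop :=
  ∀ φ : Rn n → ℂ, IsTest φ → ∀ i : Fin n,
    ∫ x, f x * partialX i φ x = - ∫ x, G x i * φ x

/-- The conditions on the coefficients: measurability, and for all `ξ, ζ ∈ ℂⁿ`
`|Aξ · ζ| ≤ M ω |ξ| |ζ|` and `ν |ξ|² ω ≤ Re (Aξ · ξ̄)`. -/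
structure IsElliptic {n : ℕ} (ω : Rn n → ℝ) (A : ℝ → Rn n → Matrix (Fin n) (Fin n) ℂ)
    (M ν : ℝ) : Prop where
  aemeasurable : ∀ i j, AEMeasurable (fun p : ℝ × Rn n => A p.1 p.2 i j) volume
  M_pos : 0 < M
  ν_pos : 0 < ν
  upper : ∀ (t : ℝ) (x : Rn n) (ξ ζ : EuclideanSpace ℂ (Fin n)),
    ‖(A t x).mulVec ξ.ofLp ⬝ᵥ ζ.ofLp‖ ≤ M * ω x * ‖ξ‖ * ‖ζ‖
  lower : ∀ (t : ℝ) (x : Rn n) (ξ : EuclideanSpace ℂ (Fin n)),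
    ν * ‖ξ‖ ^ 2 * ω x ≤ ((A t x).mulVec ξ.ofLp ⬝ᵥ star ξ.ofLp).re

/-- `u ∈ L¹_loc(ℝ; H¹_ω(ℝⁿ))` with `∫_ℝ ‖∇ₓ u(t)‖²_{2,ω} dt < ∞`, where `G = ∇ₓ u`. -/
structure IsEnergyClass {n : ℕ} {ω : Rn n → ℝ} (u : ℝ → L2w ω) (G : ℝ → L2wVec ω) : Prop where
  locallyIntegrable : LocallyIntegrable u volume
  grad : ∀ᵐ t : ℝ, IsWeakGrad (u t) (G t)
  grad_memLp : MemLp G 2 volume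

/-- `∂_t u - ω⁻¹ div_x(A ∇ₓ u) = φ ⊗ ψ` in `𝒟'(ℝ × ℝⁿ)`, where `G = ∇ₓ u` and the distributional
bracket is taken with respect to `dμ = ω(x) dx dt`. -/
def SolvesForward {n : ℕ} {ω : Rn n → ℝ} (A : ℝ → Rn n → Matrix (Fin n) (Fin n) ℂ)
    (u : ℝ → L2w ω) (G : ℝ → L2wVec ω) (φ : ℝ → ℂ) (ψ : L2w ω) : Prop :=
  ∀ Φ : ℝ × Rn n → ℂ, IsTest Φ →
    ∫ t, ∫ x, (-(u t x * deriv (fun τ => Φ (τ, x)) t) +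
        ((ω x)⁻¹ : ℂ) * ((A t x).mulVec (G t x).ofLp ⬝ᵥ gradX (fun y => Φ (t, y)) x))
          ∂(wMeasure ω)
      = ∫ t, ∫ x, φ t * ψ x * Φ (t, x) ∂(wMeasure ω)

/-- `-∂_s u - ω⁻¹ div_x(A⋆ ∇ₓ u) = φ ⊗ ψ` in `𝒟'(ℝ × ℝⁿ)`, where `G = ∇ₓ u` and `A⋆` is the
hermitian adjoint of `A`. -/
def SolvesBackward {n : ℕ} {ω : Rn n → ℝ} (A : ℝ → Rn n → Matrix (Fin n) (Fin n) ℂ)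
    (u : ℝ → L2w ω) (G : ℝ → L2wVec ω) (φ : ℝ → ℂ) (ψ : L2w ω) : Prop :=
  ∀ Φ : ℝ × Rn n → ℂ, IsTest Φ →
    ∫ s, ∫ x, (u s x * deriv (fun τ => Φ (τ, x)) s +
        ((ω x)⁻¹ : ℂ) * ((A s x).conjTranspose.mulVec (G s x).ofLp ⬝ᵥ
          gradX (fun y => Φ (s, y)) x)) ∂(wMeasure ω)
      = ∫ s, ∫ x, φ s * ψ x * Φ (s, x) ∂(wMeasure ω)

/-- Fundamental solution of `ℋ = ∂_t - ω⁻¹ div_x(A ∇ₓ)`. The pairing `⟨f, g⟩ = ∫ f ḡ dω` is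
`inner ℂ g f`. -/
structure IsFundamentalSolution {n : ℕ} (ω : Rn n → ℝ)
    (A : ℝ → Rn n → Matrix (Fin n) (Fin n) ℂ) (Γ : ℝ → ℝ → (L2w ω →L[ℂ] L2w ω)) : Prop where
  bounded : ∃ C : ℝ, ∀ t s, ‖Γ t s‖ ≤ C
  causal : ∀ t s, t < s → Γ t s = 0
  measurable : ∀ ψ ψ' : L2w ω, IsTestL2 ψ → IsTestL2 ψ' →
    Measurable fun p : ℝ × ℝ => inner ℂ ψ' (Γ p.1 p.2 ψ)
  represents : ∀ (φ : ℝ → ℂ) (ψ : L2w ω), IsTest φ → IsTestL2 ψ →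
    ∀ (u : ℝ → L2w ω) (G : ℝ → L2wVec ω), IsEnergyClass u G → SolvesForward A u G φ ψ →
      ∀ ψ' : L2w ω, IsTestL2 ψ' →
        ∀ᵐ t : ℝ, inner ℂ ψ' (u t) = ∫ s in Iic t, φ s * inner ℂ ψ' (Γ t s ψ)

/-- Fundamental solution of the backward operator `ℋ⋆ = -∂_s - ω⁻¹ div_x(A⋆ ∇ₓ)`. -/
structure IsFundamentalSolutionStar {n : ℕ} (ω : Rn n → ℝ)
    (A : ℝ → Rn n → Matrix (Fin n) (Fin n) ℂ) (Γ' : ℝ → ℝ → (L2w ω →L[ℂ] L2w ω)) : Prop where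
  bounded : ∃ C : ℝ, ∀ s t, ‖Γ' s t‖ ≤ C
  causal : ∀ s t, t < s → Γ' s t = 0
  measurable : ∀ ψ ψ' : L2w ω, IsTestL2 ψ → IsTestL2 ψ' →
    Measurable fun p : ℝ × ℝ => inner ℂ ψ' (Γ' p.1 p.2 ψ)
  represents : ∀ (φ : ℝ → ℂ) (ψ : L2w ω), IsTest φ → IsTestL2 ψ →
    ∀ (u : ℝ → L2w ω) (G : ℝ → L2wVec ω), IsEnergyClass u G → SolvesBackward A u G φ ψ →
      ∀ ψ' : L2w ω, IsTestL2 ψ' →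
        ∀ᵐ s : ℝ, inner ℂ ψ' (u s) = ∫ t in Ici s, φ t * inner ℂ ψ' (Γ' s t ψ)

/-- Choice of the representative. The defining properties of a fundamental solution see the family
only up to a null set of pairs `(t, s)`; the fundamental solution is the one representative which
is separately weakly continuous on `{(t, s) | s ≤ t}`. Here `S t s` is the operator attached to
the pair of times `s ≤ t`. -/
structure IsWeaklyContinuous {n : ℕ} {ω : Rn n → ℝ} (S : ℝ → ℝ → (L2w ω →L[ℂ] L2w ω)) :
    Prop where
  in_t : ∀ (s : ℝ) (ψ ψ' : L2w ω), ContinuousOn (fun t => inner ℂ ψ' (S t s ψ)) (Ici s)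
  in_s : ∀ (t : ℝ) (ψ ψ' : L2w ω), ContinuousOn (fun s => inner ℂ ψ' (S t s ψ)) (Iic t)

/-- An element of `L²_ω(ℝⁿ)` with compact support. -/
def HasCompactSupportL2 {n : ℕ} {ω : Rn n → ℝ} (ψ : L2w ω) : Prop :=
  ∃ K : Set (Rn n), IsCompact K ∧ ∀ᵐ x ∂(wMeasure ω), x ∉ K → ψ x = 0

theorem IsA2.measure_ball_ne_top {n : ℕ} {ω : Rn n → ℝ} (hω : IsA2 ω) (R : ℝ) :
    wMeasure ω (Metric.ball 0 R) ≠ ∞ := by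
  obtain ⟨C, hC⟩ := hω.bound
  set r : ℝ := max R 1 with hr
  have hr0 : 0 < r := lt_of_lt_of_le one_pos (le_max_right _ _)
  set a : Rn n := WithLp.toLp 2 (fun _ => -r) with ha
  have hsub : Metric.ball (0 : Rn n) r ⊆ cube a (2 * r) := by
    intro x hx i
    have h1 : ‖x‖ < r := by simpa using hx
    have h2 : |x i| ≤ ‖x‖ := by simpa using PiLp.norm_apply_le x i
    have h3 := abs_le.mp (h2.trans h1.le)
    have h4 : a i = -r := rfl
    rw [h4]
    constructor <;> linarith [h3.1, h3.2]
  have hV0 : volume (cube a (2 * r)) ≠ 0 :=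
    (lt_of_lt_of_le (Metric.measure_ball_pos volume 0 hr0) (measure_mono hsub)).ne'
  have hVtop : volume (cube a (2 * r)) ≠ ∞ := by
    have hc : IsCompact (cube a (2 * r)) := by
      have h : cube a (2 * r) = (EuclideanSpace.equiv (Fin n) ℝ).toHomeomorph ⁻¹'
          (Set.pi univ fun i => Icc (a i) (a i + 2 * r)) := by
        ext x
        simp only [cube, mem_ofPred_eq, mem_preimage, mem_univ_pi, mem_Icc]
        rfl
      rw [h, Homeomorph.isCompact_preimage]
      exact isCompact_univ_pi fun i => isCompact_Icc
    exact hc.measure_lt_top.ne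
  have hinv : (∫⁻ x in cube a (2 * r), ENNReal.ofReal (ω x)⁻¹) ≠ 0 := by
    intro h0
    have hm : AEMeasurable (fun x => ENNReal.ofReal (ω x)⁻¹)
        (volume.restrict (cube a (2 * r))) := hω.aemeasurable.inv.ennreal_ofReal.restrict
    rw [lintegral_eq_zero_iff' hm] at h0
    have h1 : ∀ᵐ x ∂(volume.restrict (cube a (2 * r))), False := by
      filter_upwards [h0] with x hx
      have := inv_pos.mpr (hω.pos x)
      simp only [Pi.zero_apply, ENNReal.ofReal_eq_zero] at hx
      linarith
    rw [ae_iff] at h1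
    simp at h1
    exact hV0 h1
  have hfin : (∫⁻ x in cube a (2 * r), ENNReal.ofReal (ω x)) ≠ ∞ := by
    intro htop
    have h := hC a (2 * r) (by linarith)
    rw [htop, ENNReal.top_div_of_ne_top hVtop,
      ENNReal.top_mul (ENNReal.div_ne_zero.mpr ⟨hinv, hVtop⟩)] at h
    exact ENNReal.coe_ne_top (top_le_iff.mp h)
  rw [wMeasure, withDensity_apply _ Metric.isOpen_ball.measurableSet]
  exact ne_top_of_le_ne_top hfin (lintegral_mono_set
    ((Metric.ball_subset_ball (le_max_left _ _)).trans hsub))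

/-- The indicator function of the ball `B(0, R)`, as an element of `L²_ω(ℝⁿ)`. -/
def ballOne {n : ℕ} {ω : Rn n → ℝ} (hω : IsA2 ω) (R : ℝ) : L2w ω :=
  indicatorConstLp 2 Metric.isOpen_ball.measurableSet (hω.measure_ball_ne_top R) (1 : ℂ)

/-- `T 1 = 1` in `L²_{ω,loc}(ℝⁿ)`, where `T 1` is the limit of `T 1_{B(0,R)}` in
`L²_ω(K)`, for every compact `K`, as `R → ∞`. -/
def PreservesOne {n : ℕ} {ω : Rn n → ℝ} (hω : IsA2 ω) (T : L2w ω →L[ℂ] L2w ω) : Prop :=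
  ∀ K : Set (Rn n), IsCompact K →
    Tendsto (fun R : ℝ => eLpNorm (fun x => T (ballOne hω R) x - 1) 2 ((wMeasure ω).restrict K))
      atTop (𝓝 0)

/-- `T` preserves integrals: for each compactly supported `ψ ∈ L²_ω`, `Tψ ∈ L¹_ω` and
`∫ Tψ dω = ∫ ψ dω`. -/
def PreservesIntegral {n : ℕ} {ω : Rn n → ℝ} (T : L2w ω →L[ℂ] L2w ω) : Prop :=
  ∀ ψ : L2w ω, HasCompactSupportL2 ψ →
    Integrable (T ψ : Rn n → ℂ) (wMeasure ω) ∧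
      ∫ x, T ψ x ∂(wMeasure ω) = ∫ x, ψ x ∂(wMeasure ω)

end DegenerateParabolic

end

/-! Formally, testing the equation of u = Γ(·, s)ψ against the constant 1 gives d/dt ∫ u dω = 0,
because the divergence term only sees ∇1 = 0. The constant is not an admissible test function; it is
replaced by cutoffs χ_R with |∇χ_R| ≤ B/R, and what has to be shown is that the resulting flux term
vanishes as R → ∞.

This follows from decay of u and ∇u in space. If |∇E| ≤ δE, the energy method with multiplier E²
bounds Eu and E∇u in L²_ω by Eψ, with a constant that grows exponentially in time at a rate
proportional to δ² (`energy_le`, `StrongSol.energy_estimate`). The weight is E = (1 + |x|²)^(n+1),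
truncated so as to be bounded; δ = n + 1 serves for all truncations (`isWeight_truncWeight`). An A₂
weight has polynomial growth, so E⁻¹ ∈ L²_ω (`memLp_inv_growthWeight`). Hence Γ(t, s)ψ is integrable
for compactly supported ψ, and the flux term is at most a constant times ‖E⁻¹∇χ_R‖ = O(1/R)
(`HasWeightedBounds.integral_eq`).

Preservation of 1 by the adjoint T' of a mass-conserving T is a quantitative form of duality. For ψ
= 1_K (T'1_B - 1), conservation of mass gives ‖ψ‖² = -∫ Tψ dω over the complement of B, and the
decay of Tψ makes this at most ‖ψ‖ times a quantity tending to 0 (`HasWeightedBounds.preservesOne`).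

The families Γ and Γ̃ are only known to represent energy solutions, and such solutions are not
regular enough to be multiplied by themselves. Representation with zero source gives uniqueness in
the energy class for both equations. Uniqueness for the adjoint equation is a density statement for
the range of the operator; together with coercivity it produces, for every test source, a solution
that is a limit of test functions whose sources converge in a dual norm (`coercive`,
`exists_strong_solution`). All computations are made on these test functions. They yield estimates
for averages of ⟨Γ(t, s)ψ, χ⟩ in s and t, which separate weak continuity concentrates at a single
pair of times (`IsPropagator.norm_inner_sub_le`). Testing the solutions of the two equations against
each other shows that Γ̃(s, t) is the adjoint of Γ(t, s) (`IsPropagator.inner_comm`).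

A sign σ = ±1 in front of ∂_t treats both time directions at once; "later" then means larger σt. -/

noncomputable section

namespace DegenerateParabolic

/-! ### The weighted measure: growth of `A₂` weights, density of test functions. -/

section WeightedMeasure

variable {n : ℕ} {ω : Rn n → ℝ}

/-- The class `A₂` is stable under `ω ↦ ω⁻¹`. -/
theorem IsA2.inv (hω : IsA2 ω) : IsA2 fun x => (ω x)⁻¹ where
  aemeasurable := hω.aemeasurable.inv
  pos x := inv_pos.mpr (hω.pos x)
  bound := by
    obtain ⟨C, hC⟩ := hω.bound
    refine ⟨C, fun a l hl => ?_⟩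
    rw [mul_comm]
    simpa using hC a l hl

theorem IsA2.isFiniteMeasureOnCompacts (hω : IsA2 ω) :
    IsFiniteMeasureOnCompacts (wMeasure ω) where
  lt_top_of_isCompact K hK := by
    obtain ⟨R, hR⟩ := hK.isBounded.subset_ball 0
    exact lt_of_le_of_lt (measure_mono hR) (lt_top_iff_ne_top.mpr (hω.measure_ball_ne_top R))

instance [h : Fact (IsA2 ω)] : IsFiniteMeasureOnCompacts (wMeasure ω) :=
  h.out.isFiniteMeasureOnCompacts

instance [h : Fact (IsA2 ω)] : IsLocallyFiniteMeasure (wMeasure ω) :=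
  isLocallyFiniteMeasure_of_isFiniteMeasureOnCompacts

instance : SigmaFinite (wMeasure ω) := by unfold wMeasure; infer_instance

theorem wMeasure_absolutelyContinuous : wMeasure ω ≪ volume :=
  withDensity_absolutelyContinuous _ _

theorem absolutelyContinuous_wMeasure (hω : IsA2 ω) : volume ≪ wMeasure ω :=
  withDensity_absolutelyContinuous' hω.aemeasurable.ennreal_ofReal
    (ae_of_all _ fun x => by simpa using hω.pos x)

theorem integral_wMeasure (hω : IsA2 ω) {E : Type*} [NormedAddCommGroup E] [NormedSpace ℝ E]
    (f : Rn n → E) : ∫ x, f x ∂(wMeasure ω) = ∫ x, ω x • f x := by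
  rw [wMeasure, integral_withDensity_eq_integral_toReal_smul₀ hω.aemeasurable.ennreal_ofReal
    (ae_of_all _ fun _ => ENNReal.ofReal_lt_top)]
  simp_rw [ENNReal.toReal_ofReal (hω.pos _).le]

theorem integrable_wMeasure_iff (hω : IsA2 ω) {E : Type*} [NormedAddCommGroup E] [NormedSpace ℝ E]
    (f : Rn n → E) : Integrable f (wMeasure ω) ↔ Integrable (fun x => ω x • f x) := by
  rw [wMeasure, integrable_withDensity_iff_integrable_smul₀' hω.aemeasurable.ennreal_ofReal
    (ae_of_all _ fun _ => ENNReal.ofReal_lt_top)]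
  simp_rw [ENNReal.toReal_ofReal (hω.pos _).le]

instance : Fact ((2 : ℝ≥0∞) ≠ ∞) := ⟨by simp⟩

theorem volume_cube (a : Rn n) {l : ℝ} : volume (cube a l) = ENNReal.ofReal l ^ n := by
  have h : cube a l = (@WithLp.ofLp 2 (Fin n → ℝ)) ⁻¹'
          (Icc a.ofLp (a.ofLp + fun _ => l)) := by
    ext x
    simp only [cube, mem_ofPred_eq, mem_preimage, mem_Icc, Pi.le_def, Pi.add_apply]
    exact forall_and
  rw [h, (PiLp.volume_preserving_ofLp (Fin n)).measure_preimage
    measurableSet_Icc.nullMeasurableSet, Real.volume_Icc_pi]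
  simp

/-- Polynomial growth of an `A₂` weight. -/
theorem IsA2.exists_measure_ball_le (hω : IsA2 ω) : ∃ C : ℝ≥0∞, C ≠ ∞ ∧
    ∀ R : ℝ, 1 ≤ R → wMeasure ω (Metric.ball 0 R) ≤ C * ENNReal.ofReal R ^ (2 * n) := by
  obtain ⟨C, hC⟩ := hω.bound
  let a : ℝ → Rn n := fun r => WithLp.toLp 2 (fun _ => -r)
  have hball : ∀ r : ℝ, Metric.ball (0 : Rn n) r ⊆ cube (a r) (2 * r) := by
    intro r x hx i
    have h1 : ‖x‖ < r := by simpa using hx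
    have h2 : |x i| ≤ ‖x‖ := by simpa using PiLp.norm_apply_le x i
    have h3 := abs_le.mp (h2.trans h1.le)
    have h4 : a r i = -r := rfl
    rw [h4]
    constructor <;> linarith [h3.1, h3.2]
  have hmono : ∀ r : ℝ, 1 ≤ r → cube (a 1) (2 * 1) ⊆ cube (a r) (2 * r) := by
    intro r hr x hx i
    have := hx i
    have h4 : ∀ r, a r i = -r := fun _ => rfl
    rw [h4] at this ⊢
    constructor <;> linarith [this.1, this.2]
  -- The integral of ω⁻¹ over a large cube is at least its value c over a fixed one, so the A₂ bound
  -- on the large cube reads ω(Q) c ≤ C |Q|², with |Q|² = (2R)^(2n).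
  set c := ∫⁻ x in cube (a 1) (2 * 1), ENNReal.ofReal (ω x)⁻¹ with hc
  have hc0 : c ≠ 0 := by
    intro h0
    have hm : AEMeasurable (fun x => ENNReal.ofReal (ω x)⁻¹)
        (volume.restrict (cube (a 1) (2 * 1))) := hω.aemeasurable.inv.ennreal_ofReal.restrict
    rw [hc, lintegral_eq_zero_iff' hm] at h0
    have h1 : ∀ᵐ x ∂(volume.restrict (cube (a 1) (2 * 1))), False := by
      filter_upwards [h0] with x hx
      have := inv_pos.mpr (hω.pos x)
      simp only [Pi.zero_apply, ENNReal.ofReal_eq_zero] at hx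
      linarith
    rw [ae_iff] at h1
    simp [volume_cube] at h1
  have hctop : c ≠ ∞ := by
    have : cube (a 1) (2 * 1) ⊆ Metric.ball 0 (2 * n + 2) := by
      intro x hx
      rw [mem_ball_zero_iff]
      have h4 : ∀ i, a 1 i = -1 := fun _ => rfl
      have h5 : ‖x‖ ≤ ∑ i, ‖x i‖ := by
        rw [EuclideanSpace.norm_eq]
        refine Real.sqrt_le_iff.mpr ⟨by positivity, ?_⟩
        exact Finset.sum_sq_le_sq_sum_of_nonneg fun i _ => norm_nonneg _
      have h6 : ∑ i, ‖x i‖ ≤ ∑ _i : Fin n, (1 : ℝ) := by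
        refine Finset.sum_le_sum fun i _ => ?_
        have := hx i
        rw [h4] at this
        exact abs_le.mpr ⟨by linarith [this.1], by linarith [this.2]⟩
      simp only [Finset.sum_const, Finset.card_univ, Fintype.card_fin, nsmul_eq_mul, mul_one] at h6
      have : (0 : ℝ) ≤ n := by positivity
      linarith
    have h2 := hω.inv.measure_ball_ne_top (2 * n + 2)
    rw [wMeasure, withDensity_apply _ Metric.isOpen_ball.measurableSet] at h2
    exact ne_top_of_le_ne_top h2 (lintegral_mono_set this)
  refine ⟨C * 2 ^ (2 * n) / c, ENNReal.div_ne_top (ENNReal.mul_ne_top (by simp) (by simp)) hc0,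
    fun R hR => ?_⟩
  have hR0 : 0 < R := by linarith
  have h1 := hC (a R) (2 * R) (by linarith)
  set V := volume (cube (a R) (2 * R)) with hV
  have hV' : V = ENNReal.ofReal (2 * R) ^ n := volume_cube _
  have hV0 : V ≠ 0 := by
    rw [hV']; exact pow_ne_zero _ (by simpa using hR0)
  have hVt : V ≠ ∞ := by rw [hV']; exact ENNReal.pow_ne_top ENNReal.ofReal_ne_top
  have h2 : wMeasure ω (Metric.ball 0 R) ≤ ∫⁻ x in cube (a R) (2 * R), ENNReal.ofReal (ω x) := by
    rw [wMeasure, withDensity_apply _ Metric.isOpen_ball.measurableSet]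
    exact lintegral_mono_set (hball R)
  have h3 : c ≤ ∫⁻ x in cube (a R) (2 * R), ENNReal.ofReal (ω x)⁻¹ :=
    lintegral_mono_set (hmono R hR)
  have h4 : (wMeasure ω (Metric.ball 0 R) / V) * (c / V) ≤ C := by
    refine le_trans ?_ h1
    gcongr
  have h5 : wMeasure ω (Metric.ball 0 R) * c ≤ C * (V * V) := by
    have : wMeasure ω (Metric.ball 0 R) * c =
        (wMeasure ω (Metric.ball 0 R) / V) * (c / V) * (V * V) := by
      rw [show (wMeasure ω (Metric.ball 0 R) / V) * (c / V) * (V * V) =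
        ((wMeasure ω (Metric.ball 0 R) / V) * V) * ((c / V) * V) by ring,
        ENNReal.div_mul_cancel hV0 hVt, ENNReal.div_mul_cancel hV0 hVt]
    rw [this]
    gcongr
  calc wMeasure ω (Metric.ball 0 R) ≤ C * (V * V) / c :=
        (ENNReal.le_div_iff_mul_le (Or.inl hc0) (Or.inl hctop)).mpr h5
    _ = C * 2 ^ (2 * n) / c * ENNReal.ofReal R ^ (2 * n) := by
        rw [hV', ENNReal.ofReal_mul (by norm_num)]
        simp only [ENNReal.ofReal_ofNat, ENNReal.div_eq_inv_mul]
        ring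

/-- The weight `(1 + |x|²)^{n+1}`. -/
def growthWeight (x : Rn n) : ℝ := (1 + ‖x‖ ^ 2) ^ (n + 1)

theorem one_le_growthWeight (x : Rn n) : 1 ≤ growthWeight x :=
  one_le_pow₀ (by nlinarith [sq_nonneg ‖x‖])

theorem growthWeight_pos (x : Rn n) : 0 < growthWeight x :=
  lt_of_lt_of_le one_pos (one_le_growthWeight x)

theorem contDiff_growthWeight : ContDiff ℝ ((⊤ : ℕ∞) : WithTop ℕ∞) (growthWeight (n := n)) := by
  unfold growthWeight
  exact (contDiff_const.add (contDiff_norm_sq ℝ)).pow _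

/-- On the shell k ≤ |x| < k + 1 the squared function is at most (1 + k²)^(-2(n+1)), while the shell
has measure O((k+1)^(2n)). Since (k+1)² ≤ 2(1 + k²), the shell contributes O((k+1)⁻²), which is
summable. -/
theorem memLp_inv_growthWeight (hω : IsA2 ω) :
    MemLp (fun x : Rn n => (growthWeight x)⁻¹) 2 (wMeasure ω) := by
  have hmeas : AEStronglyMeasurable (fun x : Rn n => (growthWeight x)⁻¹) (wMeasure ω) :=
    (contDiff_growthWeight.continuous.inv₀ fun x =>
      (growthWeight_pos x).ne').aestronglyMeasurable
  rw [memLp_two_iff_integrable_sq hmeas]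
  refine ⟨hmeas.pow 2, ?_⟩
  rw [hasFiniteIntegral_iff_ofReal (ae_of_all _ fun x => by positivity)]
  obtain ⟨C, hC, hb⟩ := hω.exists_measure_ball_le
  have huniv : (univ : Set (Rn n)) =
      ⋃ k : ℕ, (Metric.ball 0 (k + 1) \ Metric.ball 0 k) := by
    refine (eq_univ_of_forall fun x => mem_iUnion.mpr ⟨⌊‖x‖⌋₊, ?_⟩).symm
    simp only [Set.mem_sdiff, mem_ball_zero_iff, not_lt]
    exact ⟨Nat.lt_floor_add_one _, Nat.floor_le (norm_nonneg _)⟩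
  rw [← setLIntegral_univ, huniv]
  refine lt_of_le_of_lt (lintegral_iUnion_le _ _) ?_
  have hterm : ∀ k : ℕ, ∫⁻ x in Metric.ball (0 : Rn n) (k + 1) \ Metric.ball 0 k,
      ENNReal.ofReal ((growthWeight x)⁻¹ ^ 2) ∂(wMeasure ω) ≤
      C * ENNReal.ofReal (2 ^ (n + 1) * (1 / ((k : ℝ) + 1) ^ 2)) := by
    intro k
    have hk : (0 : ℝ) ≤ k := by positivity
    calc ∫⁻ x in Metric.ball (0 : Rn n) (k + 1) \ Metric.ball 0 k,
          ENNReal.ofReal ((growthWeight x)⁻¹ ^ 2) ∂(wMeasure ω)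
        ≤ ∫⁻ x in Metric.ball (0 : Rn n) (k + 1) \ Metric.ball 0 k,
          ENNReal.ofReal (((1 + (k : ℝ) ^ 2) ^ (n + 1))⁻¹ ^ 2) ∂(wMeasure ω) := by
          refine setLIntegral_mono' (Metric.isOpen_ball.measurableSet.diff
            Metric.isOpen_ball.measurableSet) fun x hx => ?_
          have hx2 : (k : ℝ) ≤ ‖x‖ := by simpa using hx.2
          unfold growthWeight
          gcongr
      _ ≤ ENNReal.ofReal (((1 + (k : ℝ) ^ 2) ^ (n + 1))⁻¹ ^ 2) *
          (C * ENNReal.ofReal (k + 1) ^ (2 * n)) := by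
          rw [setLIntegral_const]
          gcongr
          exact (measure_mono sdiff_subset).trans (hb _ (by linarith))
      _ ≤ _ := by
          rw [← ENNReal.ofReal_pow (by positivity), mul_left_comm,
            ← ENNReal.ofReal_mul (by positivity)]
          refine mul_le_mul_right (ENNReal.ofReal_le_ofReal ?_) _
          have h2 : ((k : ℝ) + 1) ^ 2 ≤ 2 * (1 + (k : ℝ) ^ 2) := by nlinarith [sq_nonneg ((k:ℝ) - 1)]
          have hq : (1 : ℝ) ≤ 1 + (k : ℝ) ^ 2 := by nlinarith
          rw [inv_pow, inv_mul_eq_div, mul_one_div, div_le_div_iff₀ (by positivity) (by positivity)]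
          calc ((k : ℝ) + 1) ^ (2 * n) * ((k : ℝ) + 1) ^ 2 = (((k : ℝ) + 1) ^ 2) ^ (n + 1) := by
                rw [← pow_mul, ← pow_add]; congr 1
            _ ≤ (2 * (1 + (k : ℝ) ^ 2)) ^ (n + 1) := by gcongr
            _ = 2 ^ (n + 1) * (1 + (k : ℝ) ^ 2) ^ (n + 1) := by rw [mul_pow]
            _ ≤ 2 ^ (n + 1) * ((1 + (k : ℝ) ^ 2) ^ (n + 1)) ^ 2 := by
                gcongr
                exact le_self_pow₀ (one_le_pow₀ hq) (by norm_num)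
  refine lt_of_le_of_lt (ENNReal.tsum_le_tsum hterm) ?_
  rw [ENNReal.tsum_mul_left]
  refine ENNReal.mul_lt_top (lt_top_iff_ne_top.mpr hC) ?_
  have hs : Summable fun k : ℕ => (2 : ℝ) ^ (n + 1) * (1 / ((k : ℝ) + 1) ^ 2) := by
    refine Summable.mul_left _ ?_
    have := (summable_nat_add_iff 1).mpr (Real.summable_one_div_nat_pow.mpr one_lt_two)
    simpa using this
  exact lt_top_iff_ne_top.mpr hs.tsum_ofReal_ne_top

theorem IsTest.memLp [Fact (IsA2 ω)] {φ : Rn n → ℂ} (h : IsTest φ) (p : ℝ≥0∞) :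
    MemLp φ p (wMeasure ω) :=
  h.1.continuous.memLp_of_hasCompactSupport h.2

theorem dense_isTestL2 [Fact (IsA2 ω)] : Dense {ψ : L2w ω | IsTestL2 ψ} := by
  convert Lp.dense_hasCompactSupport_contDiff (F := ℂ) (μ := wMeasure ω) (p := 2) (by simp)
    using 1
  ext f
  exact ⟨fun ⟨g, hg, h⟩ => ⟨g, h, hg.2, hg.1⟩, fun ⟨g, h, h1, h2⟩ => ⟨g, ⟨h2, h1⟩, h⟩⟩

/-- A curve in `L²_ω` vanishes almost everywhere when all its pairings with test functions do. -/
theorem ae_eq_zero_of_inner_test [Fact (IsA2 ω)] {m : Measure ℝ} {u : ℝ → L2w ω}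
    (h : ∀ ψ : L2w ω, IsTestL2 ψ → ∀ᵐ t ∂m, inner ℂ ψ (u t) = 0) : ∀ᵐ t ∂m, u t = 0 := by
  obtain ⟨c, hcs, hcc, hcd⟩ := (dense_isTestL2 (ω := ω)).exists_countable_dense_subset
  have h1 : ∀ᵐ t ∂m, ∀ ψ ∈ c, inner ℂ ψ (u t) = 0 :=
    (ae_ball_iff hcc).mpr fun ψ hψ => h ψ (hcs hψ)
  filter_upwards [h1] with t ht
  exact hcd.eq_zero_of_inner_right (𝕜 := ℂ) fun v hv => ht v hv

/-- Lebesgue integrals of `f φ`, with `φ` a test function, as `dω`-integrals. -/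
theorem integral_mul_eq_wMeasure (hω : IsA2 ω) (f φ : Rn n → ℂ) :
    ∫ x, f x * φ x = ∫ x, f x * (((ω x)⁻¹ : ℝ) * φ x) ∂(wMeasure ω) := by
  rw [integral_wMeasure hω]
  congr 1
  ext x
  have : (ω x : ℂ) ≠ 0 := by exact_mod_cast (hω.pos x).ne'
  simp only [Complex.real_smul, Complex.ofReal_inv]
  field_simp

/-- The square norm is ∫ |φ|² ω⁻¹ dx, finite because ω⁻¹ is again an A₂ weight and so locally
integrable. Distributional pairings with respect to dx thereby become inner products with fixed
vectors of L²_ω. -/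
theorem memLp_inv_mul_test (hω : IsA2 ω) {φ : Rn n → ℂ} (hφc : Continuous φ)
    (hφ : HasCompactSupport φ) :
    MemLp (fun x => (((ω x)⁻¹ : ℝ) : ℂ) * φ x) 2 (wMeasure ω) := by
  have hm : AEStronglyMeasurable (fun x => (((ω x)⁻¹ : ℝ) : ℂ) * φ x) (wMeasure ω) := by
    refine AEStronglyMeasurable.mono_ac wMeasure_absolutelyContinuous ?_
    exact (Complex.measurable_ofReal.comp_aemeasurable
      hω.aemeasurable.inv).aestronglyMeasurable.mul hφc.aestronglyMeasurable
  rw [memLp_two_iff_integrable_sq_norm hm, integrable_wMeasure_iff hω]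
  have : Fact (IsA2 fun x => (ω x)⁻¹) := ⟨hω.inv⟩
  have hcont : Continuous fun x => ‖φ x‖ ^ 2 := hφc.norm.pow 2
  have hsupp : HasCompactSupport fun x => ‖φ x‖ ^ 2 :=
    hφ.comp_left (g := fun z : ℂ => ‖z‖ ^ 2) (by simp)
  have h1 : Integrable (fun x => ‖φ x‖ ^ 2) (wMeasure fun x => (ω x)⁻¹) :=
    hcont.integrable_of_hasCompactSupport hsupp
  have h2 := (integrable_wMeasure_iff hω.inv _).mp h1
  refine h2.congr (ae_of_all _ fun x => ?_)
  have hx := hω.pos x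
  simp only [norm_mul, Complex.norm_real, Real.norm_eq_abs, abs_inv, abs_of_pos hx, smul_eq_mul]
  field_simp

end WeightedMeasure

/-! ### Space-time `L²` functions as curves in `L²_ω`. -/

section TimeSlices

variable {n : ℕ} {ω : Rn n → ℝ}

/-- The space-time measure `dμ = ω(x) dx dt`. -/
abbrev stMeasure (ω : Rn n → ℝ) : Measure (ℝ × Rn n) := (volume : Measure ℝ).prod (wMeasure ω)

section Slices

variable {E : Type*} [NormedAddCommGroup E]

theorem eLpNorm_two_sq {α : Type*} [MeasurableSpace α] (f : α → E) (m : Measure α) :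
    eLpNorm f 2 m ^ 2 = ∫⁻ x, ‖f x‖ₑ ^ 2 ∂m := by
  have := eLpNorm_nnreal_pow_eq_lintegral (μ := m) (f := f) (p := 2) two_ne_zero
  simpa using this

theorem eLpNorm_sq_eq_lintegral_slices {f : ℝ × Rn n → E}
    (hf : AEStronglyMeasurable f (stMeasure ω)) :
    eLpNorm f 2 (stMeasure ω) ^ 2 =
      ∫⁻ t, eLpNorm (fun x => f (t, x)) 2 (wMeasure ω) ^ 2 := by
  simp_rw [eLpNorm_two_sq]
  exact lintegral_prod _ (hf.enorm.pow_const 2)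

theorem memLp_slices {f : ℝ × Rn n → E} (hf : MemLp f 2 (stMeasure ω)) :
    ∀ᵐ t : ℝ, MemLp (fun x => f (t, x)) 2 (wMeasure ω) := by
  have h1 := hf.1.prodMk_left
  have h2 : ∫⁻ t, eLpNorm (fun x => f (t, x)) 2 (wMeasure ω) ^ 2 ≠ ∞ := by
    rw [← eLpNorm_sq_eq_lintegral_slices hf.1]
    exact ENNReal.pow_ne_top hf.2.ne
  have h3 : AEMeasurable (fun t => eLpNorm (fun x => f (t, x)) 2 (wMeasure ω) ^ 2)
      (volume : Measure ℝ) := by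
    simp_rw [eLpNorm_two_sq]
    exact (hf.1.enorm.pow_const 2).lintegral_prod_right'
  filter_upwards [h1, ae_lt_top' h3 h2] with t ht1 ht2
  exact ⟨ht1, by simpa using ht2⟩

/-- From convergence in space-time `L²`, convergence of almost all time slices along a
subsequence. -/
theorem exists_subseq_tendsto_slices {g : ℕ → ℝ × Rn n → E} {f : ℝ × Rn n → E}
    (hg : ∀ k, AEStronglyMeasurable (g k) (stMeasure ω))
    (hf : AEStronglyMeasurable f (stMeasure ω))
    (h : Tendsto (fun k => eLpNorm (g k - f) 2 (stMeasure ω)) atTop (𝓝 0)) :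
    ∃ ns : ℕ → ℕ, StrictMono ns ∧ ∀ᵐ t : ℝ, Tendsto
      (fun k => eLpNorm (fun x => g (ns k) (t, x) - f (t, x)) 2 (wMeasure ω)) atTop (𝓝 0) := by
  have h1 : ∀ k : ℕ, ∀ᶠ j in atTop,
      eLpNorm (g j - f) 2 (stMeasure ω) ^ 2 ≤ (2 : ℝ≥0∞)⁻¹ ^ k := by
    intro k
    have : Tendsto (fun k => eLpNorm (g k - f) 2 (stMeasure ω) ^ 2) atTop (𝓝 0) := by
      simpa using ENNReal.Tendsto.pow (n := 2) h
    exact (this.eventually (gt_mem_nhds (ENNReal.pow_pos (by simp) k))).mono fun _ h => h.le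
  obtain ⟨ns, hns, hle⟩ := extraction_forall_of_eventually h1
  refine ⟨ns, hns, ?_⟩
  have hm : ∀ k, AEStronglyMeasurable (g (ns k) - f) (stMeasure ω) := fun k => (hg _).sub hf
  have hm' : ∀ k, AEMeasurable
      (fun t => eLpNorm (fun x => (g (ns k) - f) (t, x)) 2 (wMeasure ω) ^ 2)
      (volume : Measure ℝ) := fun k => by
    simp_rw [eLpNorm_two_sq]
    exact ((hm k).enorm.pow_const 2).lintegral_prod_right'
  have hsum : ∫⁻ t, ∑' k, eLpNorm (fun x => (g (ns k) - f) (t, x)) 2 (wMeasure ω) ^ 2 ≠ ∞ := by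
    rw [lintegral_tsum hm']
    simp_rw [← eLpNorm_sq_eq_lintegral_slices (hm _)]
    refine ne_top_of_le_ne_top ?_ (ENNReal.tsum_le_tsum hle)
    simp
  filter_upwards [ae_lt_top' (AEMeasurable.tsum hm') hsum] with t ht
  have h2 := ENNReal.tendsto_atTop_zero_of_tsum_ne_top ht.ne
  have h3 : Tendsto (fun k => (eLpNorm (fun x => (g (ns k) - f) (t, x)) 2 (wMeasure ω) ^ 2) ^
      (1 / 2 : ℝ)) atTop (𝓝 (0 ^ (1 / 2 : ℝ))) :=
    (ENNReal.continuous_rpow_const.tendsto _).comp h2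
  rw [ENNReal.zero_rpow_of_pos (by norm_num)] at h3
  refine h3.congr fun k => ?_
  rw [← ENNReal.rpow_natCast, ← ENNReal.rpow_mul]
  norm_num

/-- Slices of g are uniformly close by uniform continuity and live in one compact set, of finite
measure. This supplies the strongly measurable approximations needed to curry an arbitrary L²
function. -/
theorem continuous_toLp_slices [Fact (IsA2 ω)] {g : ℝ × Rn n → E} (hg : Continuous g)
    (hs : HasCompactSupport g) (hm : ∀ t, MemLp (fun x => g (t, x)) 2 (wMeasure ω)) :
    Continuous fun t => (hm t).toLp := by
  rw [continuous_iff_continuousAt]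
  intro t₀
  rw [ContinuousAt, Lp.tendsto_Lp_iff_tendsto_eLpNorm'']
  set K : Set (Rn n) := Prod.snd '' tsupport g
  have hK : IsCompact K := hs.isCompact.image continuous_snd
  have hsub : ∀ t, Function.support (fun x => g (t, x)) ⊆ K := fun t x hx =>
    ⟨(t, x), subset_tsupport _ hx, rfl⟩
  have huc : UniformContinuous g := hs.uniformContinuous_of_continuous hg
  rw [ENNReal.tendsto_nhds_zero]
  intro ε hε
  obtain ⟨c, hc0, hc⟩ : ∃ c : ℝ, 0 < c ∧
      ENNReal.ofReal c * wMeasure ω K ^ (1 / (2 : ℝ≥0∞).toReal) ≤ ε := by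
    have ht : Tendsto (fun c : ℝ => ENNReal.ofReal c * wMeasure ω K ^ (1 / (2 : ℝ≥0∞).toReal))
        (𝓝[>] 0) (𝓝 0) := by
      have h0 : Tendsto (fun c : ℝ => ENNReal.ofReal c) (𝓝[>] 0) (𝓝 0) := by
        simpa using (ENNReal.continuous_ofReal.tendsto 0).mono_left nhdsWithin_le_nhds
      simpa using ENNReal.Tendsto.mul_const (b := wMeasure ω K ^ (1 / (2 : ℝ≥0∞).toReal)) h0
        (Or.inr (ENNReal.rpow_ne_top_of_nonneg (by positivity) hK.measure_lt_top.ne))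
    obtain ⟨c, hc⟩ := ((ENNReal.tendsto_nhds_zero.mp ht ε hε).and self_mem_nhdsWithin).exists
    exact ⟨c, hc.2, hc.1⟩
  obtain ⟨d, hd, hd'⟩ := Metric.uniformContinuous_iff.mp huc c hc0
  filter_upwards [Metric.ball_mem_nhds t₀ hd] with t ht
  refine le_trans (eLpNorm_sub_le_of_dist_bdd _ (by simp) hK.measurableSet hc0.le (fun x => ?_)
    (hsub t) (hsub t₀)) hc
  refine (hd' ?_).le
  rw [Prod.dist_eq, dist_self]
  exact max_lt ht hd

/-- A space-time `L²` function is an `L²` curve with values in `L²_ω`. -/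
theorem exists_curry [Fact (IsA2 ω)] [NormedSpace ℝ E] {f : ℝ × Rn n → E}
    (hf : MemLp f 2 (stMeasure ω)) : ∃ F : ℝ → Lp E 2 (wMeasure ω), MemLp F 2 volume ∧
      ∀ᵐ t : ℝ, F t =ᵐ[wMeasure ω] fun x => f (t, x) := by
  classical
  have hex : ∀ k : ℕ, ∃ g : ℝ × Rn n → E, HasCompactSupport g ∧
      eLpNorm (f - g) 2 (stMeasure ω) ≤ (2 : ℝ≥0∞)⁻¹ ^ k ∧ Continuous g ∧
      MemLp g 2 (stMeasure ω) := fun k =>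
    hf.exists_hasCompactSupport_eLpNorm_sub_le (by simp) (by simp)
  choose g hgs hgle hgc hgm using hex
  have hlim : Tendsto (fun k => eLpNorm (g k - f) 2 (stMeasure ω)) atTop (𝓝 0) := by
    refine tendsto_of_tendsto_of_tendsto_of_le_of_le tendsto_const_nhds
      (ENNReal.tendsto_pow_atTop_nhds_zero_of_lt_one (r := 2⁻¹) (by simp)) (fun _ => bot_le)
      fun k => ?_
    rw [eLpNorm_sub_comm]
    exact hgle k
  obtain ⟨ns, -, hns⟩ := exists_subseq_tendsto_slices (fun k => (hgm k).1) hf.1 hlim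
  have hgt : ∀ k t, MemLp (fun x => g k (t, x)) 2 (wMeasure ω) := fun k t => by
    refine ((hgc k).comp (by fun_prop : Continuous fun x : Rn n => (t, x))).memLp_of_hasCompactSupport ?_
    refine HasCompactSupport.intro ((hgs k).isCompact.image continuous_snd) fun x hx => ?_
    by_contra h
    exact hx ⟨(t, x), subset_tsupport _ h, rfl⟩
  let F : ℝ → Lp E 2 (wMeasure ω) := fun t =>
    if h : MemLp (fun x => f (t, x)) 2 (wMeasure ω) then h.toLp else 0
  have hF : ∀ᵐ t : ℝ, F t =ᵐ[wMeasure ω] fun x => f (t, x) := by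
    filter_upwards [memLp_slices hf] with t ht
    simp only [F, dif_pos ht]
    exact ht.coeFn_toLp
  -- The slicewise definition says nothing about measurability in t; it is inherited from continuous
  -- curves, by almost everywhere convergence along a subsequence.
  have hFm : AEStronglyMeasurable F volume := by
    refine aestronglyMeasurable_of_tendsto_ae atTop
      (f := fun k t => (hgt (ns k) t).toLp) (fun k =>
        (continuous_toLp_slices (hgc _) (hgs _) (hgt _)).aestronglyMeasurable) ?_
    filter_upwards [memLp_slices hf, hns] with t ht ht2
    simp only [F, dif_pos ht]
    rw [Lp.tendsto_Lp_iff_tendsto_eLpNorm'']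
    exact ht2
  refine ⟨F, ⟨hFm, ?_⟩, hF⟩
  have h1 : eLpNorm F 2 volume ^ 2 = eLpNorm f 2 (stMeasure ω) ^ 2 := by
    rw [eLpNorm_sq_eq_lintegral_slices hf.1, eLpNorm_two_sq]
    refine lintegral_congr_ae ?_
    filter_upwards [hF] with t ht
    rw [Lp.enorm_def, eLpNorm_congr_ae ht]
  have h2 := ENNReal.pow_lt_top (n := 2) hf.2
  rw [← h1] at h2
  simpa using h2

end Slices

end TimeSlices

/-! ### The normalised coefficients `ω⁻¹ A`, and time and space derivatives. -/

section SpaceTimeCalculus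

variable {n : ℕ} {ω : Rn n → ℝ}

section Coefficients

/-- The space `ℂⁿ`. -/
abbrev Cn (n : ℕ) : Type := EuclideanSpace ℂ (Fin n)

/-- The matrix field `ω⁻¹ A` acting on `ℂⁿ`. -/
def coef (ω : Rn n → ℝ) (A : ℝ → Rn n → Matrix (Fin n) (Fin n) ℂ) (p : ℝ × Rn n) (ξ : Cn n) :
    Cn n :=
  ((ω p.2)⁻¹ : ℂ) • WithLp.toLp 2 ((A p.1 p.2).mulVec ξ.ofLp)

variable {A : ℝ → Rn n → Matrix (Fin n) (Fin n) ℂ} {M ν : ℝ}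

theorem inner_coef (p : ℝ × Rn n) (ξ ζ : Cn n) :
    inner ℂ ζ (coef ω A p ξ) =
      ((ω p.2)⁻¹ : ℂ) * ((A p.1 p.2).mulVec ξ.ofLp ⬝ᵥ star ζ.ofLp) := by
  rw [coef, inner_smul_right, EuclideanSpace.inner_eq_star_dotProduct]

theorem coef_add (p : ℝ × Rn n) (ξ ζ : Cn n) :
    coef ω A p (ξ + ζ) = coef ω A p ξ + coef ω A p ζ := by
  simp [coef, Matrix.mulVec_add]

theorem coef_smul (p : ℝ × Rn n) (c : ℂ) (ξ : Cn n) :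
    coef ω A p (c • ξ) = c • coef ω A p ξ := by
  simp only [coef, WithLp.ofLp_smul, Matrix.mulVec_smul, WithLp.toLp_smul]
  rw [smul_comm]

theorem star_mulVec_dotProduct_star (B : Matrix (Fin n) (Fin n) ℂ) (x y : Fin n → ℂ) :
    star (B.mulVec x ⬝ᵥ star y) = B.conjTranspose.mulVec y ⬝ᵥ star x := by
  rw [← Matrix.star_dotProduct_star, star_star, Matrix.star_mulVec, dotProduct_comm,
    ← Matrix.dotProduct_mulVec, dotProduct_comm]

theorem inner_coef_left (p : ℝ × Rn n) (ξ ζ : Cn n) :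
    inner ℂ (coef ω A p ζ) ξ = inner ℂ ζ (coef ω (fun t x => (A t x).conjTranspose) p ξ) := by
  rw [← inner_conj_symm, inner_coef, inner_coef]
  simp only [map_mul, map_inv₀, Complex.conj_ofReal]
  congr 1
  rw [starRingEnd_apply, star_mulVec_dotProduct_star]

theorem IsElliptic.norm_coef_le (hω : IsA2 ω) (hA : IsElliptic ω A M ν) (p : ℝ × Rn n)
    (ξ : Cn n) : ‖coef ω A p ξ‖ ≤ M * ‖ξ‖ := by
  have hp := hω.pos p.2
  set v : Cn n := WithLp.toLp 2 ((A p.1 p.2).mulVec ξ.ofLp) with hv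
  -- Taking ζ to be the conjugate of Aξ turns the bilinear bound into an operator norm bound.
  have h1 := hA.upper p.1 p.2 ξ (WithLp.toLp 2 (star v.ofLp))
  have h2 : ‖(WithLp.toLp 2 (star v.ofLp) : Cn n)‖ = ‖v‖ := by
    simp [EuclideanSpace.norm_eq]
  have h3 : ‖(A p.1 p.2).mulVec ξ.ofLp ⬝ᵥ star v.ofLp‖ = ‖v‖ ^ 2 := by
    have : (A p.1 p.2).mulVec ξ.ofLp ⬝ᵥ star v.ofLp = inner ℂ v v := by
      rw [EuclideanSpace.inner_eq_star_dotProduct]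
    rw [this, inner_self_eq_norm_sq_to_K]
    simp
  rw [h2] at h1
  change ‖(A p.1 p.2).mulVec ξ.ofLp ⬝ᵥ star v.ofLp‖ ≤ _ at h1
  rw [h3] at h1
  have h4 : ‖v‖ ≤ M * ω p.2 * ‖ξ‖ := by
    rcases eq_or_lt_of_le (norm_nonneg v) with h | h
    · rw [← h]; have := hA.M_pos; positivity
    · nlinarith
  rw [coef, norm_smul, norm_inv, Complex.norm_real, Real.norm_of_nonneg hp.le]
  rw [inv_mul_le_iff₀ hp]
  linarith

theorem IsElliptic.le_re_inner_coef (hω : IsA2 ω) (hA : IsElliptic ω A M ν) (p : ℝ × Rn n)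
    (ξ : Cn n) : ν * ‖ξ‖ ^ 2 ≤ (inner ℂ (coef ω A p ξ) ξ).re := by
  have hp := hω.pos p.2
  have h1 := hA.lower p.1 p.2 ξ
  rw [← inner_conj_symm, Complex.conj_re, inner_coef, ← Complex.ofReal_inv,
    Complex.re_ofReal_mul, le_inv_mul_iff₀ hp]
  linarith

theorem IsElliptic.conjTranspose (hA : IsElliptic ω A M ν) :
    IsElliptic ω (fun t x => (A t x).conjTranspose) M ν where
  aemeasurable i j := continuous_star.measurable.comp_aemeasurable (hA.aemeasurable j i)
  M_pos := hA.M_pos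
  ν_pos := hA.ν_pos
  upper t x ξ ζ := by
    have h := hA.upper t x (WithLp.toLp 2 (star ζ.ofLp)) (WithLp.toLp 2 (star ξ.ofLp))
    have h2 : ∀ v : Cn n, ‖(WithLp.toLp 2 (star v.ofLp) : Cn n)‖ = ‖v‖ := fun v => by
      simp [EuclideanSpace.norm_eq]
    rw [h2, h2] at h
    have h3 : (A t x).conjTranspose.mulVec ξ.ofLp ⬝ᵥ ζ.ofLp =
        star ((A t x).mulVec (star ζ.ofLp) ⬝ᵥ star ξ.ofLp) := by
      rw [star_mulVec_dotProduct_star, star_star]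
    rw [h3, norm_star]
    calc _ ≤ _ := h
      _ = _ := by ring
  lower t x ξ := by
    have h := hA.lower t x ξ
    have h3 : (A t x).conjTranspose.mulVec ξ.ofLp ⬝ᵥ star ξ.ofLp =
        star ((A t x).mulVec ξ.ofLp ⬝ᵥ star ξ.ofLp) := by
      rw [star_mulVec_dotProduct_star]
    rw [h3]
    simpa using h

theorem stMeasure_absolutelyContinuous : stMeasure ω ≪ (volume : Measure (ℝ × Rn n)) := by
  rw [Measure.volume_eq_prod]
  exact Measure.AbsolutelyContinuous.rfl.prod wMeasure_absolutelyContinuous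

theorem IsElliptic.aestronglyMeasurable_coef (hω : IsA2 ω) (hA : IsElliptic ω A M ν)
    {f : ℝ × Rn n → Cn n} (hf : AEStronglyMeasurable f (stMeasure ω)) :
    AEStronglyMeasurable (fun p => coef ω A p (f p)) (stMeasure ω) := by
  have hinv : AEMeasurable (fun p : ℝ × Rn n => ((ω p.2)⁻¹ : ℂ)) (stMeasure ω) := by
    have : AEMeasurable ω (wMeasure ω) := hω.aemeasurable.mono_ac wMeasure_absolutelyContinuous
    exact (Complex.measurable_ofReal.comp_aemeasurable this.comp_snd).inv
  have hvec : AEMeasurable (fun p : ℝ × Rn n => (A p.1 p.2).mulVec (f p).ofLp)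
      (stMeasure ω) := by
    refine aemeasurable_pi_lambda _ fun i => ?_
    simp only [Matrix.mulVec, dotProduct]
    refine Finset.aemeasurable_fun_sum _ fun j _ => ?_
    refine ((hA.aemeasurable i j).mono_ac stMeasure_absolutelyContinuous).mul ?_
    have hj : Measurable fun v : Cn n => v.ofLp j := by fun_prop
    exact hj.comp_aemeasurable hf.aemeasurable
  have h2 : Measurable (@WithLp.toLp 2 (Fin n → ℂ)) :=
    (PiLp.continuous_toLp 2 (fun _ : Fin n => ℂ)).measurable
  exact (hinv.smul (h2.comp_aemeasurable hvec)).aestronglyMeasurable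

end Coefficients

section Derivatives

variable {F : Type*} [NormedAddCommGroup F] [NormedSpace ℝ F]

/-- The time derivative of a function on `ℝ × ℝⁿ`. -/
def dT (Φ : ℝ × Rn n → F) (p : ℝ × Rn n) : F := fderiv ℝ Φ p (1, 0)

/-- The spatial gradient of a function on `ℝ × ℝⁿ`. -/
def dX (Φ : ℝ × Rn n → ℂ) (p : ℝ × Rn n) : Cn n :=
  WithLp.toLp 2 fun i => fderiv ℝ Φ p (0, EuclideanSpace.single i 1)

theorem hasDerivAt_time {Φ : ℝ × Rn n → F} {t : ℝ} {x : Rn n}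
    (h : DifferentiableAt ℝ Φ (t, x)) : HasDerivAt (fun τ => Φ (τ, x)) (dT Φ (t, x)) t := by
  have h1 : HasDerivAt (fun τ : ℝ => (τ, x)) ((1 : ℝ), (0 : Rn n)) t :=
    (hasDerivAt_id t).prodMk (hasDerivAt_const t x)
  exact h.hasFDerivAt.comp_hasDerivAt t h1

theorem gradX_slice {Φ : ℝ × Rn n → ℂ} {t : ℝ} {x : Rn n}
    (h : DifferentiableAt ℝ Φ (t, x)) :
    gradX (fun y => Φ (t, y)) x = (dX Φ (t, x)).ofLp := by
  funext i
  have h1 : HasFDerivAt (fun y : Rn n => (t, y)) (ContinuousLinearMap.inr ℝ ℝ (Rn n)) x :=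
    (hasFDerivAt_const t x).prodMk (hasFDerivAt_id x)
  have h2 : HasFDerivAt (fun y => Φ (t, y)) _ x := h.hasFDerivAt.comp x h1
  simp [gradX, partialX, h2.fderiv, dX]

/-- Smooth functions in this file are `C^∞`. -/
abbrev Smooth {V W : Type*} [NormedAddCommGroup V] [NormedSpace ℝ V] [NormedAddCommGroup W]
    [NormedSpace ℝ W] (f : V → W) : Prop := ContDiff ℝ ((⊤ : ℕ∞) : WithTop ℕ∞) f

theorem Smooth.continuous_dT {Φ : ℝ × Rn n → F} (h : Smooth Φ) : Continuous (dT Φ) :=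
  (h.continuous_fderiv (by simp)).clm_apply continuous_const

theorem Smooth.continuous_dX {Φ : ℝ × Rn n → ℂ} (h : Smooth Φ) : Continuous (dX Φ) := by
  refine (PiLp.continuous_toLp 2 (fun _ : Fin n => ℂ)).comp (continuous_pi fun i => ?_)
  exact (h.continuous_fderiv (by simp)).clm_apply continuous_const

theorem hasCompactSupport_dT {Φ : ℝ × Rn n → F} (h : HasCompactSupport Φ) :
    HasCompactSupport (dT Φ) :=
  (h.fderiv (𝕜 := ℝ)).comp_left (g := fun L : ℝ × Rn n →L[ℝ] F => L (1, 0)) rfl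

theorem hasCompactSupport_dX {Φ : ℝ × Rn n → ℂ} (h : HasCompactSupport Φ) :
    HasCompactSupport (dX Φ) :=
  (h.fderiv (𝕜 := ℝ)).comp_left (g := fun L : ℝ × Rn n →L[ℝ] ℂ =>
    (WithLp.toLp 2 fun i => L (0, EuclideanSpace.single i 1) : Cn n)) (by ext; simp)

/-- The weight does not depend on time, so Fubini reduces the claim to the integral of a derivative
on each line x = const. -/
theorem integral_dT [Fact (IsA2 ω)] [CompleteSpace F] {Φ : ℝ × Rn n → F} (h : ContDiff ℝ 1 Φ)
    (hs : HasCompactSupport Φ) : ∫ p, dT Φ p ∂(stMeasure ω) = 0 := by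
  have hc : Continuous (dT Φ) := (h.continuous_fderiv (by simp)).clm_apply continuous_const
  rw [integral_prod_symm _ (hc.integrable_of_hasCompactSupport (hasCompactSupport_dT hs))]
  refine integral_eq_zero_of_ae (ae_of_all _ fun x => ?_)
  have hemb : Continuous fun t : ℝ => (t, x) := by fun_prop
  have hcs : ∀ {G : ℝ × Rn n → F}, HasCompactSupport G →
      HasCompactSupport fun t => G (t, x) := fun {G} hG => by
    refine HasCompactSupport.intro (hG.isCompact.image continuous_fst) fun t ht => ?_
    by_contra h
    exact ht ⟨(t, x), subset_tsupport _ h, rfl⟩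
  exact integral_eq_zero_of_hasDerivAt_of_integrable
    (fun t => hasDerivAt_time (h.differentiable (by simp) _))
    ((hc.comp hemb).integrable_of_hasCompactSupport (hcs (hasCompactSupport_dT hs)))
    ((h.continuous.comp hemb).integrable_of_hasCompactSupport (hcs hs))

end Derivatives

end SpaceTimeCalculus

/-! ### The Hilbert space of energies, the weighted energy inequality and coercivity. -/

section EnergyInequality

variable {n : ℕ} {ω : Rn n → ℝ}

section TestSpace

/-- The space of test functions on `ℝ × ℝⁿ`. -/
def testSpace (n : ℕ) : Submodule ℂ (ℝ × Rn n → ℂ) where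
  carrier := {Φ | IsTest Φ}
  add_mem' h h' := ⟨h.1.add h'.1, h.2.add h'.2⟩
  zero_mem' := ⟨contDiff_const, HasCompactSupport.zero⟩
  smul_mem' c _ h := ⟨h.1.const_smul c, h.2.smul_left (f := fun _ => c)⟩

/-- The time weight `(1 + t²)^{-1/2}`. -/
def rho (t : ℝ) : ℝ := (√(1 + t ^ 2))⁻¹

theorem rho_pos (t : ℝ) : 0 < rho t := inv_pos.mpr (Real.sqrt_pos.mpr (by positivity))

theorem rho_sq (t : ℝ) : rho t ^ 2 = 1 / (1 + t ^ 2) := by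
  rw [rho, inv_pow, Real.sq_sqrt (by positivity), one_div]

theorem continuous_rho : Continuous rho := by
  unfold rho
  refine Continuous.inv₀ (by fun_prop) fun t => (Real.sqrt_pos.mpr (by positivity)).ne'

variable [Fact (IsA2 ω)]

theorem IsTest.memLp_rho_mul {Φ : ℝ × Rn n → ℂ} (h : IsTest Φ) :
    MemLp (fun p => (rho p.1 : ℂ) * Φ p) 2 (stMeasure ω) := by
  refine Continuous.memLp_of_hasCompactSupport ?_ h.2.mul_left
  have := continuous_rho
  have := h.1.continuous
  fun_prop

theorem IsTest.memLp_inv_rho_mul_dT {Φ : ℝ × Rn n → ℂ} (h : IsTest Φ) (σ : ℝ) :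
    MemLp (fun p => ((σ * (rho p.1)⁻¹ : ℝ) : ℂ) * dT Φ p) 2 (stMeasure ω) := by
  refine Continuous.memLp_of_hasCompactSupport ?_ (hasCompactSupport_dT h.2).mul_left
  have h1 : Continuous fun t => (rho t)⁻¹ := continuous_rho.inv₀ fun t => (rho_pos t).ne'
  exact (Complex.continuous_ofReal.comp
    (continuous_const.mul (h1.comp continuous_fst))).mul (Smooth.continuous_dT h.1)

theorem IsTest.memLp_dX {Φ : ℝ × Rn n → ℂ} (h : IsTest Φ) :
    MemLp (dX Φ) 2 (stMeasure ω) :=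
  (Smooth.continuous_dX h.1).memLp_of_hasCompactSupport (hasCompactSupport_dX h.2)

theorem IsTest.memLp_coef_dX {A : ℝ → Rn n → Matrix (Fin n) (Fin n) ℂ} {M ν : ℝ}
    (hA : IsElliptic ω A M ν) {Φ : ℝ × Rn n → ℂ} (h : IsTest Φ) :
    MemLp (fun p => coef ω A p (dX Φ p)) 2 (stMeasure ω) :=
  (h.memLp_dX (ω := ω)).of_le_mul (c := M)
    (hA.aestronglyMeasurable_coef Fact.out h.memLp_dX.1)
    (ae_of_all _ fun p => hA.norm_coef_le Fact.out p _)

theorem dX_add {Φ Ψ : ℝ × Rn n → ℂ} (h : Smooth Φ) (h' : Smooth Ψ) (p : ℝ × Rn n) :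
    dX (Φ + Ψ) p = dX Φ p + dX Ψ p := by
  ext i
  simp [dX, fderiv_add (h.differentiable (by simp) p) (h'.differentiable (by simp) p)]

theorem dX_smul {Φ : ℝ × Rn n → ℂ} (h : Smooth Φ) (c : ℂ) (p : ℝ × Rn n) :
    dX (c • Φ) p = c • dX Φ p := by
  ext i
  simp [dX, fderiv_const_smul (h.differentiable (by simp) p)]

theorem dT_add {Φ Ψ : ℝ × Rn n → ℂ} (h : Smooth Φ) (h' : Smooth Ψ) (p : ℝ × Rn n) :
    dT (Φ + Ψ) p = dT Φ p + dT Ψ p := by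
  simp [dT, fderiv_add (h.differentiable (by simp) p) (h'.differentiable (by simp) p)]

theorem dT_smul {Φ : ℝ × Rn n → ℂ} (h : Smooth Φ) (c : ℂ) (p : ℝ × Rn n) :
    dT (c • Φ) p = c • dT Φ p := by
  simp [dT, fderiv_const_smul (h.differentiable (by simp) p)]

variable (ω) in
/-- The Hilbert space containing the pairs `(ρ u, ∇ₓ u)`. -/
abbrev EnergySpace : Type :=
  WithLp 2 (Lp ℂ 2 (stMeasure ω) × Lp (Cn n) 2 (stMeasure ω))

variable (ω) in
/-- The map `Φ ↦ (ρ Φ, ∇ₓ Φ)` on test functions. -/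
def energyMap : testSpace n →ₗ[ℂ] EnergySpace ω where
  toFun Φ := WithLp.toLp 2 ((IsTest.memLp_rho_mul Φ.2).toLp, (IsTest.memLp_dX Φ.2).toLp)
  map_add' Φ Ψ := by
    rw [← WithLp.toLp_add, Prod.mk_add_mk, ← MemLp.toLp_add, ← MemLp.toLp_add]
    congr 2
    · exact MemLp.toLp_congr _ _ (ae_of_all _ fun p => by simp [mul_add])
    · exact MemLp.toLp_congr _ _ (ae_of_all _ fun p => by simp [dX_add Φ.2.1 Ψ.2.1])
  map_smul' c Φ := by
    rw [← WithLp.toLp_smul, Prod.smul_mk, RingHom.id_apply, ← MemLp.toLp_const_smul,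
      ← MemLp.toLp_const_smul]
    congr 2
    · exact MemLp.toLp_congr _ _ (ae_of_all _ fun p => by simp [mul_left_comm])
    · exact MemLp.toLp_congr _ _ (ae_of_all _ fun p => by simp [dX_smul Φ.2.1])

variable {A : ℝ → Rn n → Matrix (Fin n) (Fin n) ℂ} {M ν : ℝ}

/-- The map `Φ ↦ (σ ρ⁻¹ ∂ₜ Φ, ω⁻¹ A ∇ₓ Φ)` on test functions. -/
def operatorMap (hA : IsElliptic ω A M ν) (σ : ℝ) : testSpace n →ₗ[ℂ] EnergySpace ω where
  toFun Φ := WithLp.toLp 2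
    ((IsTest.memLp_inv_rho_mul_dT Φ.2 σ).toLp, (IsTest.memLp_coef_dX hA Φ.2).toLp)
  map_add' Φ Ψ := by
    rw [← WithLp.toLp_add, Prod.mk_add_mk, ← MemLp.toLp_add, ← MemLp.toLp_add]
    congr 2
    · exact MemLp.toLp_congr _ _ (ae_of_all _ fun p => by simp [dT_add Φ.2.1 Ψ.2.1, mul_add])
    · exact MemLp.toLp_congr _ _ (ae_of_all _ fun p => by
        simp [dX_add Φ.2.1 Ψ.2.1, coef_add])
  map_smul' c Φ := by
    rw [← WithLp.toLp_smul, Prod.smul_mk, RingHom.id_apply, ← MemLp.toLp_const_smul,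
      ← MemLp.toLp_const_smul]
    congr 2
    · exact MemLp.toLp_congr _ _ (ae_of_all _ fun p => by
        simp [dT_smul Φ.2.1, mul_left_comm])
    · exact MemLp.toLp_congr _ _ (ae_of_all _ fun p => by simp [dX_smul Φ.2.1, coef_smul])

theorem inner_toLp_left {α E : Type*} [MeasurableSpace α] {m : Measure α} [NormedAddCommGroup E]
    [InnerProductSpace ℂ E] {f : α → E} (hf : MemLp f 2 m) (g : Lp E 2 m) :
    inner ℂ hf.toLp g = ∫ x, inner ℂ (f x) (g x) ∂m := by
  rw [L2.inner_def]
  refine integral_congr_ae ?_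
  filter_upwards [hf.coeFn_toLp] with x hx
  rw [hx]

theorem integrable_inner_memLp {α E : Type*} [MeasurableSpace α] {m : Measure α}
    [NormedAddCommGroup E] [InnerProductSpace ℂ E] {f g : α → E} (hf : MemLp f 2 m)
    (hg : MemLp g 2 m) : Integrable (fun x => inner ℂ (f x) (g x)) m := by
  refine (L2.integrable_inner (𝕜 := ℂ) hf.toLp hg.toLp).congr ?_
  filter_upwards [hf.coeFn_toLp, hg.coeFn_toLp] with x h1 h2
  rw [h1, h2]

theorem norm_toLp_sq {α E : Type*} [MeasurableSpace α] {m : Measure α} [NormedAddCommGroup E]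
    [InnerProductSpace ℂ E] {f : α → E} (hf : MemLp f 2 m) :
    ‖hf.toLp‖ ^ 2 = ∫ x, ‖f x‖ ^ 2 ∂m := by
  rw [← inner_self_eq_norm_sq (𝕜 := ℂ), inner_toLp_left]
  have h1 : ∫ x, inner ℂ (f x) ((hf.toLp : Lp E 2 m) x) ∂m = ((∫ x, ‖f x‖ ^ 2 ∂m : ℝ) : ℂ) := by
    rw [← integral_complex_ofReal]
    refine integral_congr_ae ?_
    filter_upwards [hf.coeFn_toLp] with x hx
    rw [hx, inner_self_eq_norm_sq_to_K]
    simp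
  rw [h1]
  simp

theorem inner_operatorMap (hA : IsElliptic ω A M ν) (σ : ℝ) (Φ : testSpace n)
    (U : EnergySpace ω) : inner ℂ (operatorMap hA σ Φ) U =
      ∫ p, (((σ * (rho p.1)⁻¹ : ℝ) : ℂ) * (starRingEnd ℂ (dT Φ.1 p) * U.fst p) +
        inner ℂ (coef ω A p (dX Φ.1 p)) (U.snd p)) ∂(stMeasure ω) := by
  have h1 := integrable_inner_memLp (IsTest.memLp_inv_rho_mul_dT Φ.2 σ (ω := ω)) (Lp.memLp U.fst)
  have h2 := integrable_inner_memLp (IsTest.memLp_coef_dX hA Φ.2) (Lp.memLp U.snd)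
  rw [WithLp.prod_inner_apply]
  change inner ℂ (IsTest.memLp_inv_rho_mul_dT Φ.2 σ).toLp U.fst +
    inner ℂ (IsTest.memLp_coef_dX hA Φ.2).toLp U.snd = _
  rw [inner_toLp_left, inner_toLp_left, ← integral_add h1 h2]
  refine integral_congr_ae (ae_of_all _ fun p => ?_)
  simp only [RCLike.inner_apply, map_mul, Complex.conj_ofReal]
  ring

theorem energyMap_fst (Ψ : testSpace n) :
    (energyMap ω Ψ).fst =ᵐ[stMeasure ω] fun p => (rho p.1 : ℂ) * Ψ.1 p :=
  (IsTest.memLp_rho_mul Ψ.2).coeFn_toLp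

theorem energyMap_snd (Ψ : testSpace n) :
    (energyMap ω Ψ).snd =ᵐ[stMeasure ω] dX Ψ.1 :=
  (IsTest.memLp_dX Ψ.2).coeFn_toLp

/-- The factors ρ⁻¹ and ρ in the two first components cancel: the time weight makes the energy norm
controllable on all of ℝ without changing the pairing. -/
theorem inner_operatorMap_energyMap (hA : IsElliptic ω A M ν) (σ : ℝ) (Φ Ψ : testSpace n) :
    inner ℂ (operatorMap hA σ Φ) (energyMap ω Ψ) =
      ∫ p, ((σ : ℂ) * (starRingEnd ℂ (dT Φ.1 p) * Ψ.1 p) +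
        inner ℂ (coef ω A p (dX Φ.1 p)) (dX Ψ.1 p)) ∂(stMeasure ω) := by
  rw [inner_operatorMap]
  refine integral_congr_ae ?_
  filter_upwards [energyMap_fst (ω := ω) Ψ, energyMap_snd (ω := ω) Ψ] with p h1 h2
  rw [h1, h2]
  have : (rho p.1 : ℂ) ≠ 0 := by exact_mod_cast (rho_pos _).ne'
  push_cast
  field_simp

theorem norm_energyMap_sq (Φ : testSpace n) :
    ‖energyMap ω Φ‖ ^ 2 =
      ∫ p, (rho p.1 ^ 2 * ‖Φ.1 p‖ ^ 2 + ‖dX Φ.1 p‖ ^ 2) ∂(stMeasure ω) := by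
  rw [WithLp.prod_norm_sq_eq_of_L2]
  change ‖(IsTest.memLp_rho_mul Φ.2).toLp‖ ^ 2 + ‖(IsTest.memLp_dX Φ.2).toLp‖ ^ 2 = _
  rw [norm_toLp_sq, norm_toLp_sq, ← integral_add
    ((memLp_two_iff_integrable_sq_norm (IsTest.memLp_rho_mul Φ.2).1).mp
      (IsTest.memLp_rho_mul Φ.2))
    ((memLp_two_iff_integrable_sq_norm (IsTest.memLp_dX Φ.2).1).mp (IsTest.memLp_dX Φ.2))]
  refine integral_congr_ae (ae_of_all _ fun p => ?_)
  simp [mul_pow]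

end TestSpace

section Energy

/-- The gradient of a real function, as a complex vector. -/
def gradR (E : Rn n → ℝ) (x : Rn n) : Cn n :=
  WithLp.toLp 2 fun i => ((fderiv ℝ E x (EuclideanSpace.single i 1) : ℝ) : ℂ)

/-- The function `η(t) E(x)² Φ(t, x)`. -/
def weighted (η : ℝ → ℝ) (E : Rn n → ℝ) (Φ : ℝ × Rn n → ℂ) (p : ℝ × Rn n) : ℂ :=
  ((η p.1 * E p.2 ^ 2 : ℝ) : ℂ) * Φ p

theorem isTest_weighted {η : ℝ → ℝ} {E : Rn n → ℝ} (hη : Smooth η) (hE : Smooth E)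
    {Φ : ℝ × Rn n → ℂ} (h : IsTest Φ) : IsTest (weighted η E Φ) := by
  refine ⟨?_, h.2.mul_left⟩
  have h1 : Smooth fun p : ℝ × Rn n => η p.1 * E p.2 ^ 2 :=
    (hη.comp contDiff_fst).mul ((hE.comp contDiff_snd).pow 2)
  exact (Complex.ofRealCLM.contDiff.comp h1).mul h.1

theorem dX_apply {Φ : ℝ × Rn n → ℂ} {p : ℝ × Rn n} (h : DifferentiableAt ℝ Φ p) (i : Fin n) :
    dX Φ p i = fderiv ℝ (fun y => Φ (p.1, y)) p.2 (EuclideanSpace.single i 1) :=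
  (congrFun (gradX_slice (t := p.1) (x := p.2) h) i).symm

theorem dX_weighted {η : ℝ → ℝ} {E : Rn n → ℝ} (hη : Smooth η) (hE : Smooth E)
    {Φ : ℝ × Rn n → ℂ} (h : IsTest Φ) (p : ℝ × Rn n) :
    dX (weighted η E Φ) p = ((η p.1 * E p.2 ^ 2 : ℝ) : ℂ) • dX Φ p +
      (((2 * η p.1 * E p.2 : ℝ) : ℂ) * Φ p) • gradR E p.2 := by
  ext i
  have hd := (isTest_weighted hη hE h).1.differentiable (by simp) p
  have hΦ := h.1.differentiable (by simp) p
  have h1 : HasFDerivAt (fun y : Rn n => (p.1, y)) (ContinuousLinearMap.inr ℝ ℝ (Rn n)) p.2 :=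
    (hasFDerivAt_const p.1 p.2).prodMk (hasFDerivAt_id p.2)
  have h2 : HasFDerivAt (fun y => Φ (p.1, y)) _ p.2 := hΦ.hasFDerivAt.comp p.2 h1
  have hE' : HasFDerivAt E (fderiv ℝ E p.2) p.2 := (hE.differentiable (by simp) p.2).hasFDerivAt
  have h3 := (Complex.ofRealCLM.hasFDerivAt.comp p.2 ((hE'.pow 2).const_mul (η p.1))).mul h2
  rw [dX_apply hd, PiLp.add_apply, PiLp.smul_apply, PiLp.smul_apply, dX_apply hΦ, h2.fderiv]
  have h4 : fderiv ℝ (fun y => weighted η E Φ (p.1, y)) p.2 = _ := HasFDerivAt.fderiv h3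
  rw [h4]
  simp [gradR]
  ring

variable [Fact (IsA2 ω)] {A : ℝ → Rn n → Matrix (Fin n) (Fin n) ℂ} {M ν : ℝ}

/-- The weighted energy inequality for test functions. -/
theorem energy_le (hA : IsElliptic ω A M ν) (σ : ℝ) (Φ : testSpace n) {η : ℝ → ℝ}
    {E : Rn n → ℝ} (hη : Smooth η) (hE : Smooth E) (hη0 : ∀ t, 0 ≤ η t) (hE0 : ∀ x, 0 < E x)
    {δ : ℝ} (hδ : ∀ x, ‖gradR E x‖ ≤ δ * E x) :
    ∫ p, (-(σ / 2) * deriv η p.1 * E p.2 ^ 2 * ‖Φ.1 p‖ ^ 2 -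
        2 * M ^ 2 * δ ^ 2 / ν * (η p.1 * E p.2 ^ 2 * ‖Φ.1 p‖ ^ 2) +
        ν / 2 * (η p.1 * E p.2 ^ 2 * ‖dX Φ.1 p‖ ^ 2)) ∂(stMeasure ω) ≤
      (inner ℂ (operatorMap hA σ Φ)
        (energyMap ω ⟨weighted η E Φ.1, isTest_weighted hη hE Φ.2⟩)).re := by
  have hω : IsA2 ω := Fact.out
  have hM := hA.M_pos
  have hν := hA.ν_pos
  set Ψ : testSpace n := ⟨weighted η E Φ.1, isTest_weighted hη hE Φ.2⟩ with hΨ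
  have hΦc : Continuous Φ.1 := Φ.2.1.continuous
  have hηc := hη.continuous
  have hEc := hE.continuous
  have hη' : Continuous (deriv η) := hη.continuous_deriv (by simp)
  have hdX := Smooth.continuous_dX Φ.2.1
  set F : ℝ × Rn n → ℝ := fun p => η p.1 * E p.2 ^ 2 * ‖Φ.1 p‖ ^ 2 with hF
  have hFs : Smooth F :=
    ((hη.comp contDiff_fst).mul ((hE.comp contDiff_snd).pow 2)).mul (Φ.2.1.norm_sq ℝ)
  have hsupp : HasCompactSupport fun p => ‖Φ.1 p‖ ^ 2 :=
    Φ.2.2.comp_left (g := fun z : ℂ => ‖z‖ ^ 2) (by simp)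
  have hsupp' : HasCompactSupport fun p => ‖dX Φ.1 p‖ ^ 2 :=
    (hasCompactSupport_dX Φ.2.2).comp_left (g := fun z : Cn n => ‖z‖ ^ 2) (by simp)
  have hFsupp : HasCompactSupport F := hsupp.mul_left
  have hint0 : ∫ p, dT F p ∂(stMeasure ω) = 0 := integral_dT (hFs.of_le (by simp)) hFsupp
  have hintF : Integrable (dT F) (stMeasure ω) :=
    (Smooth.continuous_dT hFs).integrable_of_hasCompactSupport (hasCompactSupport_dT hFsupp)
  have hintL : Integrable (fun p => -(σ / 2) * deriv η p.1 * E p.2 ^ 2 * ‖Φ.1 p‖ ^ 2 -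
        2 * M ^ 2 * δ ^ 2 / ν * (η p.1 * E p.2 ^ 2 * ‖Φ.1 p‖ ^ 2) +
        ν / 2 * (η p.1 * E p.2 ^ 2 * ‖dX Φ.1 p‖ ^ 2)) (stMeasure ω) := by
    refine Integrable.add (Integrable.sub ?_ ?_) ?_
    · exact Continuous.integrable_of_hasCompactSupport (by fun_prop) hsupp.mul_left
    · exact Continuous.integrable_of_hasCompactSupport (by fun_prop) hFsupp.mul_left
    · exact Continuous.integrable_of_hasCompactSupport (by fun_prop) hsupp'.mul_left.mul_left
  have hdT : Continuous (dT Φ.1) := Smooth.continuous_dT Φ.2.1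
  have hΨc : Continuous Ψ.1 := Ψ.2.1.continuous
  have hintR : Integrable (fun p => (σ : ℂ) * (starRingEnd ℂ (dT Φ.1 p) * Ψ.1 p) +
        inner ℂ (coef ω A p (dX Φ.1 p)) (dX Ψ.1 p)) (stMeasure ω) := by
    refine Integrable.add ?_ (integrable_inner_memLp (IsTest.memLp_coef_dX hA Φ.2)
      (IsTest.memLp_dX Ψ.2))
    exact Continuous.integrable_of_hasCompactSupport
      (continuous_const.mul ((Complex.continuous_conj.comp hdT).mul hΨc)) Ψ.2.2.mul_left.mul_left
  rw [inner_operatorMap_energyMap]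
  have hre : (∫ p, ((σ : ℂ) * (starRingEnd ℂ (dT Φ.1 p) * Ψ.1 p) +
        inner ℂ (coef ω A p (dX Φ.1 p)) (dX Ψ.1 p)) ∂(stMeasure ω)).re = ∫ p, ((σ : ℂ) *
        (starRingEnd ℂ (dT Φ.1 p) * Ψ.1 p) +
        inner ℂ (coef ω A p (dX Φ.1 p)) (dX Ψ.1 p)).re ∂(stMeasure ω) :=
    (integral_re hintR).symm
  rw [hre]
  -- The exact derivative (σ/2) ∂_t(η E² |Φ|²) has integral zero. Adding it to the left side turns
  -- the inequality between integrals into one between integrands, where it accounts for the real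
  -- part of the time term.
  have hL : ∀ f : ℝ × Rn n → ℝ, Integrable f (stMeasure ω) →
      ∫ p, f p ∂(stMeasure ω) = ∫ p, (f p + σ / 2 * dT F p) ∂(stMeasure ω) := fun f hf => by
    rw [integral_add hf (hintF.const_mul _), integral_const_mul, hint0]
    simp
  rw [hL _ hintL]
  refine integral_mono (hintL.add (hintF.const_mul _)) hintR.re fun p => ?_
  obtain ⟨t, x⟩ := p
  have hderF : dT F (t, x) = deriv η t * E x ^ 2 * ‖Φ.1 (t, x)‖ ^ 2 +
      η t * E x ^ 2 * (2 * (starRingEnd ℂ (dT Φ.1 (t, x)) * Φ.1 (t, x)).re) := by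
    have h1 := hasDerivAt_time (hFs.differentiable (by simp) (t, x))
    have h2 := hasDerivAt_time (Φ.2.1.differentiable (by simp) (t, x))
    have h3 := (((hη.differentiable (by simp) t).hasDerivAt).mul_const (E x ^ 2)).mul h2.norm_sq
    rw [h1.unique h3]
    congr 2
    rw [Complex.inner]
    simp only [Complex.mul_re, Complex.conj_re, Complex.conj_im]
    ring
  have hΨv : Ψ.1 (t, x) = ((η t * E x ^ 2 : ℝ) : ℂ) * Φ.1 (t, x) := rfl
  have hdΨ := dX_weighted hη hE Φ.2 (t, x)
  change _ ≤ ((σ : ℂ) * (starRingEnd ℂ (dT Φ.1 (t, x)) * Ψ.1 (t, x)) +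
    inner ℂ (coef ω A (t, x) (dX Φ.1 (t, x))) (dX (weighted η E Φ.1) (t, x))).re
  rw [hdΨ, hΨv, inner_add_right, inner_smul_right, inner_smul_right]
  set g := dX Φ.1 (t, x)
  set c := coef ω A (t, x) g
  have hc : ‖c‖ ≤ M * ‖g‖ := hA.norm_coef_le hω _ _
  have hcg : ν * ‖g‖ ^ 2 ≤ (inner ℂ c g).re := hA.le_re_inner_coef hω _ _
  have hcross : -(2 * η t * E x * ‖Φ.1 (t, x)‖ * (M * ‖g‖ * (δ * E x))) ≤
      (((2 * η t * E x : ℝ) : ℂ) * Φ.1 (t, x) * inner ℂ c (gradR E x)).re := by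
    have h1 : ‖((2 * η t * E x : ℝ) : ℂ) * Φ.1 (t, x) * inner ℂ c (gradR E x)‖ ≤
        2 * η t * E x * ‖Φ.1 (t, x)‖ * (M * ‖g‖ * (δ * E x)) := by
      have h0 : 0 ≤ 2 * η t * E x := by have := hη0 t; have := hE0 x; positivity
      rw [norm_mul, norm_mul, Complex.norm_real, Real.norm_of_nonneg h0]
      refine mul_le_mul_of_nonneg_left ((norm_inner_le_norm _ _).trans ?_) (by positivity)
      exact mul_le_mul hc (hδ x) (norm_nonneg _) (by positivity)
    have h2 := (abs_le.mp (Complex.abs_re_le_norm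
      (((2 * η t * E x : ℝ) : ℂ) * Φ.1 (t, x) * inner ℂ c (gradR E x)))).1
    linarith
  have hre1 : ((σ : ℂ) * (starRingEnd ℂ (dT Φ.1 (t, x)) *
      (((η t * E x ^ 2 : ℝ) : ℂ) * Φ.1 (t, x)))).re =
      σ * (η t * E x ^ 2) * (starRingEnd ℂ (dT Φ.1 (t, x)) * Φ.1 (t, x)).re := by
    rw [← Complex.re_ofReal_mul]
    congr 1
    push_cast
    ring
  have hκ : 0 ≤ η t * E x ^ 2 := by have := hη0 t; positivity
  rw [Complex.add_re, Complex.add_re, hre1, Complex.re_ofReal_mul]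
  simp only [hderF]
  -- Half of the ellipticity, ν/2, absorbs the gradient part of the cross term coming from ∇(E²);
  -- the remainder is the growth rate 2M²δ²/ν.
  have hyoung : 2 * (M * δ) * (‖Φ.1 (t, x)‖ * ‖g‖) ≤
      ν / 2 * ‖g‖ ^ 2 + 2 * M ^ 2 * δ ^ 2 / ν * ‖Φ.1 (t, x)‖ ^ 2 := by
    have h := sq_nonneg (ν * ‖g‖ - 2 * M * δ * ‖Φ.1 (t, x)‖)
    rw [show ν / 2 * ‖g‖ ^ 2 + 2 * M ^ 2 * δ ^ 2 / ν * ‖Φ.1 (t, x)‖ ^ 2 =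
      (ν ^ 2 * ‖g‖ ^ 2 + 4 * M ^ 2 * δ ^ 2 * ‖Φ.1 (t, x)‖ ^ 2) / (2 * ν) by field_simp; ring,
      le_div_iff₀ (by positivity)]
    nlinarith
  have h5 := mul_le_mul_of_nonneg_left hyoung hκ
  have h6 := mul_le_mul_of_nonneg_left hcg hκ
  linarith

/-- Multiplication by `η(t) E(x)²` is bounded in energy norm. -/
theorem norm_energyMap_weighted_le (Φ : testSpace n) {η : ℝ → ℝ}
    {E : Rn n → ℝ} (hη : Smooth η) (hE : Smooth E) (hη0 : ∀ t, 0 ≤ η t) (hE0 : ∀ x, 0 < E x)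
    {δ C : ℝ} (hδ : ∀ x, ‖gradR E x‖ ≤ δ * E x)
    (h1 : ∀ t x, η t * E x ^ 2 ≤ C) (h2 : ∀ t x, 2 * δ * (η t * E x ^ 2) ≤ C * rho t) :
    ‖energyMap ω ⟨weighted η E Φ.1, isTest_weighted hη hE Φ.2⟩‖ ≤ 2 * C * ‖energyMap ω Φ‖ := by
  have hC : 0 ≤ C := le_trans (by have := hη0 0; positivity) (h1 0 0)
  refine abs_le_of_sq_le_sq' ?_ (by positivity) |>.2
  rw [mul_pow, norm_energyMap_sq, norm_energyMap_sq, ← integral_const_mul]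
  have hint : ∀ Φ : testSpace n, Integrable
      (fun p => rho p.1 ^ 2 * ‖Φ.1 p‖ ^ 2 + ‖dX Φ.1 p‖ ^ 2) (stMeasure ω) := fun Φ => by
    refine Integrable.add ?_
      ((memLp_two_iff_integrable_sq_norm (IsTest.memLp_dX Φ.2).1).mp (IsTest.memLp_dX Φ.2))
    refine ((memLp_two_iff_integrable_sq_norm (IsTest.memLp_rho_mul Φ.2).1).mp
      (IsTest.memLp_rho_mul Φ.2)).congr (ae_of_all _ fun p => by simp [mul_pow])
  refine integral_mono (hint _) ((hint _).const_mul _) fun p => ?_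
  have hκ : 0 ≤ η p.1 * E p.2 ^ 2 := by have := hη0 p.1; positivity
  have hρ := rho_pos p.1
  simp only
  rw [dX_weighted hη hE Φ.2]
  have h3 : ‖((η p.1 * E p.2 ^ 2 : ℝ) : ℂ) • dX Φ.1 p +
      (((2 * η p.1 * E p.2 : ℝ) : ℂ) * Φ.1 p) • gradR E p.2‖ ≤
      C * ‖dX Φ.1 p‖ + C * (rho p.1 * ‖Φ.1 p‖) := by
    refine (norm_add_le _ _).trans (add_le_add ?_ ?_)
    · rw [norm_smul, Complex.norm_real, Real.norm_of_nonneg hκ]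
      exact mul_le_mul_of_nonneg_right (h1 _ _) (norm_nonneg _)
    · have h0 : 0 ≤ 2 * η p.1 * E p.2 := by have := hη0 p.1; have := hE0 p.2; positivity
      rw [norm_smul, norm_mul, Complex.norm_real, Real.norm_of_nonneg h0]
      calc 2 * η p.1 * E p.2 * ‖Φ.1 p‖ * ‖gradR E p.2‖
          ≤ 2 * η p.1 * E p.2 * ‖Φ.1 p‖ * (δ * E p.2) := by gcongr; exact hδ _
        _ = 2 * δ * (η p.1 * E p.2 ^ 2) * ‖Φ.1 p‖ := by ring
        _ ≤ C * rho p.1 * ‖Φ.1 p‖ :=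
            mul_le_mul_of_nonneg_right (h2 _ _) (norm_nonneg _)
        _ = _ := by ring
  have h4 : ‖weighted η E Φ.1 p‖ ≤ C * ‖Φ.1 p‖ := by
    rw [weighted, norm_mul, Complex.norm_real, Real.norm_of_nonneg hκ]
    exact mul_le_mul_of_nonneg_right (h1 _ _) (norm_nonneg _)
  have h5 := pow_le_pow_left₀ (norm_nonneg _) h3 2
  have h6 := pow_le_pow_left₀ (norm_nonneg _) h4 2
  have h7 := mul_le_mul_of_nonneg_left h6 (sq_nonneg (rho p.1))
  nlinarith [sq_nonneg (C * ‖dX Φ.1 p‖ - C * (rho p.1 * ‖Φ.1 p‖)),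
    sq_nonneg (C * ‖dX Φ.1 p‖), sq_nonneg (C * (rho p.1 * ‖Φ.1 p‖))]

/-- Coercivity of the parabolic operator on test functions. -/
theorem coercive (hA : IsElliptic ω A M ν) {σ : ℝ} (hσ : σ = 1 ∨ σ = -1) :
    ∃ c : ℝ, 0 < c ∧ ∀ Φ : testSpace n, ∃ Ψ : testSpace n,
      ‖energyMap ω Ψ‖ ≤ 8 * ‖energyMap ω Φ‖ ∧
      c * ‖energyMap ω Φ‖ ^ 2 ≤ (inner ℂ (operatorMap hA σ Φ) (energyMap ω Ψ)).re := by
  have hν := hA.ν_pos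
  refine ⟨min (1 / 2) (ν / 5), by positivity, fun Φ => ?_⟩
  -- With this multiplier -(σ/2)η' = ρ²/2, which recovers the first component of the energy norm. As
  -- π < 3.15, η stays between 2/5 and 4; this explains ν/5 = (ν/2)(2/5) and, through the factor 2C
  -- with C = 4, the bound 8.
  have hη : Smooth fun t : ℝ => 2 - σ * Real.arctan t :=
    contDiff_const.sub (contDiff_const.mul Real.contDiff_arctan)
  have hE : Smooth fun _ : Rn n => (1 : ℝ) := contDiff_const
  have hpi := Real.pi_lt_d2
  have hb : ∀ t : ℝ, 2 / 5 ≤ 2 - σ * Real.arctan t ∧ 2 - σ * Real.arctan t ≤ 4 := fun t => by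
    have h1 := Real.arctan_lt_pi_div_two t
    have h2 := Real.neg_pi_div_two_lt_arctan t
    rcases hσ with rfl | rfl <;> constructor <;> linarith
  have hη0 : ∀ t : ℝ, 0 ≤ 2 - σ * Real.arctan t := fun t => by linarith [(hb t).1]
  have hgrad : ∀ x : Rn n, ‖gradR (fun _ : Rn n => (1 : ℝ)) x‖ ≤ 0 * 1 := fun x => by
    have : gradR (fun _ : Rn n => (1 : ℝ)) x = 0 := by ext i; simp [gradR]
    rw [this]; simp
  refine ⟨⟨_, isTest_weighted hη hE Φ.2⟩, ?_, ?_⟩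
  · refine (norm_energyMap_weighted_le Φ hη hE hη0 (fun _ => one_pos) hgrad (C := 4)
      (fun t x => by simpa using (hb t).2) fun t x => ?_).trans (by linarith)
    have := rho_pos t
    simp only [mul_zero, zero_mul]
    positivity
  · refine le_trans ?_ (energy_le hA σ Φ hη hE hη0 (fun _ => one_pos) hgrad)
    rw [norm_energyMap_sq, ← integral_const_mul]
    have hΦc : Continuous Φ.1 := Φ.2.1.continuous
    have hdX := Smooth.continuous_dX Φ.2.1
    have hsupp : HasCompactSupport fun p => ‖Φ.1 p‖ ^ 2 :=
      Φ.2.2.comp_left (g := fun z : ℂ => ‖z‖ ^ 2) (by simp)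
    have hsupp' : HasCompactSupport fun p => ‖dX Φ.1 p‖ ^ 2 :=
      (hasCompactSupport_dX Φ.2.2).comp_left (g := fun z : Cn n => ‖z‖ ^ 2) (by simp)
    have hρ := continuous_rho
    have hder : ∀ t : ℝ, deriv (fun t : ℝ => 2 - σ * Real.arctan t) t = -(σ * rho t ^ 2) := by
      intro t
      rw [rho_sq]
      exact (((Real.hasDerivAt_arctan t).const_mul σ).const_sub 2).deriv
    have hηc := hη.continuous
    simp only [hder, one_pow, mul_one]
    refine integral_mono ?_ ?_ fun p => ?_
    · refine Integrable.const_mul (Integrable.add ?_ ?_) _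
      · exact Continuous.integrable_of_hasCompactSupport (by fun_prop) hsupp.mul_left
      · exact Continuous.integrable_of_hasCompactSupport (by fun_prop) hsupp'
    · refine Integrable.add (Integrable.sub ?_ ?_) ?_
      · exact Continuous.integrable_of_hasCompactSupport (by fun_prop) hsupp.mul_left
      · exact Continuous.integrable_of_hasCompactSupport (by fun_prop) hsupp.mul_left.mul_left
      · exact Continuous.integrable_of_hasCompactSupport (by fun_prop) hsupp'.mul_left.mul_left
    · have hσ2 : σ * σ = 1 := by rcases hσ with rfl | rfl <;> norm_num
      have h1 : -(σ / 2) * -(σ * rho p.1 ^ 2) * ‖Φ.1 p‖ ^ 2 =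
          1 / 2 * (rho p.1 ^ 2 * ‖Φ.1 p‖ ^ 2) := by
        linear_combination (1 / 2 * rho p.1 ^ 2 * ‖Φ.1 p‖ ^ 2) * hσ2
      have h2 : min (1 / 2) (ν / 5) * (rho p.1 ^ 2 * ‖Φ.1 p‖ ^ 2) ≤
          1 / 2 * (rho p.1 ^ 2 * ‖Φ.1 p‖ ^ 2) := by gcongr; exact min_le_left _ _
      have h3 : min (1 / 2) (ν / 5) * ‖dX Φ.1 p‖ ^ 2 ≤ ν / 5 * ‖dX Φ.1 p‖ ^ 2 := by
        gcongr; exact min_le_right _ _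
      have h4 : ν / 5 * ‖dX Φ.1 p‖ ^ 2 ≤
          ν / 2 * ((2 - σ * Real.arctan p.1) * ‖dX Φ.1 p‖ ^ 2) := by
        have := mul_le_mul_of_nonneg_right (hb p.1).1 (sq_nonneg ‖dX Φ.1 p‖)
        nlinarith
      simp only [h1]
      norm_num
      linarith

end Energy

end EnergyInequality

/-! ### Abstract existence of strong solutions, and the energy class of limits of test functions. -/

section StrongSolutions

variable {n : ℕ} {ω : Rn n → ℝ}

/-- If the dual problem `⟪r Φ, U⟫ = 0` has only the zero solution in the closure of the range of
`J`, and `r` is coercive relatively to `J`, then `r V = g` has a solution which is a strong limit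
of elements of the range of `J`. -/
theorem exists_strong_solution {H T : Type*} [NormedAddCommGroup H] [InnerProductSpace ℂ H]
    [CompleteSpace H] [AddCommGroup T] [Module ℂ T] (J r : T →ₗ[ℂ] H) {c C : ℝ} (hc : 0 < c) (hC : 0 ≤ C)
    (hcoer : ∀ Φ, ∃ Ψ, ‖J Ψ‖ ≤ C * ‖J Φ‖ ∧ c * ‖J Φ‖ ^ 2 ≤ (inner ℂ (r Φ) (J Ψ)).re)
    (huniq : ∀ U ∈ (LinearMap.range J).topologicalClosure,
      (∀ Φ, inner ℂ (r Φ) U = 0) → U = 0) (g : H) :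
    ∃ (Φ : ℕ → T) (V : H) (ε : ℕ → ℝ), V ∈ (LinearMap.range J).topologicalClosure ∧
      Tendsto (fun k => J (Φ k)) atTop (𝓝 V) ∧ Tendsto ε atTop (𝓝 0) ∧
      ∀ k, ∀ w ∈ (LinearMap.range J).topologicalClosure,
        ‖inner ℂ (r (Φ k)) w - inner ℂ g w‖ ≤ ε k * ‖w‖ := by
  set X := (LinearMap.range J).topologicalClosure with hX
  have hXc : IsClosed (X : Set H) := Submodule.isClosed_topologicalClosure _
  have hJX : ∀ Φ, J Φ ∈ X := fun Φ =>
    Submodule.le_topologicalClosure _ (LinearMap.mem_range_self J Φ)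
  -- Only pairings with elements of X matter, so the source may be approximated modulo Xᗮ. A vector
  -- orthogonal to K lies in Xᗮᗮ = X and solves the homogeneous dual problem, hence vanishes; thus K
  -- is dense.
  set K : Submodule ℂ H := LinearMap.range r ⊔ Xᗮ with hK
  have hXX : Xᗮᗮ = X := by
    have : CompleteSpace X := hXc.completeSpace_coe
    exact Submodule.orthogonal_orthogonal X
  have hKperp : Kᗮ = ⊥ := by
    rw [Submodule.eq_bot_iff]
    intro U hU
    rw [hK, ← Submodule.inf_orthogonal, hXX] at hU
    refine huniq U hU.2 fun Φ => ?_
    exact (Submodule.mem_orthogonal _ _).mp hU.1 _ (LinearMap.mem_range_self r Φ)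
  have hKtop : g ∈ K.topologicalClosure := by
    rw [Submodule.topologicalClosure_eq_top_iff.mpr hKperp]
    trivial
  obtain ⟨y, hyK, hy⟩ := mem_closure_iff_seq_limit.mp hKtop
  have hdec : ∀ k, ∃ Φ, ∃ e ∈ Xᗮ, r Φ + e = y k := fun k => by
    obtain ⟨a, ⟨Φ, rfl⟩, e, he, h⟩ := Submodule.mem_sup.mp (hyK k)
    exact ⟨Φ, e, he, h⟩
  choose Φ e he hye using hdec
  have hinner : ∀ k, ∀ w ∈ X, inner ℂ (r (Φ k)) w = inner ℂ (y k) w := fun k w hw => by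
    rw [← hye, inner_add_left, (Submodule.mem_orthogonal' _ _).mp (he k) w hw, add_zero]
  -- Coercivity applied to the difference Φ k - Φ l: the components in Xᗮ are invisible to J Ψ, so
  -- convergence of y forces J (Φ k) to be Cauchy.
  have hCau : ∀ k l, ‖J (Φ k) - J (Φ l)‖ ≤ C / c * ‖y k - y l‖ := fun k l => by
    obtain ⟨Ψ, h1, h2⟩ := hcoer (Φ k - Φ l)
    rw [map_sub, map_sub] at h2
    rw [map_sub] at h1
    rw [inner_sub_left, hinner k _ (hJX _), hinner l _ (hJX _), ← inner_sub_left] at h2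
    have h3 : (inner ℂ (y k - y l) (J Ψ)).re ≤ ‖y k - y l‖ * ‖J Ψ‖ :=
      (Complex.re_le_norm _).trans (norm_inner_le_norm _ _)
    rw [div_mul_eq_mul_div, le_div_iff₀ hc]
    have h4 : ‖y k - y l‖ * ‖J Ψ‖ ≤ ‖y k - y l‖ * (C * ‖J (Φ k) - J (Φ l)‖) := by gcongr
    rcases eq_or_lt_of_le (norm_nonneg (J (Φ k) - J (Φ l))) with h | h
    · rw [← h, zero_mul]
      positivity
    · nlinarith
  have hcauchy : CauchySeq fun k => J (Φ k) := by
    have hyc := hy.cauchySeq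
    rw [Metric.cauchySeq_iff] at hyc ⊢
    intro δ hδ
    obtain ⟨N, hN⟩ := hyc (δ / (C / c + 1)) (by positivity)
    refine ⟨N, fun k hk l hl => ?_⟩
    have h1 := hN k hk l hl
    rw [dist_eq_norm, lt_div_iff₀ (by positivity)] at h1
    rw [dist_eq_norm]
    have h2 : 0 ≤ ‖y k - y l‖ := norm_nonneg _
    have := hCau k l
    rcases eq_or_lt_of_le h2 with h | h
    · rw [← h] at this
      simp only [mul_zero] at this
      linarith
    · nlinarith
  obtain ⟨V, hV⟩ := cauchySeq_tendsto_of_complete hcauchy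
  refine ⟨Φ, V, fun k => ‖y k - g‖, hXc.mem_of_tendsto hV (Eventually.of_forall fun k => hJX _),
    hV, ?_, fun k w hw => ?_⟩
  · exact tendsto_iff_norm_sub_tendsto_zero.mp hy
  · rw [hinner k w hw, ← inner_sub_left]
    exact norm_inner_le_norm _ _

section Curves

variable [Fact (IsA2 ω)]

/-- The curves `u`, `G` are the time slices of `U = (ρ u, G)`. -/
structure IsCurve (U : EnergySpace ω) (u : ℝ → L2w ω) (G : ℝ → L2wVec ω) : Prop where
  fst : ∀ᵐ t : ℝ, u t =ᵐ[wMeasure ω] fun x => ((rho t)⁻¹ : ℂ) * U.fst (t, x)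
  snd : ∀ᵐ t : ℝ, G t =ᵐ[wMeasure ω] fun x => U.snd (t, x)
  locallyIntegrable : LocallyIntegrable u volume
  memLp : MemLp G 2 volume

theorem exists_isCurve (U : EnergySpace ω) : ∃ u G, IsCurve U u G := by
  obtain ⟨f, hf, hfe⟩ := exists_curry (Lp.memLp U.fst)
  obtain ⟨G, hG, hGe⟩ := exists_curry (Lp.memLp U.snd)
  refine ⟨fun t => ((rho t)⁻¹ : ℝ) • f t, G, ?_, hGe, ?_, hG⟩
  · filter_upwards [hfe] with t ht
    filter_upwards [Lp.coeFn_smul ((rho t)⁻¹ : ℝ) (f t), ht] with x h1 h2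
    rw [h1, Pi.smul_apply, h2]
    simp
  · have h1 : Continuous fun t => (rho t)⁻¹ := continuous_rho.inv₀ fun t => (rho_pos t).ne'
    have hloc : LocallyIntegrable f volume := hf.locallyIntegrable one_le_two
    rw [← locallyIntegrableOn_univ] at hloc ⊢
    exact hloc.continuousOn_smul isOpen_univ.isLocallyClosed h1.continuousOn

/-- For a fixed test function both sides of the defining identity are inner products with fixed
vectors, built from ω⁻¹ ∂_i φ and ω⁻¹ φ, so the identity passes to norm limits. -/
theorem isWeakGrad_of_tendsto {f : ℕ → L2w ω} {g : ℕ → L2wVec ω} {F : L2w ω} {G : L2wVec ω}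
    (hfg : ∀ k, IsWeakGrad (f k) (g k)) (hf : Tendsto f atTop (𝓝 F))
    (hg : Tendsto g atTop (𝓝 G)) : IsWeakGrad F G := by
  have hω : IsA2 ω := Fact.out
  intro φ hφ i
  have hφi : Continuous (partialX i φ) :=
    (hφ.1.continuous_fderiv (by simp)).clm_apply continuous_const
  have hφis : HasCompactSupport (partialX i φ) :=
    (hφ.2.fderiv (𝕜 := ℝ)).comp_left
      (g := fun L : Rn n →L[ℝ] ℂ => L (EuclideanSpace.single i 1)) rfl
  have hm1 := (memLp_inv_mul_test hω hφi hφis).star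
  have hm2' := (memLp_inv_mul_test hω hφ.1.continuous hφ.2).star
  have hm2 : MemLp (fun x => EuclideanSpace.single i
      (star ((((ω x)⁻¹ : ℝ) : ℂ) * φ x))) 2 (wMeasure ω) := by
    refine MemLp.of_le hm2' ?_ (ae_of_all _ fun x => by
      simp)
    refine (Continuous.comp_aestronglyMeasurable (g := fun z : ℂ =>
      (EuclideanSpace.single i z : Cn n)) ?_ hm2'.1)
    exact (PiLp.continuous_toLp 2 (fun _ : Fin n => ℂ)).comp
      (continuous_single (A := fun _ : Fin n => ℂ) i)
  have h1 : ∀ f : L2w ω, ∫ x, f x * partialX i φ x = inner ℂ hm1.toLp f := fun f => by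
    rw [integral_mul_eq_wMeasure hω, inner_toLp_left]
    refine integral_congr_ae (ae_of_all _ fun x => ?_)
    simp [RCLike.inner_apply]
  have h2 : ∀ g : L2wVec ω, ∫ x, g x i * φ x = inner ℂ hm2.toLp g := fun g => by
    rw [integral_mul_eq_wMeasure hω (fun x => g x i), inner_toLp_left]
    refine integral_congr_ae (ae_of_all _ fun x => ?_)
    simp [EuclideanSpace.inner_single_left, mul_comm]
  have h3 : ∀ k, inner ℂ hm1.toLp (f k) = - inner ℂ hm2.toLp (g k) := fun k => by
    rw [← h1, ← h2]
    exact hfg k φ hφ i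
  rw [h1, h2]
  refine tendsto_nhds_unique ((tendsto_const_nhds.inner hf).congr h3) ?_
  exact (tendsto_const_nhds.inner hg).neg

theorem isWeakGrad_test {φ : Rn n → ℂ} (hφ : IsTest φ) {f : L2w ω} {G : L2wVec ω}
    (hf : f =ᵐ[wMeasure ω] φ)
    (hG : G =ᵐ[wMeasure ω] fun x => WithLp.toLp 2 (gradX φ x)) : IsWeakGrad f G := by
  intro χ hχ i
  have hac := absolutelyContinuous_wMeasure (ω := ω) Fact.out
  have h1 : ∫ x, f x * partialX i χ x = ∫ x, φ x * partialX i χ x :=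
    by
    refine integral_congr_ae ?_
    filter_upwards [hac.ae_le hf] with x hx
    rw [hx]
  have h2 : ∫ x, G x i * χ x = ∫ x, partialX i φ x * χ x :=
    by
    refine integral_congr_ae ?_
    filter_upwards [hac.ae_le hG] with x hx
    rw [hx]
    rfl
  have hc : ∀ {φ : Rn n → ℂ}, IsTest φ → Continuous (partialX i φ) := fun hφ =>
    (hφ.1.continuous_fderiv (by simp)).clm_apply continuous_const
  rw [h1, h2]
  refine integral_mul_fderiv_eq_neg_fderiv_mul_of_integrable ?_ ?_ ?_
    (fun x _ => hφ.1.differentiable (by simp) x) (fun x _ => hχ.1.differentiable (by simp) x)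
  · exact ((hc hφ).mul hχ.1.continuous).integrable_of_hasCompactSupport hχ.2.mul_left
  · exact (hφ.1.continuous.mul (hc hχ)).integrable_of_hasCompactSupport hφ.2.mul_right
  · exact (hφ.1.continuous.mul hχ.1.continuous).integrable_of_hasCompactSupport hφ.2.mul_right

theorem IsTest.slice {Φ : ℝ × Rn n → ℂ} (h : IsTest Φ) (t : ℝ) : IsTest fun x => Φ (t, x) := by
  refine ⟨h.1.comp (by fun_prop), ?_⟩
  refine HasCompactSupport.intro (h.2.isCompact.image continuous_snd) fun x hx => ?_
  by_contra h'
  exact hx ⟨(t, x), subset_tsupport _ h', rfl⟩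

/-- U is a limit of pairs (ρΦ, ∇Φ) of test functions. After two extractions of subsequences both
components converge on almost every time slice; there the gradient relation is classical for the
approximants and survives in the limit. -/
theorem IsCurve.isEnergyClass {U : EnergySpace ω} {u : ℝ → L2w ω} {G : ℝ → L2wVec ω}
    (h : IsCurve U u G) (hU : U ∈ (LinearMap.range (energyMap ω)).topologicalClosure) :
    IsEnergyClass u G := by
  refine ⟨h.locallyIntegrable, ?_, h.memLp⟩
  obtain ⟨y, hy, hlim⟩ := mem_closure_iff_seq_limit.mp hU
  choose Φ hΦ using hy
  have hlim' : Tendsto (fun k => energyMap ω (Φ k)) atTop (𝓝 U) := by simpa only [hΦ] using hlim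
  have hl1 : Tendsto (fun k => (energyMap ω (Φ k)).fst) atTop (𝓝 U.fst) :=
    ((continuous_fst.comp (WithLp.prod_continuous_ofLp 2 _ _)).tendsto U).comp hlim'
  have hl2 : Tendsto (fun k => (energyMap ω (Φ k)).snd) atTop (𝓝 U.snd) :=
    ((continuous_snd.comp (WithLp.prod_continuous_ofLp 2 _ _)).tendsto U).comp hlim'
  rw [Lp.tendsto_Lp_iff_tendsto_eLpNorm'] at hl1 hl2
  have hl1' : Tendsto (fun k => eLpNorm ((fun p => (rho p.1 : ℂ) * (Φ k).1 p) - ⇑U.fst) 2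
      (stMeasure ω)) atTop (𝓝 0) := by
    refine hl1.congr fun k => eLpNorm_congr_ae ?_
    exact (energyMap_fst (Φ k)).sub (ae_eq_refl _)
  have hl2' : Tendsto (fun k => eLpNorm (dX (Φ k).1 - ⇑U.snd) 2
      (stMeasure ω)) atTop (𝓝 0) := by
    refine hl2.congr fun k => eLpNorm_congr_ae ?_
    exact (energyMap_snd (Φ k)).sub (ae_eq_refl _)
  obtain ⟨ns, hns, hae1⟩ := exists_subseq_tendsto_slices
    (fun k => (IsTest.memLp_rho_mul (Φ k).2).1) (Lp.aestronglyMeasurable _) hl1'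
  obtain ⟨ms, hms, hae2⟩ := exists_subseq_tendsto_slices
    (fun k => (IsTest.memLp_dX (Φ (ns k)).2).1) (Lp.aestronglyMeasurable _)
    (hl2'.comp hns.tendsto_atTop)
  filter_upwards [hae1, hae2, h.fst, h.snd] with t h1 h2 hu hG
  have hs : ∀ k, IsTest fun x => (Φ k).1 (t, x) := fun k => IsTest.slice (Φ k).2 t
  have hgs : ∀ k, MemLp (fun x => dX (Φ k).1 (t, x)) 2 (wMeasure ω) := fun k => by
    refine Continuous.memLp_of_hasCompactSupport
      ((Smooth.continuous_dX (Φ k).2.1).comp (by fun_prop)) ?_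
    refine HasCompactSupport.intro ((hasCompactSupport_dX (Φ k).2.2).isCompact.image
      continuous_snd) fun x hx => ?_
    by_contra h'
    exact hx ⟨(t, x), subset_tsupport _ h', rfl⟩
  refine isWeakGrad_of_tendsto (f := fun k => ((hs (ns (ms k))).memLp 2).toLp)
    (g := fun k => (hgs (ns (ms k))).toLp) (fun k => ?_) ?_ ?_
  · refine isWeakGrad_test (hs (ns (ms k))) (MemLp.coeFn_toLp _)
      ((MemLp.coeFn_toLp _).trans (ae_of_all _ fun x => ?_))
    simp only
    rw [gradX_slice ((Φ _).2.1.differentiable (by simp) _)]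
  · rw [Lp.tendsto_Lp_iff_tendsto_eLpNorm']
    have h3 : Tendsto (fun k => ‖((rho t)⁻¹ : ℂ)‖ₑ * eLpNorm
        (fun x => (rho t : ℂ) * (Φ (ns (ms k))).1 (t, x) - U.fst (t, x)) 2 (wMeasure ω))
        atTop (𝓝 0) := by
      simpa using ENNReal.Tendsto.const_mul (h1.comp hms.tendsto_atTop)
        (Or.inr (enorm_ne_top (x := ((rho t)⁻¹ : ℂ))))
    refine h3.congr fun k => ?_
    rw [← eLpNorm_const_smul]
    refine eLpNorm_congr_ae ?_
    filter_upwards [MemLp.coeFn_toLp ((hs (ns (ms k))).memLp (ω := ω) 2), hu] with x e1 e2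
    rw [Pi.sub_apply, e1, e2]
    have : (rho t : ℂ) ≠ 0 := by exact_mod_cast (rho_pos _).ne'
    simp only [Pi.smul_apply, smul_eq_mul]
    field_simp
  · rw [Lp.tendsto_Lp_iff_tendsto_eLpNorm']
    refine h2.congr fun k => eLpNorm_congr_ae ?_
    filter_upwards [MemLp.coeFn_toLp (hgs (ns (ms k))), hG] with x e1 e2
    rw [Pi.sub_apply, e1, e2]

end Curves

end StrongSolutions

/-! ### Weak solutions, uniqueness, and strong solutions of the parabolic equation. -/

section WeakSolutions

variable {n : ℕ} {ω : Rn n → ℝ}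

/-- `σ ∂_t u - ω⁻¹ div_x(A ∇ₓ u) = φ ⊗ ψ` in `𝒟'(ℝ × ℝⁿ)`, where `G = ∇ₓ u`. -/
def WeakSol (σ : ℝ) (A : ℝ → Rn n → Matrix (Fin n) (Fin n) ℂ)
    (u : ℝ → L2w ω) (G : ℝ → L2wVec ω) (φ : ℝ → ℂ) (ψ : L2w ω) : Prop :=
  ∀ Φ : ℝ × Rn n → ℂ, IsTest Φ →
    ∫ t, ∫ x, (-((σ : ℂ) * (u t x * deriv (fun τ => Φ (τ, x)) t)) +
        ((ω x)⁻¹ : ℂ) * ((A t x).mulVec (G t x).ofLp ⬝ᵥ gradX (fun y => Φ (t, y)) x))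
          ∂(wMeasure ω)
      = ∫ t, ∫ x, φ t * ψ x * Φ (t, x) ∂(wMeasure ω)

theorem weakSol_one_iff {A : ℝ → Rn n → Matrix (Fin n) (Fin n) ℂ}
    {u : ℝ → L2w ω} {G : ℝ → L2wVec ω} {φ : ℝ → ℂ} {ψ : L2w ω} :
    WeakSol 1 A u G φ ψ ↔ SolvesForward A u G φ ψ := by
  simp only [WeakSol, SolvesForward, Complex.ofReal_one, one_mul]

theorem weakSol_neg_one_iff {A : ℝ → Rn n → Matrix (Fin n) (Fin n) ℂ}
    {u : ℝ → L2w ω} {G : ℝ → L2wVec ω} {φ : ℝ → ℂ} {ψ : L2w ω} :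
    WeakSol (-1) (fun t x => (A t x).conjTranspose) u G φ ψ ↔ SolvesBackward A u G φ ψ := by
  simp only [WeakSol, SolvesBackward, Complex.ofReal_neg, Complex.ofReal_one, neg_mul, one_mul,
    neg_neg]

/-- Uniqueness in the energy class. -/
def EnergyUnique (ω : Rn n → ℝ) (σ : ℝ) (A : ℝ → Rn n → Matrix (Fin n) (Fin n) ℂ) : Prop :=
  ∀ (u : ℝ → L2w ω) (G : ℝ → L2wVec ω), IsEnergyClass u G → WeakSol σ A u G 0 0 →
    ∀ᵐ t : ℝ, u t = 0

/-! ### Complex conjugation, linking the bilinear weak form to the sesquilinear inner product. -/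

section Conjugation

theorem fderiv_conj {V : Type*} [NormedAddCommGroup V] [NormedSpace ℝ V] {f : V → ℂ} {x : V}
    (h : DifferentiableAt ℝ f x) (v : V) :
    fderiv ℝ (fun y => starRingEnd ℂ (f y)) x v = starRingEnd ℂ (fderiv ℝ f x v) := by
  have h1 : HasFDerivAt (fun y => starRingEnd ℂ (f y)) _ x :=
    ((Complex.conjCLE : ℂ →L[ℝ] ℂ).hasFDerivAt).comp x h.hasFDerivAt
  rw [h1.fderiv]
  simp

theorem IsTest.conj {V : Type*} [NormedAddCommGroup V] [NormedSpace ℝ V] {Φ : V → ℂ}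
    (h : IsTest Φ) : IsTest fun p => starRingEnd ℂ (Φ p) :=
  ⟨(Complex.conjCLE : ℂ →L[ℝ] ℂ).contDiff.comp h.1, h.2.comp_left (map_zero _)⟩

/-- The complex conjugate of a test function. -/
def conjTest (Φ : testSpace n) : testSpace n := ⟨fun p => starRingEnd ℂ (Φ.1 p), IsTest.conj Φ.2⟩

theorem dT_conjTest (Φ : testSpace n) (p : ℝ × Rn n) :
    dT (conjTest Φ).1 p = starRingEnd ℂ (dT Φ.1 p) :=
  fderiv_conj (Φ.2.1.differentiable (by simp) p) _

theorem dX_conjTest (Φ : testSpace n) (p : ℝ × Rn n) :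
    (dX (conjTest Φ).1 p).ofLp = star (dX Φ.1 p).ofLp := by
  funext i
  exact fderiv_conj (Φ.2.1.differentiable (by simp) p) _

end Conjugation

variable [Fact (IsA2 ω)] {A : ℝ → Rn n → Matrix (Fin n) (Fin n) ℂ} {M ν : ℝ}

theorem integrable_inner_operatorMap (hA : IsElliptic ω A M ν) (σ : ℝ) (Φ : testSpace n)
    (U : EnergySpace ω) : Integrable (fun p =>
      (((σ * (rho p.1)⁻¹ : ℝ) : ℂ) * (starRingEnd ℂ (dT Φ.1 p) * U.fst p) +
        inner ℂ (coef ω A p (dX Φ.1 p)) (U.snd p))) (stMeasure ω) := by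
  have h1 := integrable_inner_memLp (IsTest.memLp_inv_rho_mul_dT Φ.2 σ (ω := ω)) (Lp.memLp U.fst)
  have h2 := integrable_inner_memLp (IsTest.memLp_coef_dX hA Φ.2) (Lp.memLp U.snd)
  refine (h1.add h2).congr (ae_of_all _ fun p => ?_)
  simp only [Pi.add_apply, RCLike.inner_apply, map_mul, Complex.conj_ofReal]
  ring

/-- The weak form of the equation, as an inner product in the energy space. -/
theorem IsCurve.integral_eq_inner (hA : IsElliptic ω A M ν) (σ : ℝ) {U : EnergySpace ω}
    {u : ℝ → L2w ω} {G : ℝ → L2wVec ω} (h : IsCurve U u G) (Φ : testSpace n) :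
    ∫ t, ∫ x, (-(((-σ : ℝ) : ℂ) * (u t x * deriv (fun τ => Φ.1 (τ, x)) t)) +
        ((ω x)⁻¹ : ℂ) * ((A t x).conjTranspose.mulVec (G t x).ofLp ⬝ᵥ
          gradX (fun y => Φ.1 (t, y)) x)) ∂(wMeasure ω) =
      inner ℂ (operatorMap hA σ (conjTest Φ)) U := by
  rw [inner_operatorMap, integral_prod _ (integrable_inner_operatorMap hA σ _ U)]
  refine integral_congr_ae ?_
  filter_upwards [h.fst, h.snd] with t h1 h2
  refine integral_congr_ae ?_
  filter_upwards [h1, h2] with x e1 e2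
  rw [e1, e2, inner_coef_left, inner_coef, dX_conjTest, dT_conjTest, star_star,
    Complex.conj_conj, (hasDerivAt_time (Φ.2.1.differentiable (by simp) (t, x))).deriv,
    gradX_slice (Φ.2.1.differentiable (by simp) (t, x))]
  push_cast
  ring

/-- After the coefficients are moved to the other side, the two pairings differ by a multiple of ∫
∂_t(Ψ̄ Φ) dμ = 0: integration by parts in time reverses σ and replaces A by its hermitian adjoint.
-/
theorem operatorMap_dual (hA : IsElliptic ω A M ν) (σ : ℝ) (Φ Ψ : testSpace n) :
    inner ℂ (operatorMap hA.conjTranspose (-σ) Ψ) (energyMap ω Φ) =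
      starRingEnd ℂ (inner ℂ (operatorMap hA σ Φ) (energyMap ω Ψ)) := by
  have h1 := integrable_inner_operatorMap hA.conjTranspose (-σ) Ψ (energyMap ω Φ)
  have h2 := integrable_inner_operatorMap hA σ Φ (energyMap ω Ψ)
  have hs : IsTest fun p => starRingEnd ℂ (Ψ.1 p) * Φ.1 p :=
    ⟨(IsTest.conj Ψ.2).1.mul Φ.2.1, Φ.2.2.mul_left⟩
  have hd : ∀ p, dT (fun p => starRingEnd ℂ (Ψ.1 p) * Φ.1 p) p =
      starRingEnd ℂ (dT Ψ.1 p) * Φ.1 p + starRingEnd ℂ (Ψ.1 p) * dT Φ.1 p := by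
    rintro ⟨t, x⟩
    have e1 := hasDerivAt_time (hs.1.differentiable (by simp) (t, x))
    have e2 := hasDerivAt_time ((conjTest Ψ).2.1.differentiable (by simp) (t, x))
    have e3 := hasDerivAt_time (Φ.2.1.differentiable (by simp) (t, x))
    rw [dT_conjTest] at e2
    exact e1.unique (e2.mul e3)
  have h0 : ∫ p, dT (fun p => starRingEnd ℂ (Ψ.1 p) * Φ.1 p) p ∂(stMeasure ω) = 0 :=
    integral_dT (hs.1.of_le (by simp)) hs.2
  have hi : Integrable (dT (fun p => starRingEnd ℂ (Ψ.1 p) * Φ.1 p)) (stMeasure ω) :=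
    (Smooth.continuous_dT hs.1).integrable_of_hasCompactSupport (hasCompactSupport_dT hs.2)
  rw [inner_operatorMap, inner_operatorMap, ← integral_conj]
  rw [← sub_eq_zero, ← integral_sub h1 (by exact (Complex.conjCLE : ℂ →L[ℝ] ℂ).integrable_comp h2),
    ← mul_zero (-(σ : ℂ)), ← h0, ← integral_const_mul]
  refine integral_congr_ae ?_
  filter_upwards [energyMap_fst (ω := ω) Ψ, energyMap_snd (ω := ω) Ψ,
    energyMap_fst (ω := ω) Φ, energyMap_snd (ω := ω) Φ] with p e1 e2 e3 e4
  have : (rho p.1 : ℂ) ≠ 0 := by exact_mod_cast (rho_pos _).ne'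
  rw [e1, e2, e3, e4, hd, inner_coef_left]
  simp only [Matrix.conjTranspose_conjTranspose, map_add, map_mul, Complex.conj_ofReal,
    Complex.conj_conj, inner_conj_symm]
  push_cast
  field_simp
  ring

/-- A vanishing function has vanishing weak gradient. -/
theorem IsWeakGrad.eq_zero {G : L2wVec ω} (h : IsWeakGrad (0 : L2w ω) G) : G = 0 := by
  have hω : IsA2 ω := Fact.out
  have hac := absolutelyContinuous_wMeasure hω
  have hloc : ∀ i, LocallyIntegrable (fun x => G x i) (volume : Measure (Rn n)) := fun i => by
    rw [locallyIntegrable_iff]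
    intro K hK
    obtain ⟨f, hf1, -, hfc, -⟩ := exists_continuous_one_zero_of_isCompact (X := Rn n) hK
      isClosed_empty (disjoint_empty _)
    have hfC : Continuous fun x => (f x : ℂ) := Complex.continuous_ofReal.comp f.continuous
    have hfs : HasCompactSupport fun x => (f x : ℂ) :=
      hfc.comp_left (g := fun r : ℝ => (r : ℂ)) rfl
    have hm := memLp_inv_mul_test hω hfC hfs
    have hGi : MemLp (fun x => G x i) 2 (wMeasure ω) :=
      (Lp.memLp G).of_le ((PiLp.continuous_apply 2 (fun _ : Fin n => ℂ) i
        |>.comp_aestronglyMeasurable (Lp.aestronglyMeasurable G)))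
        (ae_of_all _ fun x => PiLp.norm_apply_le _ i)
    have hint := (integrable_wMeasure_iff hω _).mp (hm.integrable_mul hGi)
    refine hint.integrableOn.congr_fun (fun x hx => ?_) hK.measurableSet
    have h0 : (ω x : ℂ) ≠ 0 := by exact_mod_cast (hω.pos x).ne'
    simp [hf1 hx, h0]
  have h0 : ∀ i, ∀ᵐ x ∂(wMeasure ω), G x i = 0 := fun i => by
    refine wMeasure_absolutelyContinuous.ae_le
      (ae_eq_zero_of_integral_contDiff_smul_eq_zero (hloc i) fun g hg hgs => ?_)
    have h1 := h (fun x => (g x : ℂ)) ⟨Complex.ofRealCLM.contDiff.comp hg,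
      hgs.comp_left (g := fun r : ℝ => (r : ℂ)) rfl⟩ i
    have h2 : ∫ x, (0 : L2w ω) x * partialX i (fun x => (g x : ℂ)) x = 0 := by
      refine integral_eq_zero_of_ae ?_
      filter_upwards [hac.ae_le (Lp.coeFn_zero ℂ 2 (wMeasure ω))] with x hx
      rw [hx]
      simp
    rw [h2, eq_comm, neg_eq_zero] at h1
    rw [← h1]
    refine integral_congr_ae (ae_of_all _ fun x => ?_)
    simp [mul_comm]
  rw [Lp.eq_zero_iff_ae_eq_zero]
  filter_upwards [ae_all_iff.mpr h0] with x hx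
  ext i
  exact hx i

/-- Orthogonality to the range of `operatorMap hA σ` says that the curve of U is an energy solution
of the homogeneous adjoint equation. Uniqueness kills u, and a zero function has zero weak gradient,
so both components of U vanish. -/
theorem EnergyUnique.eq_zero (hA : IsElliptic ω A M ν) {σ : ℝ}
    (hu : EnergyUnique ω (-σ) fun t x => (A t x).conjTranspose) {U : EnergySpace ω}
    (hU : U ∈ (LinearMap.range (energyMap ω)).topologicalClosure)
    (h : ∀ Φ, inner ℂ (operatorMap hA σ Φ) U = 0) : U = 0 := by
  obtain ⟨u, G, hc⟩ := exists_isCurve U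
  have hen := hc.isEnergyClass hU
  have h0 := hu u G hen fun Φ hΦ => by
    rw [hc.integral_eq_inner hA σ ⟨Φ, hΦ⟩, h]
    simp
  have hG0 : ∀ᵐ t : ℝ, G t = 0 := by
    filter_upwards [h0, hen.grad] with t h1 h2
    rw [h1] at h2
    exact h2.eq_zero
  have e1 : ∀ᵐ p ∂(stMeasure ω), U.fst p = 0 := by
    have hm : MeasurableSet {p | U.fst p = 0} :=
      measurableSet_eq_fun (Lp.stronglyMeasurable U.fst).measurable measurable_const
    rw [Measure.ae_prod_iff_ae_ae hm]
    filter_upwards [h0, hc.fst] with t h1 h2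
    rw [h1] at h2
    filter_upwards [h2, Lp.coeFn_zero ℂ 2 (wMeasure ω)] with x h3 h4
    rw [h4] at h3
    have : (rho t : ℂ) ≠ 0 := by exact_mod_cast (rho_pos _).ne'
    simpa [this] using h3.symm
  have e2 : ∀ᵐ p ∂(stMeasure ω), U.snd p = 0 := by
    have hm : MeasurableSet {p | U.snd p = 0} :=
      measurableSet_eq_fun (Lp.stronglyMeasurable U.snd).measurable measurable_const
    rw [Measure.ae_prod_iff_ae_ae hm]
    filter_upwards [hG0, hc.snd] with t h1 h2
    rw [h1] at h2
    filter_upwards [h2, Lp.coeFn_zero (Cn n) 2 (wMeasure ω)] with x h3 h4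
    rw [h4] at h3
    simpa using h3.symm
  have e1' : U.fst = 0 := (Lp.eq_zero_iff_ae_eq_zero).mpr e1
  have e2' : U.snd = 0 := (Lp.eq_zero_iff_ae_eq_zero).mpr e2
  have : U = WithLp.toLp 2 (U.fst, U.snd) := rfl
  rw [this, e1', e2']
  rfl

theorem memLp_inv_rho_mul {F : ℝ × Rn n → ℂ} (h : IsTest F) :
    MemLp (fun p => (((rho p.1)⁻¹ : ℝ) : ℂ) * F p) 2 (stMeasure ω) := by
  refine Continuous.memLp_of_hasCompactSupport ?_ h.2.mul_left
  have h1 : Continuous fun t => (rho t)⁻¹ := continuous_rho.inv₀ fun t => (rho_pos t).ne'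
  exact (Complex.continuous_ofReal.comp (h1.comp continuous_fst)).mul h.1.continuous

variable (ω) in
/-- The functional `U = (ρ u, G) ↦ ∫ u F̄ dμ`, as an element of the energy space. -/
def sourceVec (F : testSpace n) : EnergySpace ω :=
  WithLp.toLp 2 ((memLp_inv_rho_mul F.2).toLp, 0)

theorem inner_sourceVec (F : testSpace n) (U : EnergySpace ω) :
    inner ℂ (sourceVec ω F) U =
      ∫ p, starRingEnd ℂ (F.1 p) * ((((rho p.1)⁻¹ : ℝ) : ℂ) * U.fst p) ∂(stMeasure ω) := by
  rw [WithLp.prod_inner_apply]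
  change inner ℂ (memLp_inv_rho_mul F.2).toLp U.fst + inner ℂ 0 U.snd = _
  rw [inner_zero_left, add_zero, inner_toLp_left]
  refine integral_congr_ae (ae_of_all _ fun p => ?_)
  simp only [RCLike.inner_apply, map_mul, Complex.conj_ofReal]
  ring

theorem inner_sourceVec_energyMap (F Ψ : testSpace n) :
    inner ℂ (sourceVec ω F) (energyMap ω Ψ) =
      ∫ p, starRingEnd ℂ (F.1 p) * Ψ.1 p ∂(stMeasure ω) := by
  rw [inner_sourceVec]
  refine integral_congr_ae ?_
  filter_upwards [energyMap_fst (ω := ω) Ψ] with p h1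
  rw [h1]
  have : (rho p.1 : ℂ) ≠ 0 := by exact_mod_cast (rho_pos _).ne'
  push_cast
  field_simp

/-- `V` is a strong limit of test functions `Φ k` that solve `σ ∂_t Φ - ω⁻¹ div(A ∇Φ) = F` up to
errors that vanish in the dual of the energy space. -/
structure StrongSol (hA : IsElliptic ω A M ν) (σ : ℝ) (F : testSpace n) (Φ : ℕ → testSpace n)
    (V : EnergySpace ω) (ε : ℕ → ℝ) : Prop where
  mem : V ∈ (LinearMap.range (energyMap ω)).topologicalClosure
  tendsto : Tendsto (fun k => energyMap ω (Φ k)) atTop (𝓝 V)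
  tendsto_zero : Tendsto ε atTop (𝓝 0)
  bound : ∀ k, ∀ w ∈ (LinearMap.range (energyMap ω)).topologicalClosure,
    ‖inner ℂ (operatorMap hA σ (Φ k)) w - inner ℂ (sourceVec ω F) w‖ ≤ ε k * ‖w‖

/-- Existence for one equation out of uniqueness for the adjoint one, since `EnergyUnique.eq_zero`
is exactly the dual uniqueness that the abstract existence result asks for. -/
theorem exists_strongSol (hA : IsElliptic ω A M ν) {σ : ℝ} (hσ : σ = 1 ∨ σ = -1)
    (hu : EnergyUnique ω (-σ) fun t x => (A t x).conjTranspose) (F : testSpace n) :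
    ∃ Φ V ε, StrongSol hA σ F Φ V ε := by
  obtain ⟨c, hc, hcoer⟩ := coercive hA hσ
  obtain ⟨Φ, V, ε, h1, h2, h3, h4⟩ := exists_strong_solution (energyMap ω) (operatorMap hA σ) hc
    (by norm_num : (0 : ℝ) ≤ 8) hcoer (fun U hU h => hu.eq_zero hA hU h) (sourceVec ω F)
  exact ⟨Φ, V, ε, h1, h2, h3, h4⟩

theorem StrongSol.tendsto_inner {hA : IsElliptic ω A M ν} {σ : ℝ} {F : testSpace n}
    {Φ : ℕ → testSpace n} {V : EnergySpace ω} {ε : ℕ → ℝ} (h : StrongSol hA σ F Φ V ε)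
    {w : EnergySpace ω} (hw : w ∈ (LinearMap.range (energyMap ω)).topologicalClosure) :
    Tendsto (fun k => inner ℂ (operatorMap hA σ (Φ k)) w) atTop
      (𝓝 (inner ℂ (sourceVec ω F) w)) := by
  rw [tendsto_iff_norm_sub_tendsto_zero]
  refine squeeze_zero (fun _ => norm_nonneg _) (fun k => h.bound k w hw) ?_
  simpa using h.tendsto_zero.mul_const ‖w‖

theorem energyMap_mem (Φ : testSpace n) :
    energyMap ω Φ ∈ (LinearMap.range (energyMap ω)).topologicalClosure :=
  Submodule.le_topologicalClosure _ (LinearMap.mem_range_self _ Φ)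

/-- The duality identity moves the operator from Φ k onto Ψ; then Φ k tends to V on one side and its
image to the source on the other. -/
theorem StrongSol.inner_dual {hA : IsElliptic ω A M ν} {σ : ℝ} {F : testSpace n}
    {Φ : ℕ → testSpace n} {V : EnergySpace ω} {ε : ℕ → ℝ} (h : StrongSol hA σ F Φ V ε)
    (Ψ : testSpace n) : inner ℂ (operatorMap hA.conjTranspose (-σ) Ψ) V =
      ∫ p, F.1 p * starRingEnd ℂ (Ψ.1 p) ∂(stMeasure ω) := by
  have h1 := (Complex.continuous_conj.tendsto _).comp (h.tendsto_inner (energyMap_mem Ψ))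
  have h2 : Tendsto (fun k => inner ℂ (operatorMap hA.conjTranspose (-σ) Ψ)
      (energyMap ω (Φ k))) atTop (𝓝 (inner ℂ (operatorMap hA.conjTranspose (-σ) Ψ) V)) :=
    tendsto_const_nhds.inner h.tendsto
  rw [tendsto_nhds_unique h2 (h1.congr fun k => (operatorMap_dual hA σ _ _).symm),
    inner_sourceVec_energyMap, ← integral_conj]
  simp

/-- The test function `φ ⊗ ψ`. -/
def tensor {φ : ℝ → ℂ} {ψ : Rn n → ℂ} (hφ : IsTest φ) (hψ : IsTest ψ) : testSpace n :=
  ⟨fun p => φ p.1 * ψ p.2, (hφ.1.comp contDiff_fst).mul (hψ.1.comp contDiff_snd), by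
    refine HasCompactSupport.intro (hφ.2.isCompact.prod hψ.2.isCompact) fun p hp => ?_
    rw [mem_prod, not_and_or] at hp
    rcases hp with hp | hp
    · simp [image_eq_zero_of_notMem_tsupport hp]
    · simp [image_eq_zero_of_notMem_tsupport hp]⟩

/-- This makes the strong solution eligible for the representation property, the only link between
the equation and the given propagators. -/
theorem StrongSol.weakSol {hA : IsElliptic ω A M ν} {σ : ℝ} {φ : ℝ → ℂ} {ψ₀ : Rn n → ℂ}
    {hφ : IsTest φ} {hψ₀ : IsTest ψ₀} {ψ : L2w ω} (hψ : ψ =ᵐ[wMeasure ω] ψ₀)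
    {Φ : ℕ → testSpace n} {V : EnergySpace ω} {ε : ℕ → ℝ}
    (h : StrongSol hA σ (tensor hφ hψ₀) Φ V ε) {u : ℝ → L2w ω} {G : ℝ → L2wVec ω}
    (hc : IsCurve V u G) : WeakSol σ A u G φ ψ := by
  intro Θ hΘ
  have h1 := hc.integral_eq_inner hA.conjTranspose (-σ) ⟨Θ, hΘ⟩
  simp only [Matrix.conjTranspose_conjTranspose, neg_neg] at h1
  have hint : Integrable (fun p : ℝ × Rn n => φ p.1 * ψ₀ p.2 * Θ p) (stMeasure ω) :=
    (((tensor hφ hψ₀).2.1.continuous).mul hΘ.1.continuous).integrable_of_hasCompactSupport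
      hΘ.2.mul_left
  have h2 : ∫ t, ∫ x, φ t * ψ x * Θ (t, x) ∂(wMeasure ω) =
      ∫ p, φ p.1 * ψ₀ p.2 * Θ p ∂(stMeasure ω) := by
    rw [integral_prod _ hint]
    refine integral_congr_ae (ae_of_all _ fun t => integral_congr_ae ?_)
    filter_upwards [hψ] with x hx
    rw [hx]
  rw [h1, h.inner_dual, h2]
  refine integral_congr_ae (ae_of_all _ fun p => ?_)
  simp [tensor, conjTest]

end WeakSolutions

/-! ### Time cutoffs and propagators. -/

section Propagators

variable {n : ℕ} {ω : Rn n → ℝ}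

/-- The function ∫ b - ∫_{-∞}^t b has derivative -b and vanishes after the support of b, but is
constant in the past. A smooth transition, equal to 1 from a - 1 on and to 0 before a - 2, makes it
compactly supported without touching times t ≥ a. -/
theorem exists_cutoff_forward {b : ℝ → ℝ} {a a' : ℝ} (hb : Smooth b) (hb0 : ∀ t, 0 ≤ b t)
    (hsupp : ∀ t, b t ≠ 0 → a < t ∧ t < a') :
    ∃ η : ℝ → ℝ, Smooth η ∧ (∀ t, 0 ≤ η t) ∧ (∀ t, η t ≤ ∫ s, b s) ∧
      (∀ t, η t ≠ 0 → a - 2 < t ∧ t < a') ∧ (∀ t, a ≤ t → deriv η t = -b t) ∧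
      ∀ t, a ≤ t → (∀ s, s ≤ t → b s = 0) → η t = ∫ s, b s := by
  have hbc := hb.continuous
  have hzl : ∀ t, t ≤ a → b t = 0 := fun t ht => by
    by_contra h; exact absurd (hsupp t h).1 (not_lt.mpr ht)
  have hzr : ∀ t, a' ≤ t → b t = 0 := fun t ht => by
    by_contra h; exact absurd (hsupp t h).2 (not_lt.mpr ht)
  have hbs : HasCompactSupport b := HasCompactSupport.intro (isCompact_Icc (a := a) (b := a'))
    fun t ht => by
      by_contra h
      exact ht ⟨(hsupp t h).1.le, (hsupp t h).2.le⟩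
  have hint : Integrable b := hbc.integrable_of_hasCompactSupport hbs
  set P : ℝ → ℝ := fun t => ∫ s in a..t, b s with hP
  have hPd : ∀ t, HasDerivAt P (b t) t := fun t =>
    intervalIntegral.integral_hasDerivAt_right (hbc.intervalIntegrable _ _)
      (hbc.stronglyMeasurableAtFilter _ _) hbc.continuousAt
  have hPs : Smooth P := by
    rw [Smooth, contDiff_infty_iff_deriv]
    refine ⟨fun t => (hPd t).differentiableAt, ?_⟩
    rw [show deriv P = b from funext fun t => (hPd t).deriv]
    exact hb
  have hPmono : Monotone P := monotone_of_hasDerivAt_nonneg hPd hb0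
  have hPa : P a = 0 := intervalIntegral.integral_same
  have hPtop : ∀ t, a' ≤ t → a ≤ t → P t = ∫ s, b s := fun t ht hat => by
    rw [hP]
    simp only
    rw [intervalIntegral.integral_eq_integral_of_support_subset]
    intro s hs
    exact ⟨(hsupp s hs).1, (hsupp s hs).2.le.trans ht⟩
  have hPle : ∀ t, P t ≤ ∫ s, b s := fun t => by
    rw [← hPtop (max t (max a a')) (by simp) (by simp)]
    exact hPmono (le_max_left _ _)
  have hI : 0 ≤ ∫ s, b s := integral_nonneg hb0
  have hPleft : ∀ t, t ≤ a → P t = 0 := fun t ht => by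
    rw [hP]
    simp only
    rw [intervalIntegral.integral_symm, intervalIntegral.integral_of_le ht,
      setIntegral_eq_zero_of_forall_eq_zero fun s hs => hzl s hs.2, neg_zero]
  have hP0 : ∀ t, 0 ≤ P t := fun t => by
    rcases le_total t a with h | h
    · rw [hPleft t h]
    · rw [← hPa]; exact hPmono h
  set χ : ℝ → ℝ := fun t => Real.smoothTransition (t - a + 2) with hχ
  have hχs : Smooth χ := Real.smoothTransition.contDiff.comp (by fun_prop)
  have hχ1 : ∀ t, a - 1 ≤ t → χ t = 1 := fun t ht =>
    Real.smoothTransition.one_of_one_le (by linarith)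
  have hχ0 : ∀ t, t ≤ a - 2 → χ t = 0 := fun t ht =>
    Real.smoothTransition.zero_of_nonpos (by linarith)
  refine ⟨fun t => χ t * ((∫ s, b s) - P t), hχs.mul (contDiff_const.sub hPs), fun t => ?_,
    fun t => ?_, fun t ht => ?_, fun t ht => ?_, fun t ht hz => ?_⟩
  · exact mul_nonneg (Real.smoothTransition.nonneg _) (by linarith [hPle t])
  · have h1 : χ t ≤ 1 := Real.smoothTransition.le_one _
    have h0 : 0 ≤ χ t := Real.smoothTransition.nonneg _
    have := hP0 t
    have := hPle t
    nlinarith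
  · constructor
    · by_contra h
      exact ht (by simp [hχ0 t (by linarith)])
    · by_contra h
      push Not at h
      rcases le_total a t with h' | h'
      · exact ht (by simp [hPtop t h h'])
      · have hb' : ∀ s, b s = 0 := fun s => by
          rcases le_total s a with hs | hs
          · exact hzl s hs
          · exact hzr s ((h.trans h').trans hs)
        exact ht (by simp [hPleft t h', hb'])
  · have h1 : (fun t => χ t * ((∫ s, b s) - P t)) =ᶠ[𝓝 t] fun t => (∫ s, b s) - P t := by
      filter_upwards [lt_mem_nhds (show a - 1 < t by linarith)] with s hs
      rw [hχ1 s hs.le, one_mul]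
    rw [h1.deriv_eq]
    exact ((hPd t).const_sub _).deriv
  · have h1 : P t = 0 := by
      rw [hP]
      simp only
      rw [intervalIntegral.integral_of_le ht,
        setIntegral_eq_zero_of_forall_eq_zero fun s hs => hz s hs.2]
    simp only [h1, sub_zero, hχ1 t (by linarith), one_mul]

/-- A primitive of `-σ b`, cut off at times before the support of `b`. -/
theorem exists_cutoff {σ : ℝ} (hσ : σ = 1 ∨ σ = -1) {b : ℝ → ℝ} {a a' : ℝ} (hb : Smooth b)
    (hb0 : ∀ t, 0 ≤ b t) (hsupp : ∀ t, b t ≠ 0 → a < σ * t ∧ σ * t < a') :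
    ∃ η : ℝ → ℝ, Smooth η ∧ (∀ t, 0 ≤ η t) ∧ (∀ t, η t ≤ ∫ s, b s) ∧
      (∀ t, η t ≠ 0 → a - 2 < σ * t ∧ σ * t < a') ∧
      (∀ t, a ≤ σ * t → σ * deriv η t = -b t) ∧
      ∀ t, a ≤ σ * t → (∀ s, σ * s ≤ σ * t → b s = 0) → η t = ∫ s, b s := by
  rcases hσ with rfl | rfl
  · simpa using exists_cutoff_forward hb hb0 (by simpa using hsupp)
  · obtain ⟨η, h1, h2, h3, h4, h5, h6⟩ := exists_cutoff_forward (b := fun t => b (-t))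
      (a := a) (a' := a') (hb.comp contDiff_neg) (fun t => hb0 _)
      (fun t ht => by simpa using hsupp (-t) ht)
    have hi : ∫ s, b (-s) = ∫ s, b s := integral_neg_eq_self b volume
    rw [hi] at h3 h6
    refine ⟨fun t => η (-t), h1.comp contDiff_neg, fun t => h2 _, fun t => h3 _, fun t ht => ?_,
      fun t ht => ?_, fun t ht hz => ?_⟩
    · simpa using h4 (-t) ht
    · rw [deriv_comp_neg, h5 (-t) (by simpa using ht)]
      simp
    · exact h6 (-t) (by simpa using ht) fun s hs => hz (-s) (by simpa using hs)

theorem integral_mul_le_sqrt {α : Type*} [MeasurableSpace α] {m : Measure α} {f g : α → ℝ}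
    (hf : MemLp f 2 m) (hg : MemLp g 2 m) :
    ∫ x, f x * g x ∂m ≤ √(∫ x, f x ^ 2 ∂m) * √(∫ x, g x ^ 2 ∂m) := by
  have h1 := real_inner_le_norm hf.toLp hg.toLp
  have hn : ∀ {f : α → ℝ} (hf : MemLp f 2 m), ‖hf.toLp‖ = √(∫ x, f x ^ 2 ∂m) := fun {f} hf => by
    rw [eq_comm, Real.sqrt_eq_iff_mul_self_eq (integral_nonneg fun _ => sq_nonneg _)
      (norm_nonneg _), ← real_inner_self_eq_norm_mul_norm, L2.inner_def]
    refine integral_congr_ae ?_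
    filter_upwards [hf.coeFn_toLp] with x hx
    rw [hx]
    simp [sq]
  rw [hn, hn] at h1
  refine le_trans (le_of_eq ?_) h1
  rw [L2.inner_def]
  refine integral_congr_ae ?_
  filter_upwards [hf.coeFn_toLp, hg.coeFn_toLp] with x h1 h2
  rw [h1, h2]
  simp [mul_comm]

/-- A weakly continuous, causal family that represents the energy solutions of
`σ ∂_t u - ω⁻¹ div_x(A ∇ₓ u) = φ ⊗ ψ`. -/
structure IsPropagator (ω : Rn n → ℝ) (σ : ℝ) (A : ℝ → Rn n → Matrix (Fin n) (Fin n) ℂ)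
    (S : ℝ → ℝ → (L2w ω →L[ℂ] L2w ω)) : Prop where
  represents : ∀ (φ : ℝ → ℂ) (ψ : L2w ω), IsTest φ → IsTestL2 ψ →
    ∀ (u : ℝ → L2w ω) (G : ℝ → L2wVec ω), IsEnergyClass u G → WeakSol σ A u G φ ψ →
      ∀ ψ' : L2w ω, IsTestL2 ψ' →
        ∀ᵐ t : ℝ, inner ℂ ψ' (u t) = ∫ s, φ s * inner ℂ ψ' (S t s ψ)
  causal : ∀ t s, σ * t < σ * s → S t s = 0
  bounded : ∃ C : ℝ, ∀ t s, ‖S t s‖ ≤ C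
  continuousOn_out : ∀ (s : ℝ) (ψ ψ' : L2w ω),
    ContinuousOn (fun t => inner ℂ ψ' (S t s ψ)) {t | σ * s ≤ σ * t}
  continuousOn_in : ∀ (t : ℝ) (ψ ψ' : L2w ω),
    ContinuousOn (fun s => inner ℂ ψ' (S t s ψ)) {s | σ * s ≤ σ * t}

variable [Fact (IsA2 ω)] {A : ℝ → Rn n → Matrix (Fin n) (Fin n) ℂ} {M ν : ℝ}
  {S : ℝ → ℝ → (L2w ω →L[ℂ] L2w ω)}

theorem isTest_zero {V : Type*} [NormedAddCommGroup V] [NormedSpace ℝ V] :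
    IsTest (0 : V → ℂ) := ⟨contDiff_const, HasCompactSupport.zero⟩

/-- With zero source the representation formula makes all pairings of u with test functions vanish
at almost every time. -/
theorem IsPropagator.energyUnique {σ : ℝ} (hS : IsPropagator ω σ A S) : EnergyUnique ω σ A := by
  intro u G hen hw
  refine ae_eq_zero_of_inner_test fun ψ' hψ' => ?_
  filter_upwards [hS.represents 0 0 isTest_zero ⟨0, isTest_zero, Lp.coeFn_zero _ _ _⟩ u G hen hw
    ψ' hψ'] with t ht
  simpa using ht

theorem IsCurve.inner_sourceVec_tensor {V : EnergySpace ω} {u : ℝ → L2w ω} {G : ℝ → L2wVec ω}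
    (hc : IsCurve V u G) {β : ℝ → ℂ} {χ : Rn n → ℂ} (hβ : IsTest β) (hχ : IsTest χ) {χ' : L2w ω}
    (hχ' : χ' =ᵐ[wMeasure ω] χ) :
    inner ℂ (sourceVec ω (tensor hβ hχ)) V = ∫ t, starRingEnd ℂ (β t) * inner ℂ χ' (u t) := by
  have hint : Integrable (fun p => starRingEnd ℂ ((tensor hβ hχ).1 p) *
      ((((rho p.1)⁻¹ : ℝ) : ℂ) * V.fst p)) (stMeasure ω) := by
    refine (integrable_inner_memLp (memLp_inv_rho_mul (tensor hβ hχ).2) (Lp.memLp V.fst)).congr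
      (ae_of_all _ fun p => ?_)
    simp only [RCLike.inner_apply, map_mul, Complex.conj_ofReal]
    ring
  rw [inner_sourceVec, integral_prod _ hint]
  refine integral_congr_ae ?_
  filter_upwards [hc.fst] with t ht
  rw [L2.inner_def, ← integral_const_mul]
  refine integral_congr_ae ?_
  filter_upwards [ht, hχ'] with x h1 h2
  rw [h1, h2]
  simp only [tensor, RCLike.inner_apply, map_mul]
  push_cast
  ring

end Propagators

/-! ### The weighted energy estimate for approximations of strong solutions. -/

section WeightedEnergy

variable {n : ℕ} {ω : Rn n → ℝ}

/-- A bounded smooth positive weight with `|∇E| ≤ δ E`. -/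
structure IsWeight (δ : ℝ) (E : Rn n → ℝ) : Prop where
  smooth : Smooth E
  pos : ∀ x, 0 < E x
  grad : ∀ x, ‖gradR E x‖ ≤ δ * E x
  bounded : ∃ B, ∀ x, E x ≤ B

/-- The rate of growth in time of the weighted energy. -/
def growthRate (M ν δ : ℝ) : ℝ := 2 * M ^ 2 * δ ^ 2 / ν

/-- The time factor absorbing the growth of the weighted energy. -/
def timeFactor (κ σ a' : ℝ) (t : ℝ) : ℝ := Real.exp (2 * κ * (a' - σ * t))

theorem smooth_timeFactor (κ σ a' : ℝ) : Smooth (timeFactor κ σ a') :=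
  Real.contDiff_exp.comp (by fun_prop)

theorem hasDerivAt_timeFactor (κ σ a' t : ℝ) :
    HasDerivAt (timeFactor κ σ a') (-(2 * κ * σ) * timeFactor κ σ a' t) t := by
  have h1 : HasDerivAt (fun t => 2 * κ * (a' - σ * t)) (2 * κ * -(σ * 1)) t :=
    (((hasDerivAt_id t).const_mul σ).const_sub a').const_mul _
  have h2 := h1.exp
  refine h2.congr_deriv ?_
  rw [timeFactor]
  ring

theorem hasCompactSupport_of_window {σ : ℝ} (hσ : σ = 1 ∨ σ = -1) {f : ℝ → ℝ} {l l' : ℝ}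
    (hf : ∀ t, f t ≠ 0 → l < σ * t ∧ σ * t < l') : HasCompactSupport f := by
  refine HasCompactSupport.intro (isCompact_Icc (a := -(|l| + |l'|)) (b := |l| + |l'|))
    fun t ht => ?_
  by_contra h0
  obtain ⟨h1, h2⟩ := hf t h0
  refine ht ?_
  have := neg_abs_le l; have := le_abs_self l'; have := le_abs_self l; have := neg_abs_le l'
  have := abs_nonneg l; have := abs_nonneg l'
  rcases hσ with rfl | rfl <;> constructor <;> linarith

variable [Fact (IsA2 ω)] {A : ℝ → Rn n → Matrix (Fin n) (Fin n) ℂ} {M ν : ℝ}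

/-- The weighted energy estimate for strong solutions. -/
theorem StrongSol.energy_estimate {hA : IsElliptic ω A M ν} {σ : ℝ} (hσ : σ = 1 ∨ σ = -1)
    {φ : ℝ → ℝ} {ψ : Rn n → ℂ} {hφ : IsTest fun t => (φ t : ℂ)} {hψ : IsTest ψ}
    {Φ : ℕ → testSpace n} {V : EnergySpace ω} {ε : ℕ → ℝ}
    (h : StrongSol hA σ (tensor hφ hψ) Φ V ε) {a a' : ℝ}
    (hV : ∀ᵐ p ∂(stMeasure ω), σ * p.1 < a → V.fst p = 0)
    {δ : ℝ} {E : Rn n → ℝ} (hE : IsWeight δ E) {η₀ β : ℝ → ℝ}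
    (hη₀ : Smooth η₀) (hη₀0 : ∀ t, 0 ≤ η₀ t) (hη₀2 : ∀ t, η₀ t ≤ 2)
    (hη₀s : ∀ t, η₀ t ≠ 0 → a - 2 < σ * t ∧ σ * t < a')
    (hβ : Continuous β) (hφβ : ∀ t, φ t ≤ β t) (hφ0 : ∀ t, 0 ≤ φ t)
    (hβs : ∀ t, β t ≠ 0 → a < σ * t ∧ σ * t < a') (hφ1 : ∫ t, φ t = 1)
    (hder : ∀ t, a ≤ σ * t → σ * deriv η₀ t = -β t) :
    ∃ o : ℕ → ℝ, Tendsto o atTop (𝓝 0) ∧ ∀ k,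
      1 / 4 * ∫ p, β p.1 * timeFactor (growthRate M ν δ) σ a' p.1 * E p.2 ^ 2 *
          ‖(Φ k).1 p‖ ^ 2 ∂(stMeasure ω) +
        ν / 2 * ∫ p, η₀ p.1 * timeFactor (growthRate M ν δ) σ a' p.1 * E p.2 ^ 2 *
          ‖dX (Φ k).1 p‖ ^ 2 ∂(stMeasure ω) ≤
      o k + 4 * Real.exp (2 * growthRate M ν δ * (a' - a + 2)) *
        ∫ x, E x ^ 2 * ‖ψ x‖ ^ 2 ∂(wMeasure ω) := by
  have hν := hA.ν_pos
  set κ := growthRate M ν δ with hκ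
  have hκ0 : 0 ≤ κ := by rw [hκ, growthRate]; positivity
  set e := timeFactor κ σ a' with he
  have hes : Smooth e := smooth_timeFactor _ _ _
  have he0 : ∀ t, 0 < e t := fun t => Real.exp_pos _
  have hec : Continuous e := hes.continuous
  have hσ2 : σ * σ = 1 := by rcases hσ with rfl | rfl <;> norm_num
  obtain ⟨B, hB⟩ := hE.bounded
  have hB0 : 0 < B := (hE.pos 0).trans_le (hB 0)
  have hEB : ∀ x, E x ^ 2 ≤ B ^ 2 := fun x => pow_le_pow_left₀ (hE.pos x).le (hB x) 2
  have hEc : Continuous E := hE.smooth.continuous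
  have hφc : Continuous φ := by
    have := Complex.continuous_re.comp hφ.1.continuous
    exact this
  have hη₀c := hη₀.continuous
  have hη₀cs : HasCompactSupport η₀ := hasCompactSupport_of_window hσ hη₀s
  have hβcs : HasCompactSupport β := hasCompactSupport_of_window hσ hβs
  -- the defect of `σ η₀' = -β`, which lives before time `a`
  set d : ℝ → ℝ := fun t => β t + σ * deriv η₀ t with hd
  have hη₀' : Continuous (deriv η₀) := hη₀.continuous_deriv (by simp)
  have hdc : Continuous d := by fun_prop
  have hdcs : HasCompactSupport d := hβcs.add hη₀cs.deriv.mul_left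
  have hd0 : ∀ t, a ≤ σ * t → d t = 0 := fun t ht => by
    rw [hd]; simp only; rw [hder t ht]; ring
  set η : ℝ → ℝ := fun t => η₀ t * e t with hη
  have hηs : Smooth η := hη₀.mul hes
  have hηc := hηs.continuous
  have hη0 : ∀ t, 0 ≤ η t := fun t => mul_nonneg (hη₀0 t) (he0 t).le
  have hηcs : HasCompactSupport η := hη₀cs.mul_right
  have hηd : ∀ t, deriv η t = deriv η₀ t * e t + η₀ t * (-(2 * κ * σ) * e t) := fun t =>
    ((hη₀.differentiable (by simp) t).hasDerivAt.mul (hasDerivAt_timeFactor κ σ a' t)).deriv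
  -- bounds for the multiplier
  have hρi : Continuous fun t => (rho t)⁻¹ := continuous_rho.inv₀ fun t => (rho_pos t).ne'
  obtain ⟨B₁, hB₁⟩ := hηcs.exists_bound_of_continuous hηc
  -- On the compact time supports ρ⁻¹ is harmless. B₂ makes multiplication by ηE² bounded in the
  -- energy norm despite the gradient of E; B₃ lets the defect term be controlled by the ρ-weighted
  -- norm.
  obtain ⟨B₂, hB₂⟩ := (hηcs.mul_right (f' := fun t => (rho t)⁻¹)).exists_bound_of_continuous
    (hηc.mul hρi)
  obtain ⟨B₃, hB₃⟩ := (hdcs.mul_right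
    (f' := fun t => e t * ((rho t)⁻¹) ^ 2)).exists_bound_of_continuous (hdc.mul (hec.mul (hρi.pow 2)))
  have hB₁0 : 0 ≤ B₁ := (norm_nonneg _).trans (hB₁ 0)
  have hB₂0 : 0 ≤ B₂ := (norm_nonneg _).trans (hB₂ 0)
  have hB₃0 : 0 ≤ B₃ := (norm_nonneg _).trans (hB₃ 0)
  set C := B₁ * B ^ 2 + 2 * |δ| * B₂ * B ^ 2 with hC
  have hC1 : ∀ t x, η t * E x ^ 2 ≤ C := fun t x => by
    have h1 : η t ≤ B₁ := (le_abs_self _).trans (hB₁ t)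
    have h2 : η t * E x ^ 2 ≤ B₁ * B ^ 2 := mul_le_mul h1 (hEB x) (sq_nonneg _) hB₁0
    have h3 : 0 ≤ 2 * |δ| * B₂ * B ^ 2 := by positivity
    linarith
  have hC2 : ∀ t x, 2 * δ * (η t * E x ^ 2) ≤ C * rho t := fun t x => by
    have hρ := rho_pos t
    have h1 : η t ≤ B₂ * rho t := by
      have := (le_abs_self _).trans (hB₂ t)
      simp only [Pi.mul_apply] at this
      rwa [← div_eq_mul_inv, div_le_iff₀ hρ] at this
    have h2 : η t * E x ^ 2 ≤ B₂ * rho t * B ^ 2 := mul_le_mul h1 (hEB x) (sq_nonneg _)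
      (by positivity)
    have h3 : 2 * δ * (η t * E x ^ 2) ≤ 2 * |δ| * (η t * E x ^ 2) := by
      have : 0 ≤ η t * E x ^ 2 := mul_nonneg (hη0 t) (sq_nonneg _)
      gcongr
      exact le_abs_self _
    calc 2 * δ * (η t * E x ^ 2) ≤ 2 * |δ| * (B₂ * rho t * B ^ 2) := by
          refine h3.trans ?_; gcongr
      _ ≤ C * rho t := by
          rw [hC]
          have : 0 ≤ B₁ * B ^ 2 * rho t := by positivity
          nlinarith
  -- Two errors vanish in the limit: the contribution of the defect d, which lives where V is zero,
  -- and the residual ε k of the equation paired with the multiplied test function.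
  refine ⟨fun k => 1 / 2 * (B₃ * B ^ 2 * ‖energyMap ω (Φ k) - V‖ ^ 2) +
    |ε k| * (2 * C * ‖energyMap ω (Φ k)‖), ?_, fun k => ?_⟩
  · have h1 := tendsto_iff_norm_sub_tendsto_zero.mp h.tendsto
    have h2 := ((h1.pow 2).const_mul (B₃ * B ^ 2)).const_mul (1 / 2)
    have h3 := h.tendsto_zero.abs.mul (h.tendsto.norm.const_mul (2 * C))
    simpa using h2.add h3
  set Ψ : testSpace n := ⟨weighted η E (Φ k).1, isTest_weighted hηs hE.smooth (Φ k).2⟩ with hΨ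
  have hΦc : Continuous (Φ k).1 := (Φ k).2.1.continuous
  have hdX := Smooth.continuous_dX (Φ k).2.1
  have hsupp : HasCompactSupport fun p => ‖(Φ k).1 p‖ ^ 2 :=
    (Φ k).2.2.comp_left (g := fun z : ℂ => ‖z‖ ^ 2) (by simp)
  have hsupp' : HasCompactSupport fun p => ‖dX (Φ k).1 p‖ ^ 2 :=
    (hasCompactSupport_dX (Φ k).2.2).comp_left (g := fun z : Cn n => ‖z‖ ^ 2) (by simp)
  have hiβ : Integrable (fun p : ℝ × Rn n => β p.1 * e p.1 * E p.2 ^ 2 * ‖(Φ k).1 p‖ ^ 2)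
      (stMeasure ω) :=
    Continuous.integrable_of_hasCompactSupport (by fun_prop) hsupp.mul_left
  have hiφ : Integrable (fun p : ℝ × Rn n => φ p.1 * e p.1 * E p.2 ^ 2 * ‖(Φ k).1 p‖ ^ 2)
      (stMeasure ω) :=
    Continuous.integrable_of_hasCompactSupport (by fun_prop) hsupp.mul_left
  have hid : Integrable (fun p : ℝ × Rn n => d p.1 * e p.1 * E p.2 ^ 2 * ‖(Φ k).1 p‖ ^ 2)
      (stMeasure ω) :=
    Continuous.integrable_of_hasCompactSupport (by fun_prop) hsupp.mul_left
  have hiη : Integrable (fun p : ℝ × Rn n => η₀ p.1 * e p.1 * E p.2 ^ 2 * ‖dX (Φ k).1 p‖ ^ 2)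
      (stMeasure ω) :=
    Continuous.integrable_of_hasCompactSupport (by fun_prop) hsupp'.mul_left
  have hψc := hψ.1.continuous
  have hψi : Integrable (fun x => E x ^ 2 * ‖ψ x‖ ^ 2) (wMeasure ω) :=
    Continuous.integrable_of_hasCompactSupport (by fun_prop)
      (hψ.2.comp_left (g := fun z : ℂ => ‖z‖ ^ 2) (by simp)).mul_left
  have hφcs : HasCompactSupport φ := hφ.2.comp_left (g := Complex.re) (by simp)
  have hφi : Integrable φ := hφc.integrable_of_hasCompactSupport hφcs
  have hφei : Integrable fun t => φ t * e t :=
    (hφc.mul hec).integrable_of_hasCompactSupport hφcs.mul_right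
  have hiψ : Integrable (fun p : ℝ × Rn n => φ p.1 * e p.1 * (E p.2 ^ 2 * ‖ψ p.2‖ ^ 2))
      (stMeasure ω) := hφei.mul_prod hψi
  -- the energy inequality
  have hen := energy_le hA σ (Φ k) hηs hE.smooth hη0 hE.pos hE.grad
  have hlhs : ∫ p, (-(σ / 2) * deriv η p.1 * E p.2 ^ 2 * ‖(Φ k).1 p‖ ^ 2 -
        2 * M ^ 2 * δ ^ 2 / ν * (η p.1 * E p.2 ^ 2 * ‖(Φ k).1 p‖ ^ 2) +
        ν / 2 * (η p.1 * E p.2 ^ 2 * ‖dX (Φ k).1 p‖ ^ 2)) ∂(stMeasure ω) =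
      1 / 2 * (∫ p, β p.1 * e p.1 * E p.2 ^ 2 * ‖(Φ k).1 p‖ ^ 2 ∂(stMeasure ω)) -
      1 / 2 * (∫ p, d p.1 * e p.1 * E p.2 ^ 2 * ‖(Φ k).1 p‖ ^ 2 ∂(stMeasure ω)) +
      ν / 2 * (∫ p, η₀ p.1 * e p.1 * E p.2 ^ 2 * ‖dX (Φ k).1 p‖ ^ 2 ∂(stMeasure ω)) := by
    rw [← integral_const_mul, ← integral_const_mul, ← integral_const_mul,
      ← integral_sub (hiβ.const_mul _) (hid.const_mul _),
      ← integral_add (by exact (hiβ.const_mul _).sub (hid.const_mul _)) (hiη.const_mul _)]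
    refine integral_congr_ae (ae_of_all _ fun p => ?_)
    -- As σ² = 1, differentiating the factor e produces exactly κ η E² |Φ|², which cancels the
    -- growth term of the energy inequality; what is left of the time derivative is (β - d)e/2.
    have hk : 2 * M ^ 2 * δ ^ 2 / ν = κ := rfl
    simp only [hηd]
    simp only [hk, hη, hd]
    linear_combination κ * η₀ p.1 * e p.1 * E p.2 ^ 2 * ‖(Φ k).1 p‖ ^ 2 * hσ2
  rw [hlhs] at hen
  -- the source term
  have hΨmem := energyMap_mem (ω := ω) Ψ
  have hbd := h.bound k _ hΨmem
  have hnorm : ‖energyMap ω Ψ‖ ≤ 2 * C * ‖energyMap ω (Φ k)‖ :=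
    norm_energyMap_weighted_le (Φ k) hηs hE.smooth hη0 hE.pos hE.grad hC1 hC2
  have hre : (inner ℂ (operatorMap hA σ (Φ k)) (energyMap ω Ψ)).re ≤
      |ε k| * (2 * C * ‖energyMap ω (Φ k)‖) +
        (inner ℂ (sourceVec ω (tensor hφ hψ)) (energyMap ω Ψ)).re := by
    have h1 := (Complex.re_le_norm _).trans hbd
    have h2 : ε k * ‖energyMap ω Ψ‖ ≤ |ε k| * (2 * C * ‖energyMap ω (Φ k)‖) :=
      mul_le_mul (le_abs_self _) hnorm (norm_nonneg _) (abs_nonneg _)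
    rw [Complex.sub_re] at h1
    linarith
  have hΨc : Continuous Ψ.1 := Ψ.2.1.continuous
  have hsrc : (inner ℂ (sourceVec ω (tensor hφ hψ)) (energyMap ω Ψ)).re ≤
      1 / 4 * (∫ p, φ p.1 * e p.1 * E p.2 ^ 2 * ‖(Φ k).1 p‖ ^ 2 ∂(stMeasure ω)) +
      4 * (∫ p, φ p.1 * e p.1 * (E p.2 ^ 2 * ‖ψ p.2‖ ^ 2) ∂(stMeasure ω)) := by
    rw [inner_sourceVec_energyMap, ← integral_const_mul, ← integral_const_mul,
      ← integral_add (hiφ.const_mul _) (hiψ.const_mul _)]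
    have hint : Integrable (fun p => starRingEnd ℂ ((tensor hφ hψ).1 p) * Ψ.1 p)
        (stMeasure ω) :=
      ((Complex.continuous_conj.comp (tensor hφ hψ).2.1.continuous).mul
        hΨc).integrable_of_hasCompactSupport Ψ.2.2.mul_left
    refine (Complex.re_le_norm _).trans ((norm_integral_le_integral_norm _).trans
      (integral_mono hint.norm ((hiφ.const_mul _).add (hiψ.const_mul _)) fun p => ?_))
    have hval : ‖starRingEnd ℂ ((tensor hφ hψ).1 p) * Ψ.1 p‖ =
        φ p.1 * e p.1 * E p.2 ^ 2 * (η₀ p.1 * (‖ψ p.2‖ * ‖(Φ k).1 p‖)) := by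
      have h1 : ‖Ψ.1 p‖ = η p.1 * E p.2 ^ 2 * ‖(Φ k).1 p‖ := by
        simp only [hΨ, weighted]
        rw [norm_mul, Complex.norm_real,
          Real.norm_of_nonneg (mul_nonneg (hη0 _) (sq_nonneg _))]
      have h2 : ‖(tensor hφ hψ).1 p‖ = φ p.1 * ‖ψ p.2‖ := by
        simp only [tensor]
        rw [norm_mul, Complex.norm_real, Real.norm_of_nonneg (hφ0 _)]
      rw [norm_mul, RCLike.norm_conj, h1, h2, hη]
      ring
    simp only [hval]
    -- Since η₀ ≤ 2, the product is split as 2xy ≤ x²/4 + 4y². The quarter is absorbed by the term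
    -- β/2, as φ ≤ β, and leaves the factor 1/4 of the conclusion.
    have h3 : η₀ p.1 * (‖ψ p.2‖ * ‖(Φ k).1 p‖) ≤ 1 / 4 * ‖(Φ k).1 p‖ ^ 2 + 4 * ‖ψ p.2‖ ^ 2 := by
      have h4 : η₀ p.1 * (‖ψ p.2‖ * ‖(Φ k).1 p‖) ≤ 2 * (‖ψ p.2‖ * ‖(Φ k).1 p‖) :=
        mul_le_mul_of_nonneg_right (hη₀2 _) (by positivity)
      nlinarith [sq_nonneg (1 / 2 * ‖(Φ k).1 p‖ - 2 * ‖ψ p.2‖)]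
    have h5 : 0 ≤ φ p.1 * e p.1 * E p.2 ^ 2 :=
      mul_nonneg (mul_nonneg (hφ0 _) (he0 _).le) (sq_nonneg _)
    have h6 := mul_le_mul_of_nonneg_left h3 h5
    refine h6.trans (le_of_eq ?_)
    ring
  have hmono : ∫ p, φ p.1 * e p.1 * E p.2 ^ 2 * ‖(Φ k).1 p‖ ^ 2 ∂(stMeasure ω) ≤
      ∫ p, β p.1 * e p.1 * E p.2 ^ 2 * ‖(Φ k).1 p‖ ^ 2 ∂(stMeasure ω) := by
    refine integral_mono hiφ hiβ fun p => ?_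
    have := (he0 p.1).le
    have := hφβ p.1
    simp only
    gcongr
  have hψE : ∫ p, φ p.1 * e p.1 * (E p.2 ^ 2 * ‖ψ p.2‖ ^ 2) ∂(stMeasure ω) ≤
      Real.exp (2 * κ * (a' - a + 2)) * ∫ x, E x ^ 2 * ‖ψ x‖ ^ 2 ∂(wMeasure ω) := by
    rw [stMeasure, integral_prod_mul (fun t => φ t * e t) fun x => E x ^ 2 * ‖ψ x‖ ^ 2]
    refine mul_le_mul_of_nonneg_right ?_ (integral_nonneg fun x => by positivity)
    calc ∫ t, φ t * e t ≤ ∫ t, φ t * Real.exp (2 * κ * (a' - a + 2)) := by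
          refine integral_mono hφei (hφi.mul_const _) fun t => ?_
          by_cases h0 : φ t = 0
          · simp [h0]
          have hβ0 : β t ≠ 0 := fun h1 =>
            h0 (le_antisymm ((hφβ t).trans h1.le) (hφ0 t))
          refine mul_le_mul_of_nonneg_left (Real.exp_le_exp.mpr ?_) (hφ0 t)
          exact mul_le_mul_of_nonneg_left (by linarith [(hβs t hβ0).1]) (by positivity)
      _ = _ := by rw [integral_mul_const, hφ1, one_mul]
  -- After time a the defect is zero. Before it V vanishes, so ρ|Φ k| is the first component of the
  -- difference from V and is small in L².
  have hdE : ∫ p, d p.1 * e p.1 * E p.2 ^ 2 * ‖(Φ k).1 p‖ ^ 2 ∂(stMeasure ω) ≤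
      B₃ * B ^ 2 * ‖energyMap ω (Φ k) - V‖ ^ 2 := by
    have hW := Lp.memLp (energyMap ω (Φ k) - V).fst
    have hWi := (memLp_two_iff_integrable_sq_norm hW.1).mp hW
    have hWn : ∫ p, ‖(energyMap ω (Φ k) - V).fst p‖ ^ 2 ∂(stMeasure ω) ≤
        ‖energyMap ω (Φ k) - V‖ ^ 2 := by
      rw [← norm_toLp_sq hW, Lp.toLp_coeFn, WithLp.prod_norm_sq_eq_of_L2]
      exact le_add_of_nonneg_right (sq_nonneg _)
    refine le_trans ?_ (mul_le_mul_of_nonneg_left hWn (by positivity))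
    rw [← integral_const_mul]
    refine integral_mono_ae hid (hWi.const_mul _) ?_
    filter_upwards [hV, energyMap_fst (ω := ω) (Φ k),
      Lp.coeFn_sub (energyMap ω (Φ k)).fst V.fst] with p h1 h2 h3
    by_cases hp : σ * p.1 < a
    · have hρ := rho_pos p.1
      have h4 : ‖(energyMap ω (Φ k) - V).fst p‖ = rho p.1 * ‖(Φ k).1 p‖ := by
        rw [WithLp.sub_fst, h3, Pi.sub_apply, h1 hp, sub_zero, h2, norm_mul, Complex.norm_real,
          Real.norm_of_nonneg hρ.le]
      rw [h4]
      have h5 : d p.1 * e p.1 ≤ B₃ * rho p.1 ^ 2 := by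
        have := (le_abs_self _).trans (hB₃ p.1)
        simp only [Pi.mul_apply] at this
        rwa [inv_pow, ← mul_assoc, ← div_eq_mul_inv, div_le_iff₀ (by positivity)] at this
      calc d p.1 * e p.1 * E p.2 ^ 2 * ‖(Φ k).1 p‖ ^ 2
          ≤ B₃ * rho p.1 ^ 2 * E p.2 ^ 2 * ‖(Φ k).1 p‖ ^ 2 := by gcongr
        _ ≤ B₃ * rho p.1 ^ 2 * B ^ 2 * ‖(Φ k).1 p‖ ^ 2 := by gcongr; exacts [(hE.pos _).le, hB _]
        _ = _ := by ring
    · rw [hd0 _ (not_lt.mp hp)]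
      have : 0 ≤ B₃ * B ^ 2 * ‖(energyMap ω (Φ k) - V).fst p‖ ^ 2 := by positivity
      simpa using this
  linarith

end WeightedEnergy

/-! ### Weighted bounds and approximate mass balance, averaged in time. -/

section AveragedEstimates

variable {n : ℕ} {ω : Rn n → ℝ}

theorem dT_tensor {φ : ℝ → ℂ} {ψ : Rn n → ℂ} (hφ : IsTest φ) (hψ : IsTest ψ) (p : ℝ × Rn n) :
    dT (tensor hφ hψ).1 p = deriv φ p.1 * ψ p.2 := by
  have h1 := hasDerivAt_time (t := p.1) (x := p.2)
    ((tensor hφ hψ).2.1.differentiable (by simp) p)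
  exact h1.unique ((hφ.1.differentiable (by simp) p.1).hasDerivAt.mul_const (ψ p.2))

theorem dX_tensor {φ : ℝ → ℂ} {ψ : Rn n → ℂ} (hφ : IsTest φ) (hψ : IsTest ψ) (p : ℝ × Rn n) :
    dX (tensor hφ hψ).1 p = φ p.1 • WithLp.toLp 2 (gradX ψ p.2) := by
  ext i
  rw [dX_apply ((tensor hφ hψ).2.1.differentiable (by simp) p)]
  have h1 := ((hψ.1.differentiable (by simp) p.2).hasFDerivAt.const_mul (φ p.1)).fderiv
  have h2 : (fun y => (tensor hφ hψ).1 (p.1, y)) = fun y => φ p.1 * ψ y := rfl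
  rw [h2, h1]
  simp [gradX, partialX]

theorem continuous_gradX {ψ : Rn n → ℂ} (hψ : IsTest ψ) :
    Continuous fun x => (WithLp.toLp 2 (gradX ψ x) : Cn n) := by
  have := hψ.1.continuous_fderiv (by simp)
  refine (PiLp.continuous_toLp 2 _).comp (continuous_pi fun i => ?_)
  exact this.clm_apply continuous_const

theorem hasCompactSupport_gradX {ψ : Rn n → ℂ} (hψ : IsTest ψ) :
    HasCompactSupport fun x => (WithLp.toLp 2 (gradX ψ x) : Cn n) := by
  refine (hψ.2.fderiv (𝕜 := ℝ)).mono' fun x hx => subset_closure fun h0 => hx ?_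
  ext i
  simp [gradX, partialX, h0]

theorem isTest_ofReal {V : Type*} [NormedAddCommGroup V] [NormedSpace ℝ V] {f : V → ℝ}
    (hf : Smooth f) (hs : HasCompactSupport f) : IsTest fun x => (f x : ℂ) :=
  ⟨Complex.ofRealCLM.contDiff.comp hf, hs.comp_left (g := fun r : ℝ => (r : ℂ)) rfl⟩

theorem integral_le_of_window {σ : ℝ} (hσ : σ = 1 ∨ σ = -1) {f : ℝ → ℝ} {l l' : ℝ}
    (hf0 : ∀ t, 0 ≤ f t) (hf1 : ∀ t, f t ≤ 1)
    (hf : ∀ t, f t ≠ 0 → l < σ * t ∧ σ * t < l') (hl : l ≤ l') : ∫ t, f t ≤ l' - l := by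
  have key : ∀ r r' : ℝ, r' - r = l' - l → (∀ t, f t ≠ 0 → r < t ∧ t < r') →
      ∫ t, f t ≤ l' - l := fun r r' hr hs => by
    rw [← setIntegral_eq_integral_of_forall_compl_eq_zero (s := Ioo r r') fun t ht => by
      by_contra h0
      exact ht (hs t h0)]
    have h1 := norm_setIntegral_le_of_norm_le_const (μ := volume) (s := Ioo r r') (f := f) (C := 1)
      (by simp) (fun t _ => by rw [Real.norm_of_nonneg (hf0 t)]; exact hf1 t)
    rw [one_mul, measureReal_def, Real.volume_Ioo, ENNReal.toReal_ofReal (by linarith), hr] at h1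
    exact (Real.le_norm_self _).trans h1
  rcases hσ with rfl | rfl
  · exact key l l' rfl fun t ht => by simpa using hf t ht
  · exact key (-l') (-l) (by ring) fun t ht => by
      have := hf t ht
      constructor <;> linarith [this.1, this.2]

theorem one_le_timeFactor {κ σ a' t : ℝ} (hκ : 0 ≤ κ) (ht : σ * t ≤ a') :
    1 ≤ timeFactor κ σ a' t :=
  Real.one_le_exp (mul_nonneg (by positivity) (by linarith))

/-- A smooth probability density supported in `{l < σ t < l'}`. -/
structure IsBump (σ l l' : ℝ) (b : ℝ → ℝ) : Prop where
  smooth : Smooth b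
  nonneg : ∀ t, 0 ≤ b t
  supp : ∀ t, b t ≠ 0 → l < σ * t ∧ σ * t < l'
  integral : ∫ t, b t = 1

theorem IsBump.isTest {σ l l' : ℝ} (hσ : σ = 1 ∨ σ = -1) {b : ℝ → ℝ} (hb : IsBump σ l l' b) :
    IsTest fun t => (b t : ℂ) :=
  isTest_ofReal hb.smooth (hasCompactSupport_of_window hσ hb.supp)

variable [Fact (IsA2 ω)] {A : ℝ → Rn n → Matrix (Fin n) (Fin n) ℂ} {M ν : ℝ}
  {S : ℝ → ℝ → (L2w ω →L[ℂ] L2w ω)}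

/-- Weighted bounds for the approximations of a strong solution with source `φ ⊗ ψ`. -/
theorem StrongSol.exists_weighted_bounds {hA : IsElliptic ω A M ν} {σ : ℝ} (hσ : σ = 1 ∨ σ = -1)
    {φ : ℝ → ℝ} {ψ : Rn n → ℂ} {hφ : IsTest fun t => (φ t : ℂ)} {hψ : IsTest ψ}
    {Φ : ℕ → testSpace n} {V : EnergySpace ω} {ε : ℕ → ℝ}
    (h : StrongSol hA σ (tensor hφ hψ) Φ V ε) {a a' : ℝ}
    (hV : ∀ᵐ p ∂(stMeasure ω), σ * p.1 < a → V.fst p = 0)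
    {δ : ℝ} {E : Rn n → ℝ} (hE : IsWeight δ E) (hφb : IsBump σ a a' φ)
    {b η : ℝ → ℝ} (hb : IsBump σ a a' b) (hη : Smooth η) (hη0 : ∀ t, 0 ≤ η t)
    (hη1 : ∀ t, η t ≤ 1) (hηs : ∀ t, η t ≠ 0 → a - 2 < σ * t ∧ σ * t < a')
    (hηd : ∀ t, a ≤ σ * t → σ * deriv η t = -b t) :
    ∃ o : ℕ → ℝ, Tendsto o atTop (𝓝 (4 * Real.exp (2 * growthRate M ν δ * (a' - a + 2)) *
        ∫ x, E x ^ 2 * ‖ψ x‖ ^ 2 ∂(wMeasure ω))) ∧ ∀ k,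
      ∫ p, b p.1 * (E p.2 ^ 2 * ‖(Φ k).1 p‖ ^ 2) ∂(stMeasure ω) ≤ 4 * o k ∧
      ∫ p, η p.1 * (E p.2 ^ 2 * ‖dX (Φ k).1 p‖ ^ 2) ∂(stMeasure ω) ≤ 2 / ν * o k := by
  have hν := hA.ν_pos
  obtain ⟨ηφ, hs, h0, h1, hsu, hd, -⟩ := exists_cutoff hσ hφb.smooth hφb.nonneg hφb.supp
  rw [hφb.integral] at h1
  have hdiff : ∀ {f : ℝ → ℝ}, Smooth f → ∀ t, DifferentiableAt ℝ f t := fun hf t =>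
    hf.differentiable (by simp) t
  -- The estimate needs β ≥ φ to absorb the source, whereas the wanted bound concerns b. Adding the
  -- cutoffs of both densities serves both purposes and accounts for the bound 2 on η₀.
  obtain ⟨o, ho, hle⟩ := h.energy_estimate hσ hV hE (η₀ := fun t => η t + ηφ t)
    (β := fun t => b t + φ t) (hη.add hs) (fun t => add_nonneg (hη0 t) (h0 t))
    (fun t => by linarith [hη1 t, h1 t])
    (fun t ht => by
      by_cases h2 : η t = 0
      · exact hsu t fun h3 => ht (by simp [h2, h3])
      · exact hηs t h2)
    (hb.smooth.continuous.add hφb.smooth.continuous) (fun t => by linarith [hb.nonneg t])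
    hφb.nonneg
    (fun t ht => by
      by_cases h2 : b t = 0
      · exact hφb.supp t fun h3 => ht (by simp [h2, h3])
      · exact hb.supp t h2) hφb.integral
    (fun t ht => by
      rw [show (fun t => η t + ηφ t) = η + ηφ from rfl, deriv_add (hdiff hη t) (hdiff hs t),
        mul_add, hηd t ht, hd t ht]
      ring)
  refine ⟨fun k => o k + 4 * Real.exp (2 * growthRate M ν δ * (a' - a + 2)) *
        ∫ x, E x ^ 2 * ‖ψ x‖ ^ 2 ∂(wMeasure ω), by simpa using ho.add_const _, fun k => ?_⟩
  have hk := hle k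
  set κ := growthRate M ν δ with hκ
  have hκ0 : 0 ≤ κ := by rw [hκ, growthRate]; positivity
  have hΦc : Continuous (Φ k).1 := (Φ k).2.1.continuous
  have hdX := Smooth.continuous_dX (Φ k).2.1
  have hsupp : HasCompactSupport fun p => ‖(Φ k).1 p‖ ^ 2 :=
    (Φ k).2.2.comp_left (g := fun z : ℂ => ‖z‖ ^ 2) (by simp)
  have hsupp' : HasCompactSupport fun p => ‖dX (Φ k).1 p‖ ^ 2 :=
    (hasCompactSupport_dX (Φ k).2.2).comp_left (g := fun z : Cn n => ‖z‖ ^ 2) (by simp)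
  have hbc := hb.smooth.continuous
  have hφc := hφb.smooth.continuous
  have hηc := hη.continuous
  have hηφc := hs.continuous
  have hec := (smooth_timeFactor κ σ a').continuous
  have hEc := hE.smooth.continuous
  have e0 : ∀ t, 0 < timeFactor κ σ a' t := fun t => Real.exp_pos _
  have key : ∀ {f g : ℝ → ℝ}, (∀ t, 0 ≤ f t) → (∀ t, 0 ≤ g t) → (∀ t, f t ≠ 0 → σ * t < a') →
      ∀ t, f t ≤ (f t + g t) * timeFactor κ σ a' t := fun {f g} hf hg hfs t => by
    have h3 : f t ≤ f t * timeFactor κ σ a' t := by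
      by_cases h2 : f t = 0
      · simp [h2]
      · exact le_mul_of_one_le_right (hf t) (one_le_timeFactor hκ0 (hfs t h2).le)
    have := mul_nonneg (hg t) (e0 t).le
    linarith
  have i1 : ∫ p, b p.1 * (E p.2 ^ 2 * ‖(Φ k).1 p‖ ^ 2) ∂(stMeasure ω) ≤
      ∫ p, (b p.1 + φ p.1) * timeFactor κ σ a' p.1 * E p.2 ^ 2 * ‖(Φ k).1 p‖ ^ 2
        ∂(stMeasure ω) := by
    refine integral_mono
      (Continuous.integrable_of_hasCompactSupport (by fun_prop) hsupp.mul_left.mul_left)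
      (Continuous.integrable_of_hasCompactSupport (by fun_prop) hsupp.mul_left) fun p => ?_
    simp only [mul_assoc]
    rw [← mul_assoc (b p.1 + φ p.1)]
    gcongr
    exact key hb.nonneg hφb.nonneg (fun t ht => (hb.supp t ht).2) p.1
  have i2 : ∫ p, η p.1 * (E p.2 ^ 2 * ‖dX (Φ k).1 p‖ ^ 2) ∂(stMeasure ω) ≤
      ∫ p, (η p.1 + ηφ p.1) * timeFactor κ σ a' p.1 * E p.2 ^ 2 * ‖dX (Φ k).1 p‖ ^ 2
        ∂(stMeasure ω) := by
    refine integral_mono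
      (Continuous.integrable_of_hasCompactSupport (by fun_prop) hsupp'.mul_left.mul_left)
      (Continuous.integrable_of_hasCompactSupport (by fun_prop) hsupp'.mul_left) fun p => ?_
    simp only [mul_assoc]
    rw [← mul_assoc (η p.1 + ηφ p.1)]
    gcongr
    exact key hη0 h0 (fun t ht => (hηs t ht).2) p.1
  have j1 : 0 ≤ ∫ p, b p.1 * (E p.2 ^ 2 * ‖(Φ k).1 p‖ ^ 2) ∂(stMeasure ω) :=
    integral_nonneg fun p => mul_nonneg (hb.nonneg _) (by positivity)
  have j2 : 0 ≤ ∫ p, η p.1 * (E p.2 ^ 2 * ‖dX (Φ k).1 p‖ ^ 2) ∂(stMeasure ω) :=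
    integral_nonneg fun p => mul_nonneg (hη0 _) (by positivity)
  have i3 := mul_le_mul_of_nonneg_left i2 (show 0 ≤ ν / 2 by positivity)
  have i4 := mul_nonneg (show 0 ≤ ν / 2 by positivity) j2
  constructor
  · linarith
  · rw [div_mul_eq_mul_div, le_div_iff₀ hν]
    linarith

/-- Cauchy–Schwarz with √η given to each factor; compact supports supply the square integrability.
-/
theorem norm_integral_le_sqrt {η : ℝ → ℝ} (hη0 : ∀ t, 0 ≤ η t) (hη : Continuous η)
    {f g : ℝ × Rn n → ℝ} (hf : Continuous f) (hg : Continuous g)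
    (hηf : HasCompactSupport fun p : ℝ × Rn n => η p.1 * f p)
    (hgs : HasCompactSupport g) {H : ℝ × Rn n → ℂ}
    (hH : ∀ p, ‖H p‖ ≤ η p.1 * (f p * g p)) :
    ‖∫ p, H p ∂(stMeasure ω)‖ ≤ √(∫ p, η p.1 * f p ^ 2 ∂(stMeasure ω)) *
      √(∫ p, η p.1 * g p ^ 2 ∂(stMeasure ω)) := by
  have hsq : Continuous fun p : ℝ × Rn n => √(η p.1) := by fun_prop
  have hsf : HasCompactSupport fun p : ℝ × Rn n => √(η p.1) * f p := by
    refine hηf.mono fun p hp => ?_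
    simp only [Function.mem_support, ne_eq, mul_eq_zero, not_or] at hp ⊢
    exact ⟨fun h0 => hp.1 (by simp [h0]), hp.2⟩
  have m1 : MemLp (fun p : ℝ × Rn n => √(η p.1) * f p) 2 (stMeasure ω) :=
    (hsq.mul hf).memLp_of_hasCompactSupport hsf
  have m2 : MemLp (fun p : ℝ × Rn n => √(η p.1) * g p) 2 (stMeasure ω) :=
    (hsq.mul hg).memLp_of_hasCompactSupport hgs.mul_left
  have hs : ∀ t, √(η t) ^ 2 = η t := fun t => Real.sq_sqrt (hη0 t)
  have h1 := integral_mul_le_sqrt m1 m2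
  simp only [mul_pow, hs] at h1
  refine le_trans ((norm_integral_le_integral_norm _).trans ?_) h1
  have hint : Integrable (fun p : ℝ × Rn n => η p.1 * (f p * g p)) (stMeasure ω) :=
    Continuous.integrable_of_hasCompactSupport (by fun_prop) hgs.mul_left.mul_left
  refine (integral_mono_of_nonneg (ae_of_all _ fun p => norm_nonneg _) hint
    (ae_of_all _ hH)).trans (le_of_eq (integral_congr_ae (ae_of_all _ fun p => ?_)))
  simp only
  linear_combination (-(f p * g p)) * hs p.1

/-- Weighted bounds for a strong solution with source `φ ⊗ ψ`, averaged in time. -/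
theorem StrongSol.norm_inner_sourceVec_le {hA : IsElliptic ω A M ν} {σ : ℝ}
    (hσ : σ = 1 ∨ σ = -1)
    {φ : ℝ → ℝ} {ψ : Rn n → ℂ} {hφ : IsTest fun t => (φ t : ℂ)} {hψ : IsTest ψ}
    {Φ : ℕ → testSpace n} {V : EnergySpace ω} {ε : ℕ → ℝ}
    (h : StrongSol hA σ (tensor hφ hψ) Φ V ε) {a a' : ℝ}
    (hV : ∀ᵐ p ∂(stMeasure ω), σ * p.1 < a → V.fst p = 0)
    {δ : ℝ} {E : Rn n → ℝ} (hE : IsWeight δ E) (hφb : IsBump σ a a' φ)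
    {b : ℝ → ℝ} (hb : IsBump σ a a' b) (hb' : IsTest fun t => (b t : ℂ)) {χ : Rn n → ℂ}
    (hχ : IsTest χ) (hEχ : IsTest fun x => (E x : ℂ) * χ x) :
    ‖inner ℂ (sourceVec ω (tensor hb' hEχ)) V‖ ≤
      √(∫ x, ‖χ x‖ ^ 2 ∂(wMeasure ω)) *
      √(4 * (4 * Real.exp (2 * growthRate M ν δ * (a' - a + 2)) *
        ∫ x, E x ^ 2 * ‖ψ x‖ ^ 2 ∂(wMeasure ω))) := by
  obtain ⟨η, hs, h0, h1, hsu, hd, -⟩ := exists_cutoff hσ hb.smooth hb.nonneg hb.supp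
  rw [hb.integral] at h1
  obtain ⟨o, ho, hle⟩ := h.exists_weighted_bounds hσ hV hE hφb hb hs h0 h1 hsu hd
  have hlim : Tendsto (fun k => ‖inner ℂ (sourceVec ω (tensor hb' hEχ)) (energyMap ω (Φ k))‖)
      atTop (𝓝 ‖inner ℂ (sourceVec ω (tensor hb' hEχ)) V‖) :=
    (tendsto_const_nhds.inner h.tendsto).norm
  refine le_of_tendsto_of_tendsto' hlim
    (((Real.continuous_sqrt.tendsto _).comp (ho.const_mul 4)).const_mul _) fun k => ?_
  have hbc := hb.smooth.continuous
  have hχc := hχ.1.continuous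
  have hEc := hE.smooth.continuous
  have hΦc : Continuous (Φ k).1 := (Φ k).2.1.continuous
  rw [inner_sourceVec_energyMap]
  refine (norm_integral_le_sqrt hb.nonneg hbc (f := fun p => ‖χ p.2‖)
    (g := fun p => E p.2 * ‖(Φ k).1 p‖) (by fun_prop) (by fun_prop) ?_
    ((Φ k).2.2.norm.mul_left) fun p => ?_).trans ?_
  · refine (tensor hb' hχ).2.2.mono fun p hp => ?_
    simp only [Function.mem_support, ne_eq, mul_eq_zero, not_or, norm_eq_zero, tensor,
      Complex.ofReal_eq_zero] at hp ⊢
    exact hp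
  · simp only [tensor, map_mul, Complex.conj_ofReal, norm_mul, Complex.norm_real, RCLike.norm_conj,
      Real.norm_of_nonneg (hb.nonneg _), Real.norm_of_nonneg (hE.pos _).le]
    refine le_of_eq ?_
    ring
  · refine mul_le_mul (Real.sqrt_le_sqrt (le_of_eq ?_)) (Real.sqrt_le_sqrt ?_)
      (Real.sqrt_nonneg _) (Real.sqrt_nonneg _)
    · rw [stMeasure, integral_prod_mul b fun x => ‖χ x‖ ^ 2, hb.integral, one_mul]
    · simp only [mul_pow]
      exact (hle k).1

/-- The equation for a strong solution with source `φ ⊗ ψ`, averaged in time, tests `χ` up to an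
error that is controlled by `∇χ`. -/
theorem StrongSol.norm_inner_sourceVec_sub_le {hA : IsElliptic ω A M ν} {σ : ℝ}
    (hσ : σ = 1 ∨ σ = -1)
    {φ : ℝ → ℝ} {ψ : Rn n → ℂ} {hφ : IsTest fun t => (φ t : ℂ)} {hψ : IsTest ψ}
    {Φ : ℕ → testSpace n} {V : EnergySpace ω} {ε : ℕ → ℝ}
    (h : StrongSol hA σ (tensor hφ hψ) Φ V ε) {a c a' : ℝ}
    (hV : ∀ᵐ p ∂(stMeasure ω), σ * p.1 < a → V.fst p = 0) (hac : a ≤ c) (hca : c ≤ a')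
    {δ : ℝ} {E : Rn n → ℝ} (hE : IsWeight δ E) (hφb : IsBump σ a c φ)
    {b : ℝ → ℝ} (hb : IsBump σ c a' b) (hb' : IsTest fun t => (b t : ℂ)) {χ : Rn n → ℂ}
    (hχ : IsTest χ) :
    ‖inner ℂ (sourceVec ω (tensor hb' hχ)) V - ∫ x, starRingEnd ℂ (χ x) * ψ x ∂(wMeasure ω)‖ ≤
      M * (√((a' - a + 2) * ∫ x, (E x)⁻¹ ^ 2 * ‖(WithLp.toLp 2 (gradX χ x) : Cn n)‖ ^ 2
        ∂(wMeasure ω)) *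
      √(2 / ν * (4 * Real.exp (2 * growthRate M ν δ * (a' - a + 2)) *
        ∫ x, E x ^ 2 * ‖ψ x‖ ^ 2 ∂(wMeasure ω)))) := by
  have hM := hA.M_pos
  have hbw : IsBump σ a a' b :=
    ⟨hb.smooth, hb.nonneg, fun t ht => ⟨hac.trans_lt (hb.supp t ht).1, (hb.supp t ht).2⟩,
      hb.integral⟩
  have hφw : IsBump σ a a' φ :=
    ⟨hφb.smooth, hφb.nonneg, fun t ht => ⟨(hφb.supp t ht).1, (hφb.supp t ht).2.trans_le hca⟩,
      hφb.integral⟩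
  obtain ⟨η, hs, h0, h1, hsu, hd, hone⟩ := exists_cutoff hσ hbw.smooth hbw.nonneg hbw.supp
  rw [hb.integral] at h1 hone
  obtain ⟨o, ho, hle⟩ := h.exists_weighted_bounds hσ hV hE hφw hbw hs h0 h1 hsu hd
  have hηcs := hasCompactSupport_of_window hσ hsu
  have hη' : IsTest fun t => (η t : ℂ) := isTest_ofReal hs hηcs
  -- The adjoint equation is tested with η ⊗ χ, whose time derivative brings in -ση'. This is b only
  -- after time a, so it is kept as a separate density until the vanishing of V identifies the two.
  have hDs : Smooth fun t => -(σ * deriv η t) :=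
    (contDiff_const.mul ((contDiff_infty_iff_deriv.mp hs).2)).neg
  have hD : IsTest fun t => ((-(σ * deriv η t) : ℝ) : ℂ) :=
    isTest_ofReal hDs (by exact (hηcs.deriv.mul_left (f := fun _ => σ)).neg)
  set Ψ := tensor hη' hχ with hΨ
  have hdη : ∀ t, deriv (fun t => (η t : ℂ)) t = ((deriv η t : ℝ) : ℂ) := fun t =>
    ((hs.differentiable (by simp) t).hasDerivAt.ofReal_comp).deriv
  -- the source term
  have hsrc : inner ℂ (operatorMap hA.conjTranspose (-σ) Ψ) V =
      ∫ x, starRingEnd ℂ (χ x) * ψ x ∂(wMeasure ω) := by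
    rw [h.inner_dual]
    have h2 : ∀ p : ℝ × Rn n, (tensor hφ hψ).1 p * starRingEnd ℂ (Ψ.1 p) =
        ((φ p.1 : ℝ) : ℂ) * (starRingEnd ℂ (χ p.2) * ψ p.2) := fun p => by
      simp only [hΨ, tensor, map_mul, Complex.conj_ofReal]
      by_cases h3 : φ p.1 = 0
      · simp [h3]
      · have h4 := hφb.supp _ h3
        -- The source acts before c and b lives after c, so the cutoff still equals ∫ b = 1 on the
        -- support of φ.
        rw [hone p.1 h4.1.le fun s hs => by
          by_contra h5
          linarith [(hb.supp s h5).1]]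
        push_cast
        ring
    simp only [h2]
    rw [stMeasure, integral_prod_mul (fun t => (φ t : ℂ)) fun x => starRingEnd ℂ (χ x) * ψ x]
    have h6 : ∫ t, (φ t : ℂ) = 1 := by
      rw [integral_complex_ofReal, hφb.integral]
      simp
    rw [h6, one_mul]
  have hDb : inner ℂ (sourceVec ω (tensor hD hχ)) V = inner ℂ (sourceVec ω (tensor hb' hχ)) V := by
    rw [inner_sourceVec, inner_sourceVec]
    refine integral_congr_ae ?_
    filter_upwards [hV] with p hp
    by_cases h2 : σ * p.1 < a
    · simp [hp h2]
    · simp only [tensor, hd p.1 (not_lt.mp h2), neg_neg]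
  have hlim : Tendsto (fun k => ‖inner ℂ (sourceVec ω (tensor hD hχ)) (energyMap ω (Φ k)) -
      inner ℂ (operatorMap hA.conjTranspose (-σ) Ψ) (energyMap ω (Φ k))‖)
      atTop (𝓝 ‖inner ℂ (sourceVec ω (tensor hb' hχ)) V -
        ∫ x, starRingEnd ℂ (χ x) * ψ x ∂(wMeasure ω)‖) := by
    rw [← hsrc, ← hDb]
    exact ((tendsto_const_nhds.inner h.tendsto).sub (tendsto_const_nhds.inner h.tendsto)).norm
  refine le_of_tendsto_of_tendsto' hlim
    ((((Real.continuous_sqrt.tendsto _).comp (ho.const_mul (2 / ν))).const_mul _).const_mul _)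
    fun k => ?_
  have hηc := hs.continuous
  have hχc := hχ.1.continuous
  have hEc := hE.smooth.continuous
  have hΦc : Continuous (Φ k).1 := (Φ k).2.1.continuous
  have hdX := Smooth.continuous_dX (Φ k).2.1
  have hgc := continuous_gradX hχ
  have hgs := hasCompactSupport_gradX hχ
  have hEi : Continuous fun x => (E x)⁻¹ := hEc.inv₀ fun x => (hE.pos x).ne'
  -- The time terms cancel, leaving only the flux through ∇χ. It is bounded by splitting the weight
  -- as E⁻¹ on ∇χ and E on ∇Φ.
  have hval : inner ℂ (sourceVec ω (tensor hD hχ)) (energyMap ω (Φ k)) -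
      inner ℂ (operatorMap hA.conjTranspose (-σ) Ψ) (energyMap ω (Φ k)) =
      -∫ p, inner ℂ (coef ω (fun t x => (A t x).conjTranspose) p (dX Ψ.1 p)) (dX (Φ k).1 p)
        ∂(stMeasure ω) := by
    have i1 := integrable_inner_memLp (IsTest.memLp_coef_dX hA.conjTranspose Ψ.2)
      (IsTest.memLp_dX (ω := ω) (Φ k).2)
    have i2 : Integrable (fun p => starRingEnd ℂ ((tensor hD hχ).1 p) * (Φ k).1 p)
        (stMeasure ω) :=
      ((Complex.continuous_conj.comp (tensor hD hχ).2.1.continuous).mul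
        hΦc).integrable_of_hasCompactSupport (Φ k).2.2.mul_left
    rw [inner_sourceVec_energyMap, inner_operatorMap_energyMap, sub_eq_iff_eq_add, neg_add_eq_sub,
      eq_sub_iff_add_eq, ← integral_add i2 i1]
    refine integral_congr_ae (ae_of_all _ fun p => ?_)
    simp only [hΨ, dT_tensor, hdη]
    simp only [tensor, map_mul, Complex.conj_ofReal]
    push_cast
    ring
  rw [hval, norm_neg]
  -- Dividing by M puts the ellipticity bound in the constant-free form required by
  -- `norm_integral_le_sqrt`; the factor is restored afterwards.
  have hH : ∀ p, ‖((M⁻¹ : ℝ) : ℂ) * inner ℂ (coef ω (fun t x => (A t x).conjTranspose) p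
      (dX Ψ.1 p)) (dX (Φ k).1 p)‖ ≤ η p.1 *
        (((E p.2)⁻¹ * ‖(WithLp.toLp 2 (gradX χ p.2) : Cn n)‖) * (E p.2 * ‖dX (Φ k).1 p‖)) := by
    intro p
    have hc := hA.conjTranspose.norm_coef_le Fact.out p (dX Ψ.1 p)
    have hc2 : ‖dX Ψ.1 p‖ = η p.1 * ‖(WithLp.toLp 2 (gradX χ p.2) : Cn n)‖ := by
      rw [hΨ, dX_tensor, norm_smul, Complex.norm_real, Real.norm_of_nonneg (h0 _)]
    rw [hc2] at hc
    have hE0 := hE.pos p.2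
    rw [norm_mul, Complex.norm_real, Real.norm_of_nonneg (inv_pos.mpr hM).le,
      inv_mul_le_iff₀ hM]
    calc _ ≤ _ := norm_inner_le_norm _ _
      _ ≤ M * (η p.1 * ‖(WithLp.toLp 2 (gradX χ p.2) : Cn n)‖) * ‖dX (Φ k).1 p‖ := by gcongr
      _ = _ := by field_simp
  have hmain := norm_integral_le_sqrt (ω := ω) h0 hηc
    (f := fun p => (E p.2)⁻¹ * ‖(WithLp.toLp 2 (gradX χ p.2) : Cn n)‖)
    (g := fun p => E p.2 * ‖dX (Φ k).1 p‖) ((hEi.comp continuous_snd).mul (hgc.norm.comp continuous_snd))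
    (by fun_prop) ?_ ((hasCompactSupport_dX (Φ k).2.2).norm.mul_left) hH
  · rw [integral_const_mul, norm_mul, Complex.norm_real,
      Real.norm_of_nonneg (inv_pos.mpr hM).le, inv_mul_le_iff₀ hM] at hmain
    refine hmain.trans (mul_le_mul_of_nonneg_left (mul_le_mul (Real.sqrt_le_sqrt ?_)
      (Real.sqrt_le_sqrt ?_) (Real.sqrt_nonneg _) (Real.sqrt_nonneg _)) hM.le)
    · simp only [mul_pow]
      rw [stMeasure, integral_prod_mul η fun x =>
        (E x)⁻¹ ^ 2 * ‖(WithLp.toLp 2 (gradX χ x) : Cn n)‖ ^ 2]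
      refine mul_le_mul_of_nonneg_right ?_ (integral_nonneg fun x => by positivity)
      exact (integral_le_of_window hσ h0 h1 hsu (by linarith)).trans (by linarith)
    · simp only [mul_pow]
      exact (hle k).2
  · refine HasCompactSupport.intro (hηcs.isCompact.prod hgs.isCompact) fun p hp => ?_
    rw [mem_prod, not_and_or] at hp
    rcases hp with hp | hp
    · simp [image_eq_zero_of_notMem_tsupport hp]
    · have := image_eq_zero_of_notMem_tsupport hp
      rw [this]
      simp

end AveragedEstimates

/-! ### From time averages to fixed times, by concentrating densities. -/

section PointwiseEstimates

variable {n : ℕ} {ω : Rn n → ℝ}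

theorem exists_isBump {σ : ℝ} (hσ : σ = 1 ∨ σ = -1) {l l' : ℝ} (hl : l < l') :
    ∃ b, IsBump σ l l' b := by
  have hσ2 : σ * σ = 1 := by rcases hσ with rfl | rfl <;> norm_num
  have hr : 0 < (l' - l) / 2 := by linarith
  let f : ContDiffBump (σ * ((l + l') / 2)) := ⟨(l' - l) / 4, (l' - l) / 2, by linarith, by linarith⟩
  refine ⟨f.normed volume, f.contDiff_normed, fun t => f.nonneg_normed t, fun t ht => ?_,
    f.integral_normed⟩
  have h1 : t ∈ Function.support (f.normed volume) := ht
  rw [f.support_normed_eq, Metric.mem_ball, Real.dist_eq, abs_lt] at h1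
  have h2 : f.rOut = (l' - l) / 2 := rfl
  rw [h2] at h1
  rcases hσ with rfl | rfl <;> constructor <;> linarith [h1.1, h1.2]

theorem IsBump.mono {σ l l' r r' : ℝ} {b : ℝ → ℝ} (h : IsBump σ l l' b) (hl : r ≤ l)
    (hl' : l' ≤ r') : IsBump σ r r' b :=
  ⟨h.smooth, h.nonneg, fun t ht => ⟨hl.trans_lt (h.supp t ht).1, (h.supp t ht).2.trans_le hl'⟩,
    h.integral⟩

theorem IsBump.integrable {σ l l' : ℝ} {b : ℝ → ℝ} (hb : IsBump σ l l' b) : Integrable b := by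
  by_contra h
  have := hb.integral
  rw [integral_undef h] at this
  exact zero_ne_one this

theorem IsBump.le {σ l l' : ℝ} {b : ℝ → ℝ} (hb : IsBump σ l l' b) : l ≤ l' := by
  by_contra h
  have h0 : ∀ t, b t = 0 := fun t => by
    by_contra ht
    obtain ⟨h1, h2⟩ := hb.supp t ht
    linarith
  have := hb.integral
  simp [h0] at this

theorem IsBump.integrable_mul {σ l l' : ℝ} {b : ℝ → ℝ} (hb : IsBump σ l l' b) {f : ℝ → ℂ}
    (hf : AEStronglyMeasurable f volume) {K : ℝ} (hK : ∀ t, ‖f t‖ ≤ K) :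
    Integrable fun t => (b t : ℂ) * f t :=
  hb.integrable.ofReal.mul_bdd hf (ae_of_all _ hK)

theorem IsBump.norm_integral_le {σ l l' : ℝ} {b : ℝ → ℝ} (hb : IsBump σ l l' b) {f : ℝ → ℂ}
    {K : ℝ} (hK : ∀ t, ‖f t‖ ≤ K) : ‖∫ t, (b t : ℂ) * f t‖ ≤ K := by
  have h1 : ‖∫ t, (b t : ℂ) * f t‖ ≤ ∫ t, b t * K := by
    refine norm_integral_le_of_norm_le (hb.integrable.mul_const _) (ae_of_all _ fun t => ?_)
    rw [norm_mul, Complex.norm_real, Real.norm_of_nonneg (hb.nonneg t)]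
    exact mul_le_mul_of_nonneg_left (hK t) (hb.nonneg t)
  rwa [integral_mul_const, hb.integral, one_mul] at h1

/-- Densities that concentrate at a point, on the side of later times. -/
theorem exists_isBump_seq {σ : ℝ} (hσ : σ = 1 ∨ σ = -1) (τ : ℝ) {d : ℝ} (hd : 0 < d) :
    ∃ (b : ℕ → ℝ → ℝ) (l l' : ℕ → ℝ), (∀ k, IsBump σ (l k) (l' k) (b k)) ∧
      (∀ k, σ * τ < l k) ∧ (∀ k, l' k ≤ σ * τ + d) ∧ Tendsto l' atTop (𝓝 (σ * τ)) := by
  have hb : ∀ k : ℕ, ∃ b, IsBump σ (σ * τ + d / 2 / ((k : ℝ) + 1)) (σ * τ + d / ((k : ℝ) + 1)) b :=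
    fun k => exists_isBump hσ (by gcongr; linarith)
  choose b hb using hb
  refine ⟨b, _, _, hb, fun k => lt_add_of_pos_right _ (by positivity), fun k => ?_, ?_⟩
  · have : d / ((k : ℝ) + 1) ≤ d :=
      div_le_self hd.le (by linarith [Nat.cast_nonneg (α := ℝ) k])
    linarith
  · have h1 := (tendsto_one_div_add_atTop_nhds_zero_nat (𝕜 := ℝ)).const_mul d
    simpa [div_eq_mul_inv] using h1.const_add (σ * τ)

/-- Averages over windows that shrink to a point converge to the value at the point. -/
theorem tendsto_integral_isBump {σ : ℝ} (hσ : σ = 1 ∨ σ = -1) {τ : ℝ} {l l' : ℕ → ℝ}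
    (hl : ∀ k, σ * τ ≤ l k) (hl' : Tendsto l' atTop (𝓝 (σ * τ))) {b : ℕ → ℝ → ℝ}
    (hb : ∀ k, IsBump σ (l k) (l' k) (b k)) {f : ℝ → ℂ}
    (hfc : ContinuousWithinAt f {t | σ * τ ≤ σ * t} τ)
    (hfi : ∀ k, Integrable fun t => (b k t : ℂ) * f t) :
    Tendsto (fun k => ∫ t, (b k t : ℂ) * f t) atTop (𝓝 (f τ)) := by
  rw [Metric.tendsto_nhds]
  intro ε hε
  rw [Metric.continuousWithinAt_iff] at hfc
  obtain ⟨d, hd, hfd⟩ := hfc (ε / 2) (by linarith)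
  filter_upwards [(tendsto_order.mp hl').2 (σ * τ + d) (by linarith)] with k hk
  have h1 : (∫ t, (b k t : ℂ) * f t) - f τ = ∫ t, (b k t : ℂ) * (f t - f τ) := by
    have h2 : ∫ t, (b k t : ℂ) * f τ = f τ := by
      rw [integral_mul_const, integral_complex_ofReal, (hb k).integral]
      simp
    have h3 : Integrable fun t => (b k t : ℂ) * f τ := (hb k).integrable.ofReal.mul_const _
    conv_lhs => rw [← h2]
    rw [← integral_sub (hfi k) h3]
    simp only [mul_sub]
  rw [dist_eq_norm, h1]
  have h3 : ‖∫ t, (b k t : ℂ) * (f t - f τ)‖ ≤ ∫ t, b k t * (ε / 2) := by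
    refine norm_integral_le_of_norm_le ((hb k).integrable.mul_const _) (ae_of_all _ fun t => ?_)
    rw [norm_mul, Complex.norm_real, Real.norm_of_nonneg ((hb k).nonneg t)]
    by_cases h0 : b k t = 0
    · simp [h0]
    · refine mul_le_mul_of_nonneg_left ?_ ((hb k).nonneg t)
      obtain ⟨h4, h5⟩ := (hb k).supp t h0
      have h6 := hl k
      rw [← dist_eq_norm]
      refine (hfd (x := t) ?_ ?_).le
      · exact h6.trans h4.le
      · rw [Real.dist_eq, abs_lt]
        rcases hσ with rfl | rfl <;> constructor <;> linarith
  rw [integral_mul_const, (hb k).integral] at h3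
  linarith

theorem norm_inner_propagator_le {S : ℝ → ℝ → (L2w ω →L[ℂ] L2w ω)} {C : ℝ}
    (hC : ∀ t s, ‖S t s‖ ≤ C) (ψ χ : L2w ω) (t s : ℝ) :
    ‖inner ℂ χ (S t s ψ)‖ ≤ ‖χ‖ * (C * ‖ψ‖) :=
  (norm_inner_le_norm _ _).trans
    (mul_le_mul_of_nonneg_left ((S t s).le_of_opNorm_le (hC t s) ψ) (norm_nonneg _))

theorem IsPropagator.measurable_in {A : ℝ → Rn n → Matrix (Fin n) (Fin n) ℂ}
    {S : ℝ → ℝ → (L2w ω →L[ℂ] L2w ω)} {σ : ℝ} (hS : IsPropagator ω σ A S) (ψ χ : L2w ω) (t : ℝ) :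
    Measurable fun s => inner ℂ χ (S t s ψ) := by
  classical
  have hm : MeasurableSet {s : ℝ | σ * s ≤ σ * t} := measurableSet_le (by fun_prop) (by fun_prop)
  have h1 := (hS.continuousOn_in t ψ χ).measurable_piecewise (g := fun _ => (0 : ℂ))
    continuousOn_const hm
  convert h1 using 1
  funext s
  by_cases h : σ * s ≤ σ * t
  · rw [piecewise_eq_of_mem _ _ _ (by exact h)]
  · rw [piecewise_eq_of_notMem _ _ _ (by exact h), hS.causal t s (not_le.mp h)]
    simp

theorem IsPropagator.measurable_out {A : ℝ → Rn n → Matrix (Fin n) (Fin n) ℂ}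
    {S : ℝ → ℝ → (L2w ω →L[ℂ] L2w ω)} {σ : ℝ} (hS : IsPropagator ω σ A S) (ψ χ : L2w ω) (s : ℝ) :
    Measurable fun t => inner ℂ χ (S t s ψ) := by
  classical
  have hm : MeasurableSet {t : ℝ | σ * s ≤ σ * t} := measurableSet_le (by fun_prop) (by fun_prop)
  have h1 := (hS.continuousOn_out s ψ χ).measurable_piecewise (g := fun _ => (0 : ℂ))
    continuousOn_const hm
  convert h1 using 1
  funext t
  by_cases h : σ * s ≤ σ * t
  · rw [piecewise_eq_of_mem _ _ _ (by exact h)]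
  · rw [piecewise_eq_of_notMem _ _ _ (by exact h), hS.causal t s (not_le.mp h)]
    simp

/-- Concentrating the observation of a pairing at a point. -/
theorem IsPropagator.tendsto_out {A : ℝ → Rn n → Matrix (Fin n) (Fin n) ℂ}
    {S : ℝ → ℝ → (L2w ω →L[ℂ] L2w ω)} {σ : ℝ} (hσ : σ = 1 ∨ σ = -1)
    (hS : IsPropagator ω σ A S) {s₀ t₀ : ℝ} (hst : σ * s₀ ≤ σ * t₀) (ψ χ : L2w ω)
    {b : ℕ → ℝ → ℝ} {l l' : ℕ → ℝ} (hl : ∀ k, σ * t₀ ≤ l k)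
    (hl' : Tendsto l' atTop (𝓝 (σ * t₀))) (hb : ∀ k, IsBump σ (l k) (l' k) (b k)) :
    Tendsto (fun k => ∫ t, (b k t : ℂ) * inner ℂ χ (S t s₀ ψ)) atTop
      (𝓝 (inner ℂ χ (S t₀ s₀ ψ))) := by
  obtain ⟨C, hC⟩ := hS.bounded
  exact tendsto_integral_isBump hσ (f := fun t => inner ℂ χ (S t s₀ ψ)) hl hl' hb
    ((hS.continuousOn_out s₀ ψ χ t₀ hst).mono fun t ht => hst.trans ht)
    (fun k => (hb k).integrable_mul (hS.measurable_out ψ χ s₀).aestronglyMeasurable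
      fun t => norm_inner_propagator_le hC ψ χ t s₀)

variable [Fact (IsA2 ω)] {A : ℝ → Rn n → Matrix (Fin n) (Fin n) ℂ} {M ν : ℝ}
  {S : ℝ → ℝ → (L2w ω →L[ℂ] L2w ω)}

/-- The strong solution lies in the energy class and solves the weak equation, hence is represented
by the propagator: its averaged pairings are double time averages of S. -/
theorem IsPropagator.inner_sourceVec {σ : ℝ} (hS : IsPropagator ω σ A S)
    {hA : IsElliptic ω A M ν} {φ : ℝ → ℂ} {ψ₀ : Rn n → ℂ}
    {hφ : IsTest φ} {hψ₀ : IsTest ψ₀} {Φ : ℕ → testSpace n} {V : EnergySpace ω} {ε : ℕ → ℝ}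
    (h : StrongSol hA σ (tensor hφ hψ₀) Φ V ε) {ψ : L2w ω} (hψ : ψ =ᵐ[wMeasure ω] ψ₀)
    {β : ℝ → ℂ} {χ₀ : Rn n → ℂ} (hβ : IsTest β) (hχ₀ : IsTest χ₀) {χ : L2w ω}
    (hχ : χ =ᵐ[wMeasure ω] χ₀) :
    inner ℂ (sourceVec ω (tensor hβ hχ₀)) V =
      ∫ t, starRingEnd ℂ (β t) * ∫ s, φ s * inner ℂ χ (S t s ψ) := by
  obtain ⟨u, G, hc⟩ := exists_isCurve V
  rw [hc.inner_sourceVec_tensor hβ hχ₀ hχ]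
  refine integral_congr_ae ?_
  filter_upwards [hS.represents φ ψ hφ ⟨ψ₀, hψ₀, hψ⟩ u G (hc.isEnergyClass h.mem)
    (h.weakSol hψ hc) χ ⟨χ₀, hχ₀, hχ⟩] with t ht
  rw [ht]

/-- By causality the representation integral is empty before the source acts. This initial condition
lets the energy estimate discard what happens before time a. -/
theorem IsPropagator.fst_eq_zero {σ : ℝ} (hS : IsPropagator ω σ A S)
    {hA : IsElliptic ω A M ν} {φ : ℝ → ℂ} {ψ₀ : Rn n → ℂ}
    {hφ : IsTest φ} {hψ₀ : IsTest ψ₀} {Φ : ℕ → testSpace n} {V : EnergySpace ω} {ε : ℕ → ℝ}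
    (h : StrongSol hA σ (tensor hφ hψ₀) Φ V ε) {a : ℝ} (ha : ∀ s, φ s ≠ 0 → a < σ * s) :
    ∀ᵐ p ∂(stMeasure ω), σ * p.1 < a → V.fst p = 0 := by
  obtain ⟨u, G, hc⟩ := exists_isCurve V
  set ψ : L2w ω := (hψ₀.memLp 2).toLp with hψdef
  have hψ : ψ =ᵐ[wMeasure ω] ψ₀ := (hψ₀.memLp 2).coeFn_toLp
  have hm : MeasurableSet {t : ℝ | σ * t < a} := measurableSet_lt (by fun_prop) (by fun_prop)
  have h0 : ∀ᵐ t ∂(volume.restrict {t : ℝ | σ * t < a}), u t = 0 := by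
    refine ae_eq_zero_of_inner_test fun χ hχ => ?_
    rw [ae_restrict_iff' hm]
    filter_upwards [hS.represents φ ψ hφ ⟨ψ₀, hψ₀, hψ⟩ u G (hc.isEnergyClass h.mem)
      (h.weakSol hψ hc) χ hχ] with t ht hta
    rw [ht]
    refine integral_eq_zero_of_ae (ae_of_all _ fun s => ?_)
    by_cases hs : φ s = 0
    · simp [hs]
    · have h1 : σ * t < a := hta
      simp [hS.causal t s (h1.trans (ha s hs))]
  rw [ae_restrict_iff' hm] at h0
  have hms : MeasurableSet {p : ℝ × Rn n | σ * p.1 < a → V.fst p = 0} := by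
    have h1 : MeasurableSet {p | V.fst p = 0} :=
      measurableSet_eq_fun (Lp.stronglyMeasurable V.fst).measurable measurable_const
    have h2 : MeasurableSet {p : ℝ × Rn n | σ * p.1 < a} :=
      measurableSet_lt (by fun_prop) (by fun_prop)
    exact h2.imp h1
  rw [Measure.ae_prod_iff_ae_ae hms]
  filter_upwards [h0, hc.fst] with t h1 h2
  by_cases hta : σ * t < a
  · rw [h1 hta] at h2
    filter_upwards [h2, Lp.coeFn_zero ℂ 2 (wMeasure ω)] with x h3 h4 _
    rw [h4] at h3
    have : (rho t : ℂ) ≠ 0 := by exact_mod_cast (rho_pos _).ne'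
    simpa [this] using h3.symm
  · exact ae_of_all _ fun x h => absurd h hta

/-- Measurability in t is read off from a solution u that the integral represents, so no joint
measurability of S is involved. -/
theorem IsPropagator.aestronglyMeasurable_integral {σ : ℝ} (hσ : σ = 1 ∨ σ = -1)
    (hS : IsPropagator ω σ A S) (hA : IsElliptic ω A M ν)
    (hu : EnergyUnique ω (-σ) fun t x => (A t x).conjTranspose) {φ : ℝ → ℂ} (hφ : IsTest φ)
    {ψ χ : L2w ω} (hψ : IsTestL2 ψ) (hχ : IsTestL2 χ) :
    AEStronglyMeasurable (fun t => ∫ s, φ s * inner ℂ χ (S t s ψ)) volume := by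
  obtain ⟨ψ₀, hψ₀, hψe⟩ := id hψ
  obtain ⟨Φ, V, ε, h⟩ := exists_strongSol hA hσ hu (tensor hφ hψ₀)
  obtain ⟨u, G, hc⟩ := exists_isCurve V
  have h1 : AEStronglyMeasurable (fun t => inner ℂ χ (u t)) volume :=
    (innerSL ℂ χ).continuous.comp_aestronglyMeasurable hc.locallyIntegrable.aestronglyMeasurable
  exact h1.congr (hS.represents φ ψ hφ hψ u G (hc.isEnergyClass h.mem) (h.weakSol hψe hc) χ hχ)

/-- Concentrating the source of an averaged pairing at a point. -/
theorem IsPropagator.tendsto_average {σ : ℝ} (hσ : σ = 1 ∨ σ = -1)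
    (hS : IsPropagator ω σ A S) (hA : IsElliptic ω A M ν)
    (hu : EnergyUnique ω (-σ) fun t x => (A t x).conjTranspose) {s₀ c c' : ℝ}
    (hc : σ * s₀ < c) {ψ χ : L2w ω} (hψ : IsTestL2 ψ) (hχ : IsTestL2 χ) {b : ℝ → ℝ}
    (hb : IsBump σ c c' b) {φ : ℕ → ℝ → ℝ} {l l' : ℕ → ℝ} (hl : ∀ k, σ * s₀ ≤ l k)
    (hl' : Tendsto l' atTop (𝓝 (σ * s₀))) (hφ : ∀ k, IsBump σ (l k) (l' k) (φ k)) :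
    Tendsto (fun k => ∫ t, (b t : ℂ) * ∫ s, (φ k s : ℂ) * inner ℂ χ (S t s ψ)) atTop
      (𝓝 (∫ t, (b t : ℂ) * inner ℂ χ (S t s₀ ψ))) := by
  obtain ⟨C, hC⟩ := hS.bounded
  have hbd := norm_inner_propagator_le hC ψ χ
  refine tendsto_integral_of_dominated_convergence (fun t => ‖b t‖ * (‖χ‖ * (C * ‖ψ‖)))
    (fun k => ?_) (hb.integrable.norm.mul_const _) (fun k => ae_of_all _ fun t => ?_)
    (ae_of_all _ fun t => ?_)
  · exact hb.integrable.ofReal.1.mul (hS.aestronglyMeasurable_integral hσ hA hu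
      ((hφ k).isTest hσ) hψ hχ)
  · rw [norm_mul, Complex.norm_real]
    exact mul_le_mul_of_nonneg_left ((hφ k).norm_integral_le (hbd t)) (norm_nonneg _)
  · by_cases h0 : b t = 0
    · simp [h0]
    · refine Tendsto.const_mul _ ?_
      have ht : σ * s₀ < σ * t := hc.trans (hb.supp t h0).1
      refine tendsto_integral_isBump hσ hl hl' hφ ?_
        fun k => (hφ k).integrable_mul (hS.measurable_in ψ χ t).aestronglyMeasurable (hbd t)
      refine (hS.continuousOn_in t ψ χ s₀ ht.le).mono_of_mem_nhdsWithin
        (mem_nhdsWithin_of_mem_nhds ?_)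
      have ho : IsOpen {s : ℝ | σ * s < σ * t} := isOpen_lt (by fun_prop) (by fun_prop)
      exact mem_of_superset (ho.mem_nhds ht) fun s hs => show σ * s ≤ σ * t from le_of_lt hs

/-- Averaged estimates for a propagator pass to the limit. -/
theorem IsPropagator.norm_inner_sub_le {σ : ℝ} (hσ : σ = 1 ∨ σ = -1)
    (hS : IsPropagator ω σ A S) (hA : IsElliptic ω A M ν)
    (hu : EnergyUnique ω (-σ) fun t x => (A t x).conjTranspose) {s₀ t₀ : ℝ}
    (hst : σ * s₀ ≤ σ * t₀) {ψ χ : L2w ω} (hψ : IsTestL2 ψ) (hχ : IsTestL2 χ) {z : ℂ} {B : ℝ}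
    (h : ∀ c φ b, σ * s₀ ≤ c → c ≤ σ * t₀ + 1 → IsBump σ (σ * s₀) c φ →
      IsBump σ c (σ * t₀ + 1) b →
      ‖(∫ t, (b t : ℂ) * ∫ s, (φ s : ℂ) * inner ℂ χ (S t s ψ)) - z‖ ≤ B) :
    ‖inner ℂ χ (S t₀ s₀ ψ) - z‖ ≤ B := by
  -- The source is concentrated first, with the observation window kept strictly after s₀ so that
  -- continuity at s₀ applies; then the observation is concentrated at t₀. Both windows approach
  -- from later times, which also covers t₀ = s₀.
  have step : ∀ c b, σ * s₀ < c → c ≤ σ * t₀ + 1 → IsBump σ c (σ * t₀ + 1) b →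
      ‖(∫ t, (b t : ℂ) * inner ℂ χ (S t s₀ ψ)) - z‖ ≤ B := by
    intro c b hc hc' hb
    obtain ⟨φ, l, l', hφ, hl, hle, hlim⟩ := exists_isBump_seq hσ s₀ (sub_pos.mpr hc)
    refine le_of_tendsto ((hS.tendsto_average hσ hA hu hc hψ hχ hb (fun k => (hl k).le) hlim
      hφ).sub_const z).norm (Eventually.of_forall fun k => ?_)
    exact h c (φ k) b hc.le hc' ((hφ k).mono (hl k).le (by linarith [hle k])) hb
  obtain ⟨b, l, l', hb, hl, hle, hlim⟩ := exists_isBump_seq hσ t₀ one_pos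
  refine le_of_tendsto ((hS.tendsto_out hσ hst ψ χ (fun k => (hl k).le) hlim hb).sub_const z).norm
    (Eventually.of_forall fun k => ?_)
  exact step _ (b k) (hst.trans_lt (hl k)) ((hb k).le.trans (hle k)) ((hb k).mono le_rfl (hle k))

/-- The class of a test function in `L²_ω`. -/
def testL2 (ω : Rn n → ℝ) [Fact (IsA2 ω)] {ψ : Rn n → ℂ} (hψ : IsTest ψ) : L2w ω :=
  (hψ.memLp 2).toLp

theorem coeFn_testL2 {ψ : Rn n → ℂ} (hψ : IsTest ψ) : testL2 ω hψ =ᵐ[wMeasure ω] ψ :=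
  (hψ.memLp 2).coeFn_toLp

theorem isTestL2_testL2 {ψ : Rn n → ℂ} (hψ : IsTest ψ) : IsTestL2 (testL2 ω hψ) :=
  ⟨ψ, hψ, coeFn_testL2 hψ⟩

theorem inner_testL2 {χ : Rn n → ℂ} (hχ : IsTest χ) (f : L2w ω) :
    inner ℂ (testL2 ω hχ) f = ∫ x, starRingEnd ℂ (χ x) * f x ∂(wMeasure ω) := by
  rw [L2.inner_def]
  refine integral_congr_ae ?_
  filter_upwards [coeFn_testL2 (ω := ω) hχ] with x h1
  rw [h1, RCLike.inner_apply, mul_comm]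

/-- Weighted bounds and approximate conservation of mass for a propagator. -/
theorem IsPropagator.exists_bounds {σ : ℝ} (hσ : σ = 1 ∨ σ = -1)
    (hS : IsPropagator ω σ A S) (hA : IsElliptic ω A M ν)
    (hu : EnergyUnique ω (-σ) fun t x => (A t x).conjTranspose) {s₀ t₀ : ℝ}
    (hst : σ * s₀ ≤ σ * t₀) (δ : ℝ) : ∃ C, 0 ≤ C ∧ ∀ E : Rn n → ℝ, IsWeight δ E →
      ∀ (ψ χ : Rn n → ℂ) (hψ : IsTest ψ) (hχ : IsTest χ),
      (∀ hEχ : IsTest fun x => (E x : ℂ) * χ x,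
        ‖inner ℂ (testL2 ω hEχ) (S t₀ s₀ (testL2 ω hψ))‖ ≤
          C * √(∫ x, E x ^ 2 * ‖ψ x‖ ^ 2 ∂(wMeasure ω)) * √(∫ x, ‖χ x‖ ^ 2 ∂(wMeasure ω))) ∧
      ‖inner ℂ (testL2 ω hχ) (S t₀ s₀ (testL2 ω hψ)) - inner ℂ (testL2 ω hχ) (testL2 ω hψ)‖ ≤
        C * √(∫ x, E x ^ 2 * ‖ψ x‖ ^ 2 ∂(wMeasure ω)) *
          √(∫ x, (E x)⁻¹ ^ 2 * ‖(WithLp.toLp 2 (gradX χ x) : Cn n)‖ ^ 2 ∂(wMeasure ω)) := by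
  have hM := hA.M_pos
  have hν := hA.ν_pos
  -- The time span runs from the source to the end of the observation window, one unit after t₀,
  -- plus the two units used by the time cutoff. The constants 16X and 8X/ν below are 4·4X and
  -- (2/ν)·4X.
  set L := σ * t₀ + 1 - σ * s₀ + 2 with hL
  have hL0 : 0 ≤ L := by linarith
  set X := Real.exp (2 * growthRate M ν δ * L) with hX
  have hX0 : 0 < X := Real.exp_pos _
  refine ⟨max √(16 * X) (M * (√L * √(8 * X / ν))), by positivity, fun E hE ψ χ hψ hχ => ?_⟩
  have hφt : ∀ {l l' : ℝ} {φ : ℝ → ℝ}, IsBump σ l l' φ → IsTest fun t => (φ t : ℂ) :=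
    fun h => h.isTest hσ
  constructor
  · intro hEχ
    have h1 := hS.norm_inner_sub_le hσ hA hu hst (isTestL2_testL2 hψ) (isTestL2_testL2 hEχ)
      (z := 0) (B := √(16 * X) * √(∫ x, E x ^ 2 * ‖ψ x‖ ^ 2 ∂(wMeasure ω)) *
        √(∫ x, ‖χ x‖ ^ 2 ∂(wMeasure ω))) (fun c φ b hc hc' hφ hb => by
        obtain ⟨Φ, V, ε, h⟩ := exists_strongSol hA hσ hu (tensor (hφt hφ) hψ)
        have hV := hS.fst_eq_zero h (a := σ * s₀) fun s hs =>
          (hφ.supp s (by simpa using hs)).1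
        have h2 := h.norm_inner_sourceVec_le hσ hV hE (hφ.mono le_rfl hc') (hb.mono hc le_rfl)
          (hφt hb) hχ hEχ
        rw [hS.inner_sourceVec h (coeFn_testL2 hψ) (hφt hb) hEχ (coeFn_testL2 hEχ)] at h2
        simp only [Complex.conj_ofReal] at h2
        rw [sub_zero]
        refine h2.trans (le_of_eq ?_)
        rw [show 4 * (4 * Real.exp (2 * growthRate M ν δ * (σ * t₀ + 1 - σ * s₀ + 2)) *
          ∫ x, E x ^ 2 * ‖ψ x‖ ^ 2 ∂(wMeasure ω)) = 16 * X *
          ∫ x, E x ^ 2 * ‖ψ x‖ ^ 2 ∂(wMeasure ω) by rw [hX, hL]; ring,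
          Real.sqrt_mul (by positivity)]
        ring)
    rw [sub_zero] at h1
    refine h1.trans ?_
    gcongr
    exact le_max_left _ _
  · have hin : inner ℂ (testL2 ω hχ) (testL2 ω hψ) =
        ∫ x, starRingEnd ℂ (χ x) * ψ x ∂(wMeasure ω) := by
      rw [inner_testL2]
      refine integral_congr_ae ?_
      filter_upwards [coeFn_testL2 (ω := ω) hψ] with x h1
      rw [h1]
    refine (hS.norm_inner_sub_le hσ hA hu hst (isTestL2_testL2 hψ) (isTestL2_testL2 hχ)
      (z := inner ℂ (testL2 ω hχ) (testL2 ω hψ))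
      (B := M * (√L * √(8 * X / ν)) * √(∫ x, E x ^ 2 * ‖ψ x‖ ^ 2 ∂(wMeasure ω)) *
        √(∫ x, (E x)⁻¹ ^ 2 * ‖(WithLp.toLp 2 (gradX χ x) : Cn n)‖ ^ 2 ∂(wMeasure ω)))
      (fun c φ b hc hc' hφ hb => ?_)).trans ?_
    · obtain ⟨Φ, V, ε, h⟩ := exists_strongSol hA hσ hu (tensor (hφt hφ) hψ)
      have hV := hS.fst_eq_zero h (a := σ * s₀) fun s hs =>
        (hφ.supp s (by simpa using hs)).1
      have h2 := h.norm_inner_sourceVec_sub_le hσ hV hc hc' hE hφ hb (hφt hb) hχ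
      rw [hS.inner_sourceVec h (coeFn_testL2 hψ) (hφt hb) hχ (coeFn_testL2 hχ)] at h2
      simp only [Complex.conj_ofReal] at h2
      rw [hin]
      refine h2.trans (le_of_eq ?_)
      rw [show 2 / ν * (4 * Real.exp (2 * growthRate M ν δ * (σ * t₀ + 1 - σ * s₀ + 2)) *
        ∫ x, E x ^ 2 * ‖ψ x‖ ^ 2 ∂(wMeasure ω)) = 8 * X / ν *
        ∫ x, E x ^ 2 * ‖ψ x‖ ^ 2 ∂(wMeasure ω) by rw [hX, hL]; ring,
        Real.sqrt_mul (show 0 ≤ 8 * X / ν by positivity),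
        Real.sqrt_mul (show 0 ≤ σ * t₀ + 1 - σ * s₀ + 2 from hL0)]
      ring
    · gcongr
      exact le_max_right _ _

end PointwiseEstimates

/-! ### Truncated polynomial weights and spatial cutoffs. -/

section WeightsAndCutoffs

variable {n : ℕ} {ω : Rn n → ℝ}

/-- Bounded truncations of the weight `growthWeight`. -/
def truncWeight (ε : ℝ) (x : Rn n) : ℝ := growthWeight x / (1 + ε * growthWeight x)

theorem truncWeight_pos {ε : ℝ} (hε : 0 ≤ ε) (x : Rn n) : 0 < truncWeight ε x := by
  have := growthWeight_pos x
  unfold truncWeight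
  positivity

theorem inv_truncWeight {ε : ℝ} (x : Rn n) :
    (truncWeight ε x)⁻¹ = (growthWeight x)⁻¹ + ε := by
  have := (growthWeight_pos x).ne'
  rw [truncWeight, inv_div]
  field_simp

theorem truncWeight_le {ε : ℝ} (hε : 0 ≤ ε) (x : Rn n) : truncWeight ε x ≤ growthWeight x := by
  have := growthWeight_pos x
  exact div_le_self this.le (by nlinarith)

theorem truncWeight_le_inv {ε : ℝ} (hε : 0 < ε) (x : Rn n) : truncWeight ε x ≤ ε⁻¹ := by
  have := growthWeight_pos x
  rw [truncWeight, div_le_iff₀ (by positivity), mul_add, inv_mul_cancel_left₀ hε.ne']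
  have : 0 < ε⁻¹ := inv_pos.mpr hε
  linarith

theorem norm_gradR_eq {E : Rn n → ℝ} {c : ℝ} {x : Rn n}
    (h : HasFDerivAt E (c • innerSL ℝ x) x) : ‖gradR E x‖ = |c| * ‖x‖ := by
  have h1 : gradR E x = (c : ℂ) • (WithLp.toLp 2 fun i => (x i : ℂ) : Cn n) := by
    ext i
    simp only [gradR, h.fderiv, PiLp.smul_apply, smul_apply,
      innerSL_apply_apply, smul_eq_mul]
    rw [EuclideanSpace.inner_single_right]
    simp
  rw [h1, norm_smul, Complex.norm_real, Real.norm_eq_abs, EuclideanSpace.norm_eq,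
    EuclideanSpace.norm_eq]
  simp

/-- With G = (1 + |x|²)^(n+1), the logarithmic gradient of G/(1 + εG) is that of G divided by 1 +
εG, and |∇G|/G = 2(n+1)|x|/(1 + |x|²) ≤ n + 1. The rate is independent of ε, which permits ε → 0
later. -/
theorem isWeight_truncWeight {ε : ℝ} (hε : 0 < ε) :
    IsWeight ((n : ℝ) + 1) (truncWeight (n := n) ε) where
  smooth := contDiff_growthWeight.div (contDiff_const.add (contDiff_const.mul contDiff_growthWeight))
    fun x => by have := growthWeight_pos x; positivity
  pos := truncWeight_pos hε.le
  bounded := ⟨ε⁻¹, truncWeight_le_inv hε⟩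
  grad x := by
    have hG := growthWeight_pos x
    have h1 : HasFDerivAt (growthWeight (n := n))
        ((((n : ℝ) + 1) * (1 + ‖x‖ ^ 2) ^ n * 2) • innerSL ℝ x) x := by
      have h := (((hasStrictFDerivAt_norm_sq x).hasFDerivAt).const_add 1).pow (n + 1)
      refine h.congr_fderiv ?_
      ext v
      simp
      ring
    have h2 : HasDerivAt (fun y : ℝ => y / (1 + ε * y)) (((1 + ε * growthWeight x) ^ 2)⁻¹)
        (growthWeight x) := by
      have hne : 1 + ε * growthWeight x ≠ 0 := by positivity
      have h := (hasDerivAt_id (growthWeight x)).div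
        (((hasDerivAt_id (growthWeight x)).const_mul ε).const_add 1) hne
      refine h.congr_deriv ?_
      simp only [id]
      field_simp
      ring
    have h3 := h2.comp_hasFDerivAt x h1
    rw [smul_smul] at h3
    have h4 : ‖gradR (truncWeight ε) x‖ = _ := norm_gradR_eq h3
    rw [h4, abs_of_nonneg (by positivity)]
    have h5 : 2 * ‖x‖ ≤ 1 + ‖x‖ ^ 2 := by nlinarith [sq_nonneg (‖x‖ - 1)]
    have h6 : growthWeight x = (1 + ‖x‖ ^ 2) ^ n * (1 + ‖x‖ ^ 2) := by
      rw [growthWeight, pow_succ]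
    have h7 : 1 ≤ 1 + ε * growthWeight x := by nlinarith
    calc ((1 + ε * growthWeight x) ^ 2)⁻¹ * (((n : ℝ) + 1) * (1 + ‖x‖ ^ 2) ^ n * 2) * ‖x‖
        = ((1 + ε * growthWeight x) ^ 2)⁻¹ * (((n : ℝ) + 1) *
            ((1 + ‖x‖ ^ 2) ^ n * (2 * ‖x‖))) := by ring
      _ ≤ (1 + ε * growthWeight x)⁻¹ * (((n : ℝ) + 1) *
            ((1 + ‖x‖ ^ 2) ^ n * (1 + ‖x‖ ^ 2))) := by
          gcongr
          exact le_self_pow₀ h7 (by simp)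
      _ = _ := by rw [← h6, truncWeight]; ring

section Cutoff

/-- A smooth bump function equal to `1` on the unit ball. -/
def unitBump (n : ℕ) : ContDiffBump (0 : Rn n) := ⟨1, 2, one_pos, one_lt_two⟩

/-- A smooth cutoff function at scale `R`. -/
def cutoff (R : ℝ) (x : Rn n) : ℂ := ((unitBump n (R⁻¹ • x) : ℝ) : ℂ)

theorem isTest_unitBump : IsTest fun x : Rn n => ((unitBump n x : ℝ) : ℂ) :=
  isTest_ofReal (unitBump n).contDiff (unitBump n).hasCompactSupport

theorem isTest_cutoff {R : ℝ} (hR : 0 < R) : IsTest (cutoff (n := n) R) :=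
  ⟨isTest_unitBump.1.comp (contDiff_const_smul _),
    isTest_unitBump.2.comp_smul (inv_pos.mpr hR).ne'⟩

theorem cutoff_eq_one {R : ℝ} (hR : 0 < R) {x : Rn n} (hx : ‖x‖ ≤ R) : cutoff R x = 1 := by
  rw [cutoff, (unitBump n).one_of_mem_closedBall, Complex.ofReal_one]
  rw [mem_closedBall_zero_iff, norm_smul, Real.norm_of_nonneg (inv_pos.mpr hR).le,
    inv_mul_le_iff₀ hR]
  change ‖x‖ ≤ R * 1
  linarith

theorem cutoff_eq_zero {R : ℝ} (hR : 0 < R) {x : Rn n} (hx : 2 * R ≤ ‖x‖) : cutoff R x = 0 := by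
  rw [cutoff, (unitBump n).zero_of_le_dist, Complex.ofReal_zero]
  rw [dist_zero_right, norm_smul, Real.norm_of_nonneg (inv_pos.mpr hR).le, le_inv_mul_iff₀ hR]
  change R * 2 ≤ _
  linarith

theorem norm_cutoff_le (R : ℝ) (x : Rn n) : ‖cutoff R x‖ ≤ 1 := by
  rw [cutoff, Complex.norm_real, Real.norm_of_nonneg (unitBump n).nonneg]
  exact (unitBump n).le_one

theorem tendsto_cutoff (x : Rn n) : Tendsto (fun R => cutoff R x) atTop (𝓝 1) := by
  refine tendsto_const_nhds.congr' ?_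
  filter_upwards [eventually_ge_atTop ‖x‖, eventually_gt_atTop 0] with R h1 h2
  rw [cutoff_eq_one h2 h1]

theorem exists_gradX_cutoff_le : ∃ B : ℝ, 0 ≤ B ∧ ∀ R : ℝ, 0 < R → ∀ x : Rn n,
    ‖(WithLp.toLp 2 (gradX (cutoff R) x) : Cn n)‖ ≤ R⁻¹ * B := by
  obtain ⟨B, hB⟩ := (hasCompactSupport_gradX isTest_unitBump).exists_bound_of_continuous
    (continuous_gradX (n := n) isTest_unitBump)
  refine ⟨B, (norm_nonneg _).trans (hB 0), fun R hR x => ?_⟩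
  have h1 : (WithLp.toLp 2 (gradX (cutoff R) x) : Cn n) = ((R⁻¹ : ℝ) : ℂ) •
      WithLp.toLp 2 (gradX (fun x : Rn n => ((unitBump n x : ℝ) : ℂ)) (R⁻¹ • x)) := by
    ext i
    have h2 := (isTest_unitBump (n := n)).1.differentiable (by simp) (R⁻¹ • x)
    have h3 : HasFDerivAt (cutoff R) _ x :=
      h2.hasFDerivAt.comp x ((hasFDerivAt_id x).const_smul R⁻¹)
    simp [gradX, partialX, h3.fderiv]
  rw [h1, norm_smul, Complex.norm_real, Real.norm_of_nonneg (inv_pos.mpr hR).le]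
  exact mul_le_mul_of_nonneg_left (hB _) (inv_pos.mpr hR).le

end Cutoff

/-- Multiplication by a bounded continuous function on `L²_ω`. -/
theorem memLp_mul_of_bounded {g : Rn n → ℂ} (hg : Continuous g) {B : ℝ} (hB : ∀ x, ‖g x‖ ≤ B)
    (f : L2w ω) : MemLp (fun x => g x * f x) 2 (wMeasure ω) :=
  (Lp.memLp f).of_le_mul (c := B) (hg.aestronglyMeasurable.mul (Lp.aestronglyMeasurable f))
    (ae_of_all _ fun x => by
      rw [norm_mul]; exact mul_le_mul_of_nonneg_right (hB x) (norm_nonneg _))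

variable [Fact (IsA2 ω)]

/-- The bounds that a propagator satisfies for weights with `|∇E| ≤ δ E`. -/
def HasWeightedBounds (δ C : ℝ) (T : L2w ω →L[ℂ] L2w ω) : Prop :=
  ∀ E : Rn n → ℝ, IsWeight δ E → ∀ (ψ χ : Rn n → ℂ) (hψ : IsTest ψ) (hχ : IsTest χ),
    (∀ hEχ : IsTest fun x => (E x : ℂ) * χ x,
      ‖inner ℂ (testL2 ω hEχ) (T (testL2 ω hψ))‖ ≤
        C * √(∫ x, E x ^ 2 * ‖ψ x‖ ^ 2 ∂(wMeasure ω)) * √(∫ x, ‖χ x‖ ^ 2 ∂(wMeasure ω))) ∧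
    ‖inner ℂ (testL2 ω hχ) (T (testL2 ω hψ)) - inner ℂ (testL2 ω hχ) (testL2 ω hψ)‖ ≤
      C * √(∫ x, E x ^ 2 * ‖ψ x‖ ^ 2 ∂(wMeasure ω)) *
        √(∫ x, (E x)⁻¹ ^ 2 * ‖(WithLp.toLp 2 (gradX χ x) : Cn n)‖ ^ 2 ∂(wMeasure ω))

theorem norm_testL2 {ψ : Rn n → ℂ} (hψ : IsTest ψ) :
    ‖testL2 ω hψ‖ = √(∫ x, ‖ψ x‖ ^ 2 ∂(wMeasure ω)) := by
  rw [← norm_toLp_sq (hψ.memLp 2), Real.sqrt_sq (norm_nonneg _), testL2]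

/-- Functions supported in a ball are limits of test functions supported in a larger ball. -/
theorem exists_test_tendsto {r : ℝ} (hr : 0 < r) {ψ : L2w ω}
    (hψ : ∀ᵐ x ∂(wMeasure ω), r < ‖x‖ → ψ x = 0) :
    ∃ (f : ℕ → Rn n → ℂ) (hf : ∀ k, IsTest (f k)), (∀ k x, 2 * r ≤ ‖x‖ → f k x = 0) ∧
      Tendsto (fun k => testL2 ω (hf k)) atTop (𝓝 ψ) := by
  obtain ⟨u, hu, hlim⟩ := mem_closure_iff_seq_limit.mp ((dense_isTestL2 (ω := ω)) ψ)
  choose g hg hge using hu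
  have hc := isTest_cutoff (n := n) hr
  have hf : ∀ k, IsTest fun x => cutoff r x * g k x := fun k =>
    ⟨hc.1.mul (hg k).1, (hg k).2.mul_left⟩
  refine ⟨_, hf, fun k x hx => by rw [cutoff_eq_zero hr hx, zero_mul], ?_⟩
  rw [tendsto_iff_norm_sub_tendsto_zero] at hlim ⊢
  refine squeeze_zero (fun _ => norm_nonneg _) (fun k => ?_) hlim
  refine Lp.norm_le_norm_of_ae_le ?_
  filter_upwards [Lp.coeFn_sub (testL2 ω (hf k)) ψ, Lp.coeFn_sub (u k) ψ, hge k,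
    coeFn_testL2 (ω := ω) (hf k), hψ] with x h1 h2 h3 h4 h5
  rw [h1, h2, Pi.sub_apply, Pi.sub_apply, h4, h3]
  have h6 : ψ x = cutoff r x * ψ x := by
    by_cases hx : ‖x‖ ≤ r
    · rw [cutoff_eq_one hr hx, one_mul]
    · rw [h5 (not_le.mp hx), mul_zero]
  conv_lhs => rw [h6, ← mul_sub, norm_mul]
  exact mul_le_of_le_one_left (norm_nonneg _) (norm_cutoff_le _ _)

/-- An element of `L²_ω` is determined in norm by its pairings with test functions. -/
theorem norm_le_of_inner_test {g : L2w ω} {K : ℝ} (hK : 0 ≤ K)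
    (h : ∀ (χ : Rn n → ℂ) (hχ : IsTest χ), ‖inner ℂ (testL2 ω hχ) g‖ ≤ K * ‖testL2 ω hχ‖) :
    ‖g‖ ≤ K := by
  have h1 : ∀ f : L2w ω, ‖inner ℂ f g‖ ≤ K * ‖f‖ := fun f => by
    have hcl : IsClosed {f : L2w ω | ‖inner ℂ f g‖ ≤ K * ‖f‖} :=
      isClosed_le (by fun_prop) (by fun_prop)
    have hsub : {f : L2w ω | IsTestL2 f} ⊆ {f : L2w ω | ‖inner ℂ f g‖ ≤ K * ‖f‖} := by
      rintro f ⟨χ, hχ, hf⟩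
      have : f = testL2 ω hχ := Lp.ext (hf.trans (coeFn_testL2 hχ).symm)
      rw [this]
      exact h χ hχ
    exact hcl.closure_subset_iff.mpr hsub (dense_isTestL2 f)
  have h2 := h1 g
  rw [inner_self_eq_norm_sq_to_K, norm_pow, RCLike.norm_ofReal, abs_norm] at h2
  by_contra hcon
  push Not at hcon
  nlinarith [norm_nonneg g]

end WeightsAndCutoffs

/-! ### Decay, conservation of mass and preservation of constants. -/

section Conservation

variable {n : ℕ} {ω : Rn n → ℝ}

/-- The maximum of `growthWeight` on the ball of radius `2 r`. -/
def growthBound (n : ℕ) (r : ℝ) : ℝ := (1 + (2 * r) ^ 2) ^ (n + 1)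

theorem growthBound_pos (r : ℝ) : 0 < growthBound n r := by
  unfold growthBound
  positivity

theorem growthWeight_le {r : ℝ} {x : Rn n} (hx : ‖x‖ ≤ 2 * r) :
    growthWeight x ≤ growthBound n r := by
  unfold growthWeight growthBound
  gcongr

variable [Fact (IsA2 ω)]

theorem sqrt_integral_truncWeight_le {ε r : ℝ} (hε : 0 < ε) {f : Rn n → ℂ} (hf : IsTest f)
    (hfr : ∀ x, 2 * r ≤ ‖x‖ → f x = 0) :
    √(∫ x, truncWeight ε x ^ 2 * ‖f x‖ ^ 2 ∂(wMeasure ω)) ≤ growthBound n r * ‖testL2 ω hf‖ := by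
  have hB := growthBound_pos (n := n) r
  have hc := hf.1.continuous
  have hs : HasCompactSupport fun x => ‖f x‖ ^ 2 :=
    hf.2.comp_left (g := fun z : ℂ => ‖z‖ ^ 2) (by simp)
  have hE := (isWeight_truncWeight (n := n) hε).smooth.continuous
  have h1 : ∫ x, truncWeight ε x ^ 2 * ‖f x‖ ^ 2 ∂(wMeasure ω) ≤
      ∫ x, growthBound n r ^ 2 * ‖f x‖ ^ 2 ∂(wMeasure ω) := by
    refine integral_mono (Continuous.integrable_of_hasCompactSupport (by fun_prop) hs.mul_left)
      (Continuous.integrable_of_hasCompactSupport (by fun_prop) hs.mul_left) fun x => ?_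
    by_cases hx : 2 * r ≤ ‖x‖
    · simp [hfr x hx]
    · have h2 := (truncWeight_le hε.le x).trans (growthWeight_le (not_le.mp hx).le)
      have h3 := (truncWeight_pos hε.le x).le
      simp only
      gcongr
  refine (Real.sqrt_le_sqrt h1).trans (le_of_eq ?_)
  rw [integral_const_mul, Real.sqrt_mul (sq_nonneg _), Real.sqrt_sq hB.le, norm_testL2]

variable {T : L2w ω →L[ℂ] L2w ω} {C : ℝ}

theorem HasWeightedBounds.norm_inner_le (hT : HasWeightedBounds ((n : ℝ) + 1) C T) (hC : 0 ≤ C)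
    {r : ℝ} (hr : 0 < r) {ψ : L2w ω} (hψ : ∀ᵐ x ∂(wMeasure ω), r < ‖x‖ → ψ x = 0) {ε : ℝ}
    (hε : 0 < ε) {χ : Rn n → ℂ} (hχ : IsTest χ)
    (hEχ : IsTest fun x => (truncWeight ε x : ℂ) * χ x) :
    ‖inner ℂ (testL2 ω hEχ) (T ψ)‖ ≤ C * (growthBound n r * ‖ψ‖) * ‖testL2 ω hχ‖ := by
  obtain ⟨f, hf, hfr, hlim⟩ := exists_test_tendsto hr hψ
  have h1 : Tendsto (fun k => ‖inner ℂ (testL2 ω hEχ) (T (testL2 ω (hf k)))‖) atTop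
      (𝓝 ‖inner ℂ (testL2 ω hEχ) (T ψ)‖) :=
    (tendsto_const_nhds.inner ((T.continuous.tendsto ψ).comp hlim)).norm
  refine le_of_tendsto_of_tendsto' h1
    (((hlim.norm.const_mul _).const_mul C).mul_const _) fun k => ?_
  refine ((hT _ (isWeight_truncWeight hε) (f k) χ (hf k) hχ).1 hEχ).trans ?_
  rw [← norm_testL2 hχ]
  gcongr
  exact sqrt_integral_truncWeight_le hε (hf k) (hfr k)

/-- Density removes the smoothness of ψ for each truncation. Then ε → 0 by dominated convergence:
the inverse truncated weight is growthWeight⁻¹ + ε, at most 2 for ε ≤ 1, and ∇χ has compact support.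
-/
theorem HasWeightedBounds.norm_inner_sub_le (hT : HasWeightedBounds ((n : ℝ) + 1) C T)
    (hC : 0 ≤ C) {r : ℝ} (hr : 0 < r) {ψ : L2w ω}
    (hψ : ∀ᵐ x ∂(wMeasure ω), r < ‖x‖ → ψ x = 0) {χ : Rn n → ℂ} (hχ : IsTest χ) :
    ‖inner ℂ (testL2 ω hχ) (T ψ) - inner ℂ (testL2 ω hχ) ψ‖ ≤ C * (growthBound n r * ‖ψ‖) *
      √(∫ x, (growthWeight x)⁻¹ ^ 2 * ‖(WithLp.toLp 2 (gradX χ x) : Cn n)‖ ^ 2 ∂(wMeasure ω)) := by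
  have hgc := continuous_gradX hχ
  have hs : HasCompactSupport fun x => ‖(WithLp.toLp 2 (gradX χ x) : Cn n)‖ ^ 2 :=
    (hasCompactSupport_gradX hχ).comp_left (g := fun z : Cn n => ‖z‖ ^ 2) (by simp)
  have hic : Continuous fun x : Rn n => (growthWeight x)⁻¹ :=
    contDiff_growthWeight.continuous.inv₀ fun x => (growthWeight_pos x).ne'
  have key : ∀ ε : ℝ, 0 < ε → ‖inner ℂ (testL2 ω hχ) (T ψ) - inner ℂ (testL2 ω hχ) ψ‖ ≤
      C * (growthBound n r * ‖ψ‖) * √(∫ x, (truncWeight ε x)⁻¹ ^ 2 *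
        ‖(WithLp.toLp 2 (gradX χ x) : Cn n)‖ ^ 2 ∂(wMeasure ω)) := by
    intro ε hε
    obtain ⟨f, hf, hfr, hlim⟩ := exists_test_tendsto hr hψ
    have h1 : Tendsto (fun k => ‖inner ℂ (testL2 ω hχ) (T (testL2 ω (hf k))) -
        inner ℂ (testL2 ω hχ) (testL2 ω (hf k))‖) atTop
        (𝓝 ‖inner ℂ (testL2 ω hχ) (T ψ) - inner ℂ (testL2 ω hχ) ψ‖) :=
      ((tendsto_const_nhds.inner ((T.continuous.tendsto ψ).comp hlim)).sub
        (tendsto_const_nhds.inner hlim)).norm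
    refine le_of_tendsto_of_tendsto' h1
      (((hlim.norm.const_mul _).const_mul C).mul_const _) fun k => ?_
    refine ((hT _ (isWeight_truncWeight hε) (f k) χ (hf k) hχ).2).trans ?_
    gcongr
    exact sqrt_integral_truncWeight_le hε (hf k) (hfr k)
  have hlim := tendsto_one_div_add_atTop_nhds_zero_nat (𝕜 := ℝ)
  have hdct : Tendsto (fun k : ℕ => ∫ x, (truncWeight (1 / ((k : ℝ) + 1)) x)⁻¹ ^ 2 *
        ‖(WithLp.toLp 2 (gradX χ x) : Cn n)‖ ^ 2 ∂(wMeasure ω)) atTop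
      (𝓝 (∫ x, (growthWeight x)⁻¹ ^ 2 * ‖(WithLp.toLp 2 (gradX χ x) : Cn n)‖ ^ 2
        ∂(wMeasure ω))) := by
    refine tendsto_integral_of_dominated_convergence
      (fun x => 4 * ‖(WithLp.toLp 2 (gradX χ x) : Cn n)‖ ^ 2) (fun k => ?_)
      ((Continuous.integrable_of_hasCompactSupport (by fun_prop) hs).const_mul _)
      (fun k => ae_of_all _ fun x => ?_) (ae_of_all _ fun x => ?_)
    · simp only [inv_truncWeight]
      exact Continuous.aestronglyMeasurable (((hic.add continuous_const).pow 2).mul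
        (hgc.norm.pow 2))
    · rw [inv_truncWeight, Real.norm_of_nonneg (by positivity)]
      have h1 : (growthWeight x)⁻¹ ≤ 1 := inv_le_one_of_one_le₀ (one_le_growthWeight x)
      have h2 : 1 / ((k : ℝ) + 1) ≤ 1 :=
        div_le_self zero_le_one (by linarith [Nat.cast_nonneg (α := ℝ) k])
      have h3 := inv_pos.mpr (growthWeight_pos x)
      have h4 : 0 < 1 / ((k : ℝ) + 1) := by positivity
      have h5 : ((growthWeight x)⁻¹ + 1 / ((k : ℝ) + 1)) ^ 2 ≤ 4 := by nlinarith
      exact mul_le_mul_of_nonneg_right h5 (by positivity)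
    · simp only [inv_truncWeight]
      refine Tendsto.mul_const _ (Tendsto.pow ?_ 2)
      simpa using hlim.const_add (growthWeight x)⁻¹
  refine ge_of_tendsto' (((Real.continuous_sqrt.tendsto _).comp hdct).const_mul _) fun k => ?_
  exact key _ (by positivity)

/-- For each truncated weight, duality against test functions turns the bilinear estimate into a
norm bound independent of ε; Fatou's lemma removes the truncation. -/
theorem HasWeightedBounds.eLpNorm_le (hT : HasWeightedBounds ((n : ℝ) + 1) C T) (hC : 0 ≤ C)
    {r : ℝ} (hr : 0 < r) {ψ : L2w ω} (hψ : ∀ᵐ x ∂(wMeasure ω), r < ‖x‖ → ψ x = 0) :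
    eLpNorm (fun x => (growthWeight x : ℂ) * T ψ x) 2 (wMeasure ω) ≤
      ENNReal.ofReal (C * (growthBound n r * ‖ψ‖)) := by
  have hB := growthBound_pos (n := n) r
  have hK : 0 ≤ C * (growthBound n r * ‖ψ‖) := by positivity
  have hm : ∀ ε : ℝ, 0 < ε → MemLp (fun x => (truncWeight ε x : ℂ) * T ψ x) 2 (wMeasure ω) :=
    fun ε hε => memLp_mul_of_bounded (Complex.continuous_ofReal.comp
      (isWeight_truncWeight hε).smooth.continuous) (B := ε⁻¹) (fun x => by
        change ‖((truncWeight ε x : ℝ) : ℂ)‖ ≤ _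
        rw [Complex.norm_real, Real.norm_of_nonneg (truncWeight_pos hε.le x).le]
        exact truncWeight_le_inv hε x) (T ψ)
  have hbd : ∀ ε : ℝ, 0 < ε → eLpNorm (fun x => (truncWeight ε x : ℂ) * T ψ x) 2 (wMeasure ω) ≤
      ENNReal.ofReal (C * (growthBound n r * ‖ψ‖)) := by
    intro ε hε
    have h1 : ‖(hm ε hε).toLp‖ ≤ C * (growthBound n r * ‖ψ‖) := by
      refine norm_le_of_inner_test hK fun χ hχ => ?_
      have hEχ : IsTest fun x => (truncWeight ε x : ℂ) * χ x :=
        ⟨(Complex.ofRealCLM.contDiff.comp (isWeight_truncWeight hε).smooth).mul hχ.1,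
          hχ.2.mul_left⟩
      refine le_trans (le_of_eq ?_) (hT.norm_inner_le hC hr hψ hε hχ hEχ)
      congr 1
      rw [L2.inner_def, L2.inner_def]
      refine integral_congr_ae ?_
      filter_upwards [coeFn_testL2 (ω := ω) hχ, coeFn_testL2 (ω := ω) hEχ,
        (hm ε hε).coeFn_toLp] with x h2 h3 h4
      rw [h2, h3, h4]
      simp only [RCLike.inner_apply, map_mul, Complex.conj_ofReal]
      ring
    rw [Lp.norm_toLp] at h1
    rw [← ENNReal.ofReal_toReal (hm ε hε).2.ne]
    exact ENNReal.ofReal_le_ofReal h1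
  have hε : ∀ k : ℕ, (0 : ℝ) < 1 / ((k : ℝ) + 1) := fun k => by positivity
  have hlim := tendsto_one_div_add_atTop_nhds_zero_nat (𝕜 := ℝ)
  have hfatou := Lp.eLpNorm_lim_le_liminf_eLpNorm (p := 2) (μ := wMeasure ω)
    (f := fun k x => (truncWeight (1 / ((k : ℝ) + 1)) x : ℂ) * T ψ x)
    (fun k => (hm _ (hε k)).1) (fun x => (growthWeight x : ℂ) * T ψ x)
    (ae_of_all _ fun x => by
      refine Tendsto.mul_const _ ((Complex.continuous_ofReal.tendsto _).comp ?_)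
      have h1 : Tendsto (fun k : ℕ => growthWeight x / (1 + 1 / ((k : ℝ) + 1) * growthWeight x))
          atTop (𝓝 (growthWeight x / (1 + 0 * growthWeight x))) :=
        tendsto_const_nhds.div ((hlim.mul_const _).const_add 1) (by simp)
      simpa [truncWeight] using h1)
  refine hfatou.trans (liminf_le_of_le (by isBoundedDefault) fun b hb => ?_)
  obtain ⟨k, hk⟩ := hb.exists
  exact hk.trans (hbd _ (hε k))

theorem memLp_inv_growthWeight_ofReal :
    MemLp (fun x : Rn n => (((growthWeight x)⁻¹ : ℝ) : ℂ)) 2 (wMeasure ω) :=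
  (memLp_inv_growthWeight Fact.out).ofReal

theorem HasWeightedBounds.memLp (hT : HasWeightedBounds ((n : ℝ) + 1) C T) (hC : 0 ≤ C)
    {r : ℝ} (hr : 0 < r) {ψ : L2w ω} (hψ : ∀ᵐ x ∂(wMeasure ω), r < ‖x‖ → ψ x = 0) :
    MemLp (fun x => (growthWeight x : ℂ) * T ψ x) 2 (wMeasure ω) :=
  ⟨(Complex.continuous_ofReal.comp contDiff_growthWeight.continuous).aestronglyMeasurable.mul
    (Lp.aestronglyMeasurable _), (hT.eLpNorm_le hC hr hψ).trans_lt ENNReal.ofReal_lt_top⟩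

/-- Tψ is the product of growthWeight⁻¹ and growthWeight · Tψ, both in L²_ω. -/
theorem HasWeightedBounds.integrable (hT : HasWeightedBounds ((n : ℝ) + 1) C T) (hC : 0 ≤ C)
    {r : ℝ} (hr : 0 < r) {ψ : L2w ω} (hψ : ∀ᵐ x ∂(wMeasure ω), r < ‖x‖ → ψ x = 0) :
    Integrable (T ψ : Rn n → ℂ) (wMeasure ω) := by
  refine (memLp_inv_growthWeight_ofReal.integrable_mul (hT.memLp hC hr hψ)).congr
    (ae_of_all _ fun x => ?_)
  have : (growthWeight x : ℂ) ≠ 0 := by exact_mod_cast (growthWeight_pos x).ne'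
  simp [this]

theorem integrable_of_support {r : ℝ} {ψ : L2w ω}
    (hψ : ∀ᵐ x ∂(wMeasure ω), r < ‖x‖ → ψ x = 0) : Integrable (ψ : Rn n → ℂ) (wMeasure ω) := by
  have h1 : IntegrableOn (ψ : Rn n → ℂ) (Metric.closedBall 0 r) (wMeasure ω) := by
    have : IsFiniteMeasure ((wMeasure ω).restrict (Metric.closedBall (0 : Rn n) r)) :=
      ⟨by
        rw [Measure.restrict_apply_univ]
        exact (isCompact_closedBall _ _).measure_lt_top⟩
    exact ((Lp.memLp ψ).restrict _).integrable (by norm_num)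
  refine h1.integrable_of_ae_notMem_eq_zero ?_
  filter_upwards [hψ] with x hx hxr
  exact hx (by simpa using hxr)

theorem tendsto_inner_cutoff {f : L2w ω} (hf : Integrable (f : Rn n → ℂ) (wMeasure ω)) :
    Tendsto (fun k : ℕ => inner ℂ (testL2 ω (isTest_cutoff (n := n) (R := (k : ℝ) + 1)
      (by positivity))) f) atTop (𝓝 (∫ x, f x ∂(wMeasure ω))) := by
  simp only [inner_testL2]
  have hR : Tendsto (fun k : ℕ => (k : ℝ) + 1) atTop atTop :=
    tendsto_atTop_add_const_right _ _ tendsto_natCast_atTop_atTop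
  refine tendsto_integral_of_dominated_convergence (fun x => ‖f x‖) (fun k => ?_) hf.norm
    (fun k => ae_of_all _ fun x => ?_) (ae_of_all _ fun x => ?_)
  · have hc := (isTest_cutoff (n := n) (R := (k : ℝ) + 1) (by positivity)).1.continuous
    exact (Complex.continuous_conj.comp hc).aestronglyMeasurable.mul hf.1
  · rw [norm_mul, RCLike.norm_conj]
    exact mul_le_of_le_one_left (norm_nonneg _) (norm_cutoff_le _ _)
  · have h1 := (Complex.continuous_conj.tendsto _).comp ((tendsto_cutoff x).comp hR)
    simpa using h1.mul_const (f x)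

/-- Tested against cutoffs at scale k + 1, Tψ and ψ differ by O(1/(k+1)), since growthWeight⁻¹ is
square integrable. Both pairings converge to the integrals by dominated convergence. -/
theorem HasWeightedBounds.integral_eq (hT : HasWeightedBounds ((n : ℝ) + 1) C T) (hC : 0 ≤ C)
    {r : ℝ} (hr : 0 < r) {ψ : L2w ω} (hψ : ∀ᵐ x ∂(wMeasure ω), r < ‖x‖ → ψ x = 0) :
    ∫ x, T ψ x ∂(wMeasure ω) = ∫ x, ψ x ∂(wMeasure ω) := by
  obtain ⟨B, hB0, hB⟩ := exists_gradX_cutoff_le (n := n)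
  have hgb := growthBound_pos (n := n) r
  have hK : 0 ≤ C * (growthBound n r * ‖ψ‖) := by positivity
  have h1 := ((tendsto_inner_cutoff (hT.integrable hC hr hψ)).sub
    (tendsto_inner_cutoff (integrable_of_support hψ))).norm
  have hI : Integrable (fun x : Rn n => (growthWeight x)⁻¹ ^ 2) (wMeasure ω) :=
    (memLp_two_iff_integrable_sq (memLp_inv_growthWeight Fact.out).1).mp
      (memLp_inv_growthWeight Fact.out)
  have h2 : ∀ k : ℕ, ‖inner ℂ (testL2 ω (isTest_cutoff (n := n) (R := (k : ℝ) + 1)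
      (by positivity))) (T ψ) - inner ℂ (testL2 ω (isTest_cutoff (n := n) (R := (k : ℝ) + 1)
      (by positivity))) ψ‖ ≤ C * (growthBound n r * ‖ψ‖) * (1 / ((k : ℝ) + 1) * B *
        √(∫ x, (growthWeight (n := n) x)⁻¹ ^ 2 ∂(wMeasure ω))) := by
    intro k
    have hR : (0 : ℝ) < (k : ℝ) + 1 := by positivity
    refine (hT.norm_inner_sub_le hC hr hψ _).trans (mul_le_mul_of_nonneg_left ?_ hK)
    have h3 : ∫ x, (growthWeight x)⁻¹ ^ 2 *
        ‖(WithLp.toLp 2 (gradX (cutoff (n := n) ((k : ℝ) + 1)) x) : Cn n)‖ ^ 2 ∂(wMeasure ω) ≤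
        ∫ x, (growthWeight (n := n) x)⁻¹ ^ 2 * (1 / ((k : ℝ) + 1) * B) ^ 2 ∂(wMeasure ω) := by
      refine integral_mono_of_nonneg (ae_of_all _ fun x => by positivity) (hI.mul_const _)
        (ae_of_all _ fun x => ?_)
      have h4 := hB _ hR x
      simp only [one_div]
      gcongr
    refine (Real.sqrt_le_sqrt h3).trans (le_of_eq ?_)
    rw [integral_mul_const, Real.sqrt_mul' _ (sq_nonneg _), Real.sqrt_sq (by positivity), mul_comm]
  have h3 : Tendsto (fun k : ℕ => C * (growthBound n r * ‖ψ‖) * (1 / ((k : ℝ) + 1) * B *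
        √(∫ x, (growthWeight (n := n) x)⁻¹ ^ 2 ∂(wMeasure ω)))) atTop (𝓝 0) := by
    have := (((tendsto_one_div_add_atTop_nhds_zero_nat (𝕜 := ℝ)).mul_const B).mul_const
      (√(∫ x, (growthWeight (n := n) x)⁻¹ ^ 2 ∂(wMeasure ω)))).const_mul
        (C * (growthBound n r * ‖ψ‖))
    simpa using this
  have h4 := le_of_tendsto_of_tendsto' h1 h3 h2
  exact sub_eq_zero.mp (norm_le_zero_iff.mp h4)

theorem exists_radius {K : Set (Rn n)} (hK : IsCompact K) :
    ∃ r : ℝ, 0 < r ∧ ∀ x, r < ‖x‖ → x ∉ K := by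
  obtain ⟨r, hr, h⟩ := hK.isBounded.exists_pos_norm_le
  exact ⟨r, hr, fun x hx hxK => absurd (h x hxK) (not_le.mpr hx)⟩

theorem HasWeightedBounds.preservesIntegral (hT : HasWeightedBounds ((n : ℝ) + 1) C T)
    (hC : 0 ≤ C) : PreservesIntegral T := by
  rintro ψ ⟨K, hK, hψ⟩
  obtain ⟨r, hr, hrK⟩ := exists_radius hK
  have h : ∀ᵐ x ∂(wMeasure ω), r < ‖x‖ → ψ x = 0 := by
    filter_upwards [hψ] with x hx hxr
    exact hx (hrK x hxr)
  exact ⟨hT.integrable hC hr h, hT.integral_eq hC hr h⟩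

/-- The tails of the square integral of `growthWeight⁻¹`. -/
def tail (ω : Rn n → ℝ) (R : ℝ) : ℝ :=
  √(∫ x, (Metric.ball (0 : Rn n) R)ᶜ.indicator (fun x => (growthWeight x)⁻¹) x ^ 2 ∂(wMeasure ω))

theorem tendsto_tail : Tendsto (tail ω) atTop (𝓝 0) := by
  have hI : Integrable (fun x : Rn n => (growthWeight x)⁻¹ ^ 2) (wMeasure ω) :=
    (memLp_two_iff_integrable_sq (memLp_inv_growthWeight Fact.out).1).mp
      (memLp_inv_growthWeight Fact.out)
  have h1 : Tendsto (fun R => ∫ x, (Metric.ball (0 : Rn n) R)ᶜ.indicator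
      (fun x => (growthWeight x)⁻¹) x ^ 2 ∂(wMeasure ω)) atTop
      (𝓝 (∫ _, (0 : ℝ) ∂(wMeasure ω))) := by
    refine tendsto_integral_filter_of_dominated_convergence (fun x => (growthWeight x)⁻¹ ^ 2)
      (Eventually.of_forall fun R => ?_) (Eventually.of_forall fun R => ae_of_all _ fun x => ?_) hI
      (ae_of_all _ fun x => ?_)
    · exact (((memLp_inv_growthWeight Fact.out).1).indicator
        Metric.isOpen_ball.measurableSet.compl).pow 2
    · by_cases hx : x ∈ (Metric.ball (0 : Rn n) R)ᶜ
      · rw [indicator_of_mem hx, Real.norm_of_nonneg (by positivity)]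
      · rw [indicator_of_notMem hx]
        simp only [ne_eq, OfNat.ofNat_ne_zero, not_false_eq_true, zero_pow, norm_zero]
        positivity
    · refine tendsto_const_nhds.congr' ?_
      filter_upwards [eventually_gt_atTop ‖x‖] with R hR
      rw [indicator_of_notMem (by simpa using hR)]
      simp
  have h2 : Tendsto (tail ω) atTop (𝓝 √(∫ _, (0 : ℝ) ∂(wMeasure ω))) :=
    (Real.continuous_sqrt.tendsto _).comp h1
  simpa using h2

/-- Cauchy–Schwarz with growthWeight⁻¹ cut to the exterior and growthWeight · Tψ. The bound is
linear in ‖ψ‖, so it can be used with a ψ depending on R. -/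
theorem HasWeightedBounds.norm_integral_compl_le (hT : HasWeightedBounds ((n : ℝ) + 1) C T)
    (hC : 0 ≤ C) {r : ℝ} (hr : 0 < r) {ψ : L2w ω}
    (hψ : ∀ᵐ x ∂(wMeasure ω), r < ‖x‖ → ψ x = 0) (R : ℝ) :
    ‖∫ x in (Metric.ball (0 : Rn n) R)ᶜ, T ψ x ∂(wMeasure ω)‖ ≤
      tail ω R * (C * (growthBound n r * ‖ψ‖)) := by
  have hgb := growthBound_pos (n := n) r
  have hm := hT.memLp hC hr hψ
  have hms : MeasurableSet (Metric.ball (0 : Rn n) R)ᶜ := Metric.isOpen_ball.measurableSet.compl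
  have h1 := integral_mul_le_sqrt ((memLp_inv_growthWeight (ω := ω) Fact.out).indicator hms) hm.norm
  have h2 : √(∫ x, ‖(growthWeight x : ℂ) * T ψ x‖ ^ 2 ∂(wMeasure ω)) ≤
      C * (growthBound n r * ‖ψ‖) := by
    rw [← norm_toLp_sq hm, Real.sqrt_sq (norm_nonneg _), Lp.norm_toLp]
    exact ENNReal.toReal_le_of_le_ofReal (by positivity) (hT.eLpNorm_le hC hr hψ)
  refine le_trans ?_ (h1.trans (mul_le_mul_of_nonneg_left h2 (Real.sqrt_nonneg _)))
  refine (norm_integral_le_integral_norm _).trans (le_of_eq ?_)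
  rw [← integral_indicator hms]
  refine integral_congr_ae (ae_of_all _ fun x => ?_)
  have hg := growthWeight_pos x
  by_cases hx : x ∈ (Metric.ball (0 : Rn n) R)ᶜ
  · simp only [indicator_of_mem hx]
    rw [norm_mul, Complex.norm_real, Real.norm_of_nonneg hg.le, inv_mul_cancel_left₀ hg.ne']
  · simp only [indicator_of_notMem hx, zero_mul]

/-- The adjoint of an operator that conserves mass preserves constants. -/
theorem HasWeightedBounds.preservesOne (hT : HasWeightedBounds ((n : ℝ) + 1) C T) (hC : 0 ≤ C)
    (hω : IsA2 ω) {T' : L2w ω →L[ℂ] L2w ω} (hdual : ∀ f g, inner ℂ (T' f) g = inner ℂ f (T g)) :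
    PreservesOne hω T' := by
  intro K hK
  obtain ⟨r, hr, hrK⟩ := exists_radius hK
  have hgb := growthBound_pos (n := n) r
  have hm1 : MemLp (K.indicator fun _ => (1 : ℂ)) 2 (wMeasure ω) :=
    memLp_indicator_const 2 hK.measurableSet 1 (Or.inr hK.measure_lt_top.ne)
  have hm : ∀ R, MemLp (K.indicator fun x => T' (ballOne hω R) x - 1) 2 (wMeasure ω) := fun R => by
    refine (((Lp.memLp (T' (ballOne hω R))).indicator hK.measurableSet).sub hm1).ae_eq
      (ae_of_all _ fun x => ?_)
    by_cases hx : x ∈ K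
    · simp only [Pi.sub_apply, indicator_of_mem hx]
    · simp only [Pi.sub_apply, indicator_of_notMem hx, sub_zero]
  have hbd : ∀ R, eLpNorm (fun x => T' (ballOne hω R) x - 1) 2 ((wMeasure ω).restrict K) ≤
      ENNReal.ofReal (tail ω R * (C * growthBound n r)) := by
    intro R
    -- The error itself, restricted to K, serves as the function to which conservation of mass is
    -- applied.
    set ψ : L2w ω := (hm R).toLp with hψdef
    have hψe := (hm R).coeFn_toLp
    have hψ : ∀ᵐ x ∂(wMeasure ω), r < ‖x‖ → ψ x = 0 := by
      filter_upwards [hψe] with x hx hxr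
      rw [hx, indicator_of_notMem (hrK x hxr)]
    have hi := hT.integrable hC hr hψ
    have hself : inner ℂ ψ ψ = inner ℂ (T' (ballOne hω R)) ψ - ∫ x, ψ x ∂(wMeasure ω) := by
      rw [L2.inner_def, L2.inner_def, ← integral_sub (L2.integrable_inner _ _)
        (integrable_of_support hψ)]
      refine integral_congr_ae ?_
      filter_upwards [hψe] with x hx
      rw [hx]
      by_cases hxK : x ∈ K
      · simp only [indicator_of_mem hxK, RCLike.inner_apply, map_sub, map_one]
        ring
      · simp [indicator_of_notMem hxK]
    -- Duality turns ⟨ψ, T'1_B⟩, up to conjugation, into the integral of Tψ over B, while ∫ ψ = ∫ Tψ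
    -- over the whole space; the exterior integral remains.
    have hval : inner ℂ ψ ψ = -∫ x in (Metric.ball (0 : Rn n) R)ᶜ, T ψ x ∂(wMeasure ω) := by
      rw [hself, hdual, ballOne, L2.inner_indicatorConstLp_one, ← hT.integral_eq hC hr hψ,
        ← integral_add_compl (Metric.isOpen_ball (x := (0 : Rn n)) (ε := R)).measurableSet hi]
      ring
    have hle : ‖ψ‖ ^ 2 ≤ tail ω R * (C * (growthBound n r * ‖ψ‖)) := by
      have h1 := hT.norm_integral_compl_le hC hr hψ R
      rw [← norm_neg, ← hval, inner_self_eq_norm_sq_to_K, norm_pow, RCLike.norm_ofReal,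
        abs_norm] at h1
      exact h1
    have hψn : ‖ψ‖ ≤ tail ω R * (C * growthBound n r) := by
      have ht : 0 ≤ tail ω R := Real.sqrt_nonneg _
      have h0 : 0 ≤ tail ω R * (C * growthBound n r) := by positivity
      by_contra hcon
      push Not at hcon
      nlinarith [norm_nonneg ψ]
    rw [← eLpNorm_indicator_eq_eLpNorm_restrict hK.measurableSet,
      ← ENNReal.ofReal_toReal (hm R).2.ne]
    rw [hψdef, Lp.norm_toLp] at hψn
    exact ENNReal.ofReal_le_ofReal hψn
  have hlim : Tendsto (fun R => ENNReal.ofReal (tail ω R * (C * growthBound n r))) atTop (𝓝 0) := by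
    have h1 := ENNReal.tendsto_ofReal ((tendsto_tail (ω := ω)).mul_const (C * growthBound n r))
    simpa using h1
  exact tendsto_of_tendsto_of_tendsto_of_le_of_le tendsto_const_nhds hlim (fun _ => zero_le) hbd

end Conservation

/-! ### The two fundamental solutions as propagators adjoint to each other. -/

section Duality

variable {n : ℕ} {ω : Rn n → ℝ}
variable {A : ℝ → Rn n → Matrix (Fin n) (Fin n) ℂ}

theorem IsFundamentalSolution.isPropagator {Γ : ℝ → ℝ → (L2w ω →L[ℂ] L2w ω)}
    (h : IsFundamentalSolution ω A Γ) (hc : IsWeaklyContinuous Γ) : IsPropagator ω 1 A Γ where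
  represents φ ψ hφ hψ u G hu hw χ hχ := by
    filter_upwards [h.represents φ ψ hφ hψ u G hu (weakSol_one_iff.mp hw) χ hχ] with t ht
    rw [ht, setIntegral_eq_integral_of_forall_compl_eq_zero fun s hs => ?_]
    rw [h.causal t s (by simpa using hs)]
    simp
  causal t s hts := h.causal t s (by simpa using hts)
  bounded := h.bounded
  continuousOn_out s ψ χ := (hc.in_t s ψ χ).mono fun t ht => by simpa using ht
  continuousOn_in t ψ χ := (hc.in_s t ψ χ).mono fun s hs => by simpa using hs

/-- The backward operator is the case σ = -1 with the hermitian adjoint coefficients. Causality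
extends the half-line integral to ℝ, and the continuity hypotheses trade places because s is now the
output time. -/
theorem IsFundamentalSolutionStar.isPropagator {Γ' : ℝ → ℝ → (L2w ω →L[ℂ] L2w ω)}
    (h : IsFundamentalSolutionStar ω A Γ') (hc : IsWeaklyContinuous fun t s => Γ' s t) :
    IsPropagator ω (-1) (fun t x => (A t x).conjTranspose) Γ' where
  represents φ ψ hφ hψ u G hu hw χ hχ := by
    filter_upwards [h.represents φ ψ hφ hψ u G hu (weakSol_neg_one_iff.mp hw) χ hχ] with s hs
    rw [hs, setIntegral_eq_integral_of_forall_compl_eq_zero fun t ht => ?_]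
    rw [h.causal s t (by simpa using ht)]
    simp
  causal t s hts := h.causal t s (by linarith)
  bounded := h.bounded
  continuousOn_out s ψ χ := (hc.in_s s ψ χ).mono fun t ht => by simpa using ht
  continuousOn_in t ψ χ := (hc.in_t t ψ χ).mono fun s hs => by simpa using hs

variable [Fact (IsA2 ω)] {M ν : ℝ} {S S' : ℝ → ℝ → (L2w ω →L[ℂ] L2w ω)}

/-- Strong solutions of an equation and of the adjoint equation, tested against each other. -/
theorem StrongSol.inner_sourceVec_comm {hA : IsElliptic ω A M ν} {σ : ℝ} {F F' : testSpace n}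
    {Φ Φ' : ℕ → testSpace n} {V V' : EnergySpace ω} {ε ε' : ℕ → ℝ} (h : StrongSol hA σ F Φ V ε)
    (h' : StrongSol hA.conjTranspose (-σ) F' Φ' V' ε') :
    inner ℂ (sourceVec ω F') V = starRingEnd ℂ (inner ℂ (sourceVec ω F) V') := by
  have h1 := h'.tendsto_inner h.mem
  have h2 : Tendsto (fun k => starRingEnd ℂ (inner ℂ (sourceVec ω F) (energyMap ω (Φ' k)))) atTop
      (𝓝 (starRingEnd ℂ (inner ℂ (sourceVec ω F) V'))) :=
    (Complex.continuous_conj.tendsto _).comp (tendsto_const_nhds.inner h'.tendsto)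
  refine tendsto_nhds_unique h1 (h2.congr fun k => ?_)
  rw [h.inner_dual, inner_sourceVec_energyMap, ← integral_conj]
  simp

/-- The strong solution with source φ ⊗ ψ and the adjoint one with source b ⊗ χ are tested against
each other; representation rewrites both sides as averages of the propagators. -/
theorem IsPropagator.average_comm {σ : ℝ} (hσ : σ = 1 ∨ σ = -1) (hS : IsPropagator ω σ A S)
    (hA : IsElliptic ω A M ν)
    (hS' : IsPropagator ω (-σ) (fun t x => (A t x).conjTranspose) S')
    {ψ χ : L2w ω} (hψ : IsTestL2 ψ) (hχ : IsTestL2 χ) {l₁ l₁' l₂ l₂' : ℝ} {φ b : ℝ → ℝ}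
    (hφ : IsBump σ l₁ l₁' φ) (hb : IsBump σ l₂ l₂' b) :
    ∫ t, (b t : ℂ) * ∫ s, (φ s : ℂ) * inner ℂ χ (S t s ψ) =
      starRingEnd ℂ (∫ s, (φ s : ℂ) * ∫ t, (b t : ℂ) * inner ℂ ψ (S' s t χ)) := by
  obtain ⟨ψ₀, hψ₀, hψe⟩ := hψ
  obtain ⟨χ₀, hχ₀, hχe⟩ := hχ
  have hσ' : -σ = 1 ∨ -σ = -1 := by rcases hσ with rfl | rfl <;> simp
  have hu' : EnergyUnique ω (- -σ) fun t x => ((A t x).conjTranspose).conjTranspose := by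
    simpa using hS.energyUnique
  obtain ⟨Φ, V, ε, h⟩ := exists_strongSol hA hσ hS'.energyUnique (tensor (hφ.isTest hσ) hψ₀)
  obtain ⟨Φ', V', ε', h'⟩ := exists_strongSol hA.conjTranspose hσ' hu'
    (tensor (hb.isTest hσ) hχ₀)
  have h1 := hS.inner_sourceVec h hψe (hb.isTest hσ) hχ₀ hχe
  have h2 := hS'.inner_sourceVec h' hχe (hφ.isTest hσ) hψ₀ hψe
  simp only [Complex.conj_ofReal] at h1 h2
  rw [← h1, ← h2, h.inner_sourceVec_comm h']

/-- The propagators of an equation and of the adjoint equation are adjoint to each other. -/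
theorem IsPropagator.inner_comm {σ : ℝ} (hσ : σ = 1 ∨ σ = -1) (hS : IsPropagator ω σ A S)
    (hA : IsElliptic ω A M ν)
    (hS' : IsPropagator ω (-σ) (fun t x => (A t x).conjTranspose) S')
    {s₀ t₀ : ℝ} (hst : σ * s₀ ≤ σ * t₀) (χ ψ : L2w ω) :
    inner ℂ (S' s₀ t₀ χ) ψ = inner ℂ χ (S t₀ s₀ ψ) := by
  have hσ' : -σ = 1 ∨ -σ = -1 := by rcases hσ with rfl | rfl <;> simp
  have hu' : EnergyUnique ω (- -σ) fun t x => ((A t x).conjTranspose).conjTranspose := by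
    simpa using hS.energyUnique
  obtain ⟨C', hC'⟩ := hS'.bounded
  have key : ∀ ψ χ : L2w ω, IsTestL2 ψ → IsTestL2 χ →
      inner ℂ χ (S t₀ s₀ ψ) = starRingEnd ℂ (inner ℂ ψ (S' s₀ t₀ χ)) := by
    intro ψ χ hψ hχ
    have hbd := norm_inner_propagator_le hC' χ ψ
    have step : ∀ c c' b, σ * s₀ < c → IsBump σ c c' b →
        ∫ t, (b t : ℂ) * inner ℂ χ (S t s₀ ψ) =
          starRingEnd ℂ (∫ t, (b t : ℂ) * inner ℂ ψ (S' s₀ t χ)) := by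
      intro c c' b hc hb
      obtain ⟨φ, l, l', hφ, hl, -, hlim⟩ := exists_isBump_seq hσ s₀ one_pos
      have h1 := hS.tendsto_average hσ hA hS'.energyUnique hc hψ hχ hb (fun k => (hl k).le)
        hlim hφ
      -- For the adjoint propagator s is the output time. As b lives strictly after s₀, every t in
      -- its support stays after s for s near s₀, where the pairing is continuous.
      have hcont : ContinuousAt (fun s => ∫ t, (b t : ℂ) * inner ℂ ψ (S' s t χ)) s₀ := by
        have ho : IsOpen {s : ℝ | σ * s < c} := isOpen_lt (by fun_prop) (by fun_prop)
        refine continuousAt_of_dominated (bound := fun t => ‖b t‖ * (‖ψ‖ * (C' * ‖χ‖)))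
          (Eventually.of_forall fun s => hb.integrable.ofReal.1.mul
            (hS'.measurable_in χ ψ s).aestronglyMeasurable)
          (Eventually.of_forall fun s => ae_of_all _ fun t => ?_)
          (hb.integrable.norm.mul_const _) (ae_of_all _ fun t => ?_)
        · rw [norm_mul, Complex.norm_real]
          exact mul_le_mul_of_nonneg_left (hbd s t) (norm_nonneg _)
        · by_cases h0 : b t = 0
          · simp only [h0, Complex.ofReal_zero, zero_mul]
            exact continuousAt_const
          · have ht := (hb.supp t h0).1
            refine continuousAt_const.mul ((hS'.continuousOn_out t χ ψ).continuousAt ?_)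
            refine mem_of_superset (ho.mem_nhds hc) fun s hs => ?_
            have hs' : σ * s < c := hs
            change -σ * t ≤ -σ * s
            linarith
      have h2 := tendsto_integral_isBump hσ (fun k => (hl k).le) hlim hφ
        hcont.continuousWithinAt fun k => (hφ k).integrable_mul
          (hS'.aestronglyMeasurable_integral hσ' hA.conjTranspose hu' (hb.isTest hσ) hχ hψ)
          fun s => hb.norm_integral_le (hbd s)
      refine tendsto_nhds_unique h1 (((Complex.continuous_conj.tendsto _).comp h2).congr
        fun k => (hS.average_comm hσ hA hS' hψ hχ (hφ k) hb).symm)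
    obtain ⟨b, l, l', hb, hl, -, hlim⟩ := exists_isBump_seq hσ t₀ one_pos
    have h1 := hS.tendsto_out hσ hst ψ χ (fun k => (hl k).le) hlim hb
    have hset : ∀ t, σ * t₀ ≤ σ * t → t ∈ {t : ℝ | -σ * t ≤ -σ * s₀} := fun t ht => by
      change -σ * t ≤ -σ * s₀
      linarith
    have h2 := tendsto_integral_isBump hσ (τ := t₀) (f := fun t => inner ℂ ψ (S' s₀ t χ))
      (fun k => (hl k).le) hlim hb
      ((hS'.continuousOn_in s₀ χ ψ t₀ (hset t₀ le_rfl)).mono fun t ht => hset t ht)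
      fun k => (hb k).integrable_mul (hS'.measurable_in χ ψ s₀).aestronglyMeasurable (hbd s₀)
    refine tendsto_nhds_unique h1 (((Complex.continuous_conj.tendsto _).comp h2).congr
      fun k => (step _ _ _ (hst.trans_lt (hl k)) (hb k)).symm)
  -- Both sides are continuous in the two vectors, so density of test functions gives the identity
  -- on all of L²_ω.
  have hcl : IsClosed {p : L2w ω × L2w ω | inner ℂ (S' s₀ t₀ p.1) p.2 =
      inner ℂ p.1 (S t₀ s₀ p.2)} := isClosed_eq (by fun_prop) (by fun_prop)
  have hd := (dense_isTestL2 (ω := ω)).prod (dense_isTestL2 (ω := ω))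
  refine hcl.closure_subset_iff.mpr ?_ (hd (χ, ψ))
  rintro ⟨f, g⟩ ⟨hf, hg⟩
  change inner ℂ (S' s₀ t₀ f) g = inner ℂ f (S t₀ s₀ g)
  rw [key g f hg hf, inner_conj_symm]

/-- Conservation of mass for a propagator, and of constants for its adjoint. -/
theorem IsPropagator.conservation {σ : ℝ} (hσ : σ = 1 ∨ σ = -1) (hS : IsPropagator ω σ A S)
    (hA : IsElliptic ω A M ν)
    (hS' : IsPropagator ω (-σ) (fun t x => (A t x).conjTranspose) S') (hω : IsA2 ω)
    {s₀ t₀ : ℝ} (hst : σ * s₀ ≤ σ * t₀) :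
    PreservesIntegral (S t₀ s₀) ∧ PreservesOne hω (S' s₀ t₀) := by
  obtain ⟨C, hC, hT⟩ := hS.exists_bounds hσ hA hS'.energyUnique hst ((n : ℝ) + 1)
  have hT' : HasWeightedBounds ((n : ℝ) + 1) C (S t₀ s₀) := hT
  exact ⟨hT'.preservesIntegral hC, hT'.preservesOne hC hω (hS.inner_comm hσ hA hS' hst)⟩

end Duality

end DegenerateParabolic

end

theorem mainTheorem3 {n : ℕ} (hn : 1 ≤ n) {ω : DegenerateParabolic.Rn n → ℝ}
    (hω : DegenerateParabolic.IsA2 ω)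
    {A : ℝ → DegenerateParabolic.Rn n → Matrix (Fin n) (Fin n) ℂ} {M ν : ℝ}
    (hA : DegenerateParabolic.IsElliptic ω A M ν)
    {Γ Γ' : ℝ → ℝ → (DegenerateParabolic.L2w ω →L[ℂ] DegenerateParabolic.L2w ω)}
    (hΓ : DegenerateParabolic.IsFundamentalSolution ω A Γ)
    (hΓc : DegenerateParabolic.IsWeaklyContinuous Γ)
    (hΓ' : DegenerateParabolic.IsFundamentalSolutionStar ω A Γ')
    (hΓc' : DegenerateParabolic.IsWeaklyContinuous fun t s => Γ' s t)
    (s t : ℝ) (hst : s ≤ t) :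
    (DegenerateParabolic.PreservesOne hω (Γ t s) ∧
      DegenerateParabolic.PreservesIntegral (Γ' s t)) ∧
    (DegenerateParabolic.PreservesOne hω (Γ' s t) ∧
      DegenerateParabolic.PreservesIntegral (Γ t s)) := by
  have : Fact (DegenerateParabolic.IsA2 ω) := ⟨hω⟩
  have hS := hΓ.isPropagator hΓc
  have hS' := hΓ'.isPropagator hΓc'
  -- For the second half the roles are exchanged: the adjoint of the backward equation is the
  -- forward one, since A** = A and two time reversals cancel.
  have hS₂ : DegenerateParabolic.IsPropagator ω (- -1)
      (fun t x => ((A t x).conjTranspose).conjTranspose) Γ := by simpa using hS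
  obtain ⟨h1, h2⟩ := hS.conservation (Or.inl rfl) hA hS' hω (s₀ := s) (t₀ := t) (by linarith)
  obtain ⟨h3, h4⟩ := hS'.conservation (Or.inr rfl) hA.conjTranspose hS₂ hω (s₀ := t) (t₀ := s)
    (by linarith)
  exact ⟨⟨h4, h3⟩, h2, h1⟩
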